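/- All schemes are of finite type over a fixed field $k$; a variety is an integral scheme (of finite type over $k$, not assumed separated), and a subvariety is an integral closed subscheme. For a closed subset $S$ of a variety $X$ let $Z_n(S)$ be the free abelian group on the $n$-dimensional subvarieties of $X$ contained in $S$, let $W_n(S)=\bigoplus_V k(V)^*$, the sum over the $(n+1)$-dimensional subvarieties $V\subset S$, let $\partial\colon W_n(S)\to Z_n(S)$ be the homomorphism sending $y\in k(V)^*$ to $\sum_W \mathrm{ord}_W(y)[W]$, the sum over the subvarieties $W\subset V$ of codimension one, and let $A_n(S)=Z_n(S)/\partial W_n(S)$. If $D$ is a Cartier divisor on a variety $X$ with normalization $\pi\colon\widehat X\to X$, its support $|D|$ is the union of the images $\pi(W)$ of the subvarieties $W\subset\widehat X$ of codimension one with $\mathrm{ord}_W(\pi^*D)\neq 0$. A $P$-divisor on $X$ is a tuple $(U,U',x)$ where $U,U'$ are nonempty open subschemes with $U\cup U'=X$, $x\in k(U)^*$ restricts to an element of $\mathcal O^*(U\cap U')$, and the Cartier divisor $D$ with local equation $x$ on $U$ and $1$ on $U'$ satisfies $|D|=X\setminus U'$. If $V$ is a variety and $f\colon V\to X$ is a morphism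 with $f(V)\not\subset|D|$, let $f^*x$ be the pull-back of $x$, which is a local equation of $f^*D$ on $f^{-1}(U)$, while $1$ is one on $f^{-1}(U')$. (If $f^{-1}(U)=\emptyset$, put $f^*x=1$.) Let $D$ be a $P$-divisor on a variety $X$. Let $D\cdot{-}\colon Z_n(X)\to Z_{n-1}(|D|)$ be the homomorphism with $D\cdot[V]=[D|_V]$, the Weil divisor of the restriction of $D$ to $V$, if $V\not\subset|D|$, and $D\cdot[V]=0$ if $V\subset|D|$. For a subvariety $V\subset X$ of dimension $n+1$ and $y\in k(V)^*$ put $D\cdot y=0$ if $V\subset|D|$, and otherwise, with the normalization $\pi\colon\widehat V\to V$ (and $x$, $y$ also denoting their pull-backs to $\widehat V$), $$D\cdot y=\pi_*\Bigl(\bigoplus_{W}\bigl(y^{\mathrm{ord}_W x}/x^{\mathrm{ord}_W y}\bigr)\big|_W\Bigr)\in W_{n-1}(|D|),$$ where $W$ runs over the subvarieties of codimension one of $\widehat V$ contained in $\pi^{-1}(|D|)=\widehat V\setminus\pi^{-1}(U')$, and $\pi_*$ is the push-forward of rational equivalences, given by the norms $k(W)^*\to k(\pi(W))^*$. Extend this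 additively to a map $D\cdot{-}\colon W_n(X)\to W_{n-1}(|D|)$. **Proposition.** For every integer $n$, the map $D\cdot{-}\colon W_n(X)\to W_{n-1}(|D|)$ is a homomorphism of groups, and for every $\alpha\in W_n(X)$ $$\partial(D\cdot\alpha)=D\cdot(\partial\alpha)\quad\text{in } Z_{n-1}(|D|).$$ Consequently the map $D\cdot{-}\colon Z_n(X)\to Z_{n-1}(|D|)$ induces a homomorphism $A_n(X)\to A_{n-1}(|D|)$. -/

import Mathlib

open AlgebraicGeometry CategoryTheory TopologicalSpace Order

universe u

set_option linter.unusedSectionVars false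

noncomputable section

namespace DivisorIntersection

/-! ### Rational functions and orders of vanishing -/

/-- The pull-back to the function field of an integral scheme `Y` of a rational function `y` on the
subvariety of `X` with generic point `v`, i.e. of `y ∈ κ(v)`, along a morphism `g : Y ⟶ X` that maps
the generic point of `Y` to `v`. -/
def pullFun {X Y : Scheme.{u}} [IsIntegral Y] (g : Y ⟶ X) {v : X} (hv : v = g (genericPoint Y)) :
    X.residueField v →+* Y.functionField :=
  ((X.residueFieldCongr hv).hom ≫
    Scheme.descResidueField (K := Y.functionField) (g.stalkMap (genericPoint Y))).hom

/-- The order of vanishing of the rational function `g = a / b` along the codimension one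
subvariety with generic point `w`: the length of `𝒪_w / a` minus the length of `𝒪_w / b`. (It is set
to be `0` if `w` is not of codimension one.) -/
def ordAt (Y : Scheme.{u}) [IsIntegral Y] (g : Y.functionField) (w : Y) : ℤ :=
  open scoped Classical in
  let ab := IsLocalization.sec (nonZeroDivisors (Y.presheaf.stalk w)) g
  if coheight w = 1 then
    ((Ring.ord (Y.presheaf.stalk w) ab.1).toNat : ℤ) -
      ((Ring.ord (Y.presheaf.stalk w) (ab.2 : Y.presheaf.stalk w)).toNat : ℤ)
  else 0

/-- On locally Noetherian integral schemes, `ordAt` is Mathlib's order of vanishing. -/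
theorem ordAt_eq_ord (Y : Scheme.{u}) [IsIntegral Y] [IsLocallyNoetherian Y] (g : Y.functionField)
    (hg : g ≠ 0) (w : Y) : ordAt Y g w = Scheme.ord g w := by
  classical
  by_cases hw : coheight w = 1
  · symm
    rw [Scheme.ord_eq_iff hw hg]
    have : Ring.KrullDimLE 1 (Y.presheaf.stalk w) := krullDimLE_of_coheight_le hw.le
    set M := nonZeroDivisors (Y.presheaf.stalk w)
    set ab := IsLocalization.sec M g with hab
    have h1 : g * algebraMap _ Y.functionField (ab.2 : Y.presheaf.stalk w) =
      algebraMap _ Y.functionField ab.1 := IsLocalization.sec_spec M g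
    have h2 : algebraMap _ Y.functionField (ab.2 : Y.presheaf.stalk w) ≠ 0 :=
      IsFractionRing.to_map_ne_zero_of_mem_nonZeroDivisors ab.2.2
    have h3 : ab.1 ∈ M := by
      refine mem_nonZeroDivisors_of_ne_zero ?_
      intro h
      rw [h, map_zero] at h1
      exact mul_ne_zero hg h2 h1
    have h4 : g = IsLocalization.mk' Y.functionField ab.1 ab.2 := by
      rw [hab, IsLocalization.mk'_sec]
    have key : ∀ a : M, Ring.ordMonoidWithZeroHom (Y.presheaf.stalk w) (a : Y.presheaf.stalk w) =
        ((Multiplicative.ofAdd (((Ring.ord (Y.presheaf.stalk w)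
          (a : Y.presheaf.stalk w)).toNat : ℤ)) : Multiplicative ℤ) : WithZero _) := fun a =>
      Ring.ordMonoidWithZeroHom_eq_coe _ a.2 (ENat.natCast_toNat (Ring.ord_ne_top a.2)).symm
    change Ring.ordFrac (Y.presheaf.stalk w) g = _
    rw [show ordAt Y g w = _ from if_pos hw]
    conv_lhs => rw [h4]
    rw [Ring.ordFrac_eq_div _ ⟨ab.1, h3⟩ ab.2, key, key, ofAdd_sub, WithZero.coe_div]
  · rw [Scheme.ord_eq_zero_of_coheight_neq_one hw]
    exact if_neg hw

/-- A nonzero rational function on a Noetherian integral scheme has only finitely many zeros and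
poles. -/
theorem ordAt_support_finite (Y : Scheme.{u}) [IsIntegral Y] [AlgebraicGeometry.IsNoetherian Y]
    (g : Y.functionField) (hg : g ≠ 0) : (Function.support (ordAt Y g)).Finite := by
  obtain ⟨U, -, f, hU, rfl, hf⟩ := exists_isUnit_germ_eq Y g hg
  set Z : Set Y := (U : Set Y)ᶜ with hZ
  have hZc : IsClosed Z := U.isOpen.isClosed_compl
  have hη : genericPoint Y ∈ U :=
    ((genericPoint_spec Y).mem_open_set_iff U.isOpen).mpr (by simpa using hU)
  obtain ⟨S, hS, hZS⟩ := NoetherianSpace.exists_finset_irreducible (⟨Z, hZc⟩ : Closeds Y)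
  refine (Set.finite_range fun k : S => (hS k).genericPoint).subset ?_
  intro w hw
  have hwc : coheight w = 1 := by
    by_contra h
    exact hw (if_neg h)
  have hwZ : w ∈ Z := fun hwU => hw (by rw [ordAt_eq_ord Y _ hg, Scheme.ord_of_isUnit hf hwU])
  have hmem : w ∈ ((S.sup id : Closeds Y) : Set Y) := by
    rw [← hZS]; exact hwZ
  have hmem' : ∃ k ∈ S, w ∈ k := by
    simpa [Closeds.coe_finset_sup] using hmem
  obtain ⟨k, hk, hwk⟩ := hmem'
  refine ⟨⟨k, hk⟩, ?_⟩
  have hgen : IsGenericPoint (hS ⟨k, hk⟩).genericPoint (k : Set Y) := by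
    have := (hS ⟨k, hk⟩).isGenericPoint_genericPoint_closure
    rwa [k.isClosed.closure_eq] at this
  set z := (hS ⟨k, hk⟩).genericPoint
  have hwz : w ≤ z := hgen.specializes hwk
  have hzZ : z ∈ Z := by
    have h1 : k ≤ (⟨Z, hZc⟩ : Closeds Y) := by
      rw [hZS]; exact Finset.le_sup (f := id) hk
    exact h1 hgen.mem
  by_contra hne
  have hwz' : w < z := lt_of_le_not_ge hwz fun h => hne (Specializes.antisymm hwz h).eq
  have hzη : z < genericPoint Y := by
    refine lt_of_le_not_ge (genericPoint_specializes z) fun h => ?_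
    exact hzZ (Specializes.mem_open h U.isOpen hη)
  have h1 := coheight_add_one_le hwz'
  have h2 := coheight_add_one_le hzη
  rw [hwc] at h1
  have h3 : (1 : ℕ∞) ≤ coheight z := le_trans le_add_self h2
  have h4 : (1 : ℕ∞) + 1 ≤ 1 := (add_le_add_left h3 1).trans h1
  exact absurd h4 (by decide)

/-- `g|_W` for a rational function `g` which is a unit at the generic point `w` of `W`, as an
element of `k(W)^* = κ(w)^*`: the residue class of the unit of `𝒪_w` which `g` is. (It is set to
be `1` if `g` is not a unit at `w`.) -/
def restrictTo {Y : Scheme.{u}} [IsIntegral Y] (g : Y.functionField) (w : Y) :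
    (Y.residueField w)ˣ :=
  open scoped Classical in
  if h : ∃ a : (Y.presheaf.stalk w)ˣ,
      algebraMap (Y.presheaf.stalk w) Y.functionField (a : Y.presheaf.stalk w) = g then
    Units.map ((Y.residue w).hom : Y.presheaf.stalk w →* Y.residueField w) h.choose
  else 1

/-- The norm `k(W)^* → k(f(W))^*`, where `W` is the subvariety with generic point `w`. -/
def normTo {Y X : Scheme.{u}} (f : Y ⟶ X) (w : Y) :
    (Y.residueField w)ˣ →* (X.residueField (f w))ˣ :=
  letI : Algebra (X.residueField (f w)) (Y.residueField w) := (f.residueFieldMap w).hom.toAlgebra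
  Units.map (Algebra.norm (X.residueField (f w)))

/-! ### Subvarieties and their normalizations -/

section Subvarieties

variable {X : Scheme.{u}} [AlgebraicGeometry.IsNoetherian X]

/-- The subvariety of `X` with generic point `v`: the closure of `v` with its reduced structure,
constructed as the scheme-theoretic image of `Spec κ(v) ⟶ X`. -/
def subvar (v : X) : Scheme.{u} := (X.fromSpecResidueField v).image

/-- The closed immersion of a subvariety. -/
def subvarι (v : X) : subvar v ⟶ X := (X.fromSpecResidueField v).imageι

instance (v : X) : IsClosedImmersion (subvarι v) := by
  unfold subvarι subvar Scheme.Hom.imageι Scheme.Hom.image; infer_instance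

instance (v : X) : IsIntegral (subvar v) := by
  set f := X.fromSpecResidueField v with hf
  have hred : IsReduced f.image := by
    have (U : X.affineOpens) : _root_.IsReduced Γ(f.image, f.imageι ⁻¹ᵁ U.1) :=
      isReduced_of_injective (f.toImage.app (f.imageι ⁻¹ᵁ U.1)).hom (f.toImage_app_injective U)
    refine @isReduced_of_isReduced_stalk _ fun x => ?_
    obtain ⟨_, ⟨U, hU, rfl⟩, hxU, -⟩ := X.isBasis_affineOpens.exists_subset_of_mem_open
      (Set.mem_univ (f.imageι x)) isOpen_univ
    have hV : IsAffineOpen (f.imageι ⁻¹ᵁ U) := hU.preimage _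
    have h1 := this ⟨U, hU⟩
    let := TopCat.Presheaf.algebra_section_stalk f.image.presheaf
      (⟨x, hxU⟩ : (f.imageι ⁻¹ᵁ U : f.image.Opens))
    have h2 := hV.isLocalization_stalk ⟨x, hxU⟩
    exact isReduced_localizationPreserves (hV.primeIdealOf ⟨x, hxU⟩).asIdeal.primeCompl _ h1
  have : IsReduced (subvar v) := hred
  have hirr : IrreducibleSpace (subvar v) := by
    rw [irreducibleSpace_def]
    convert! ((IrreducibleSpace.isIrreducible_univ (Spec (X.residueField v))).image _
          f.toImage.continuous.continuousOn).closure
    rw [Set.image_univ]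
    exact f.toImage.denseRange.closure_range.symm
  exact isIntegral_of_irreducibleSpace_of_isReduced _

instance (v : X) : AlgebraicGeometry.IsNoetherian (subvar v) where
  toIsLocallyNoetherian := LocallyOfFiniteType.isLocallyNoetherian (subvarι v)
  toCompactSpace := (subvarι v).isClosedEmbedding.compactSpace

/-- A dominant morphism of irreducible schemes maps the generic point to the generic point. -/
theorem map_genericPoint {Y Z : Scheme.{u}} [IrreducibleSpace Y] [IrreducibleSpace Z] (f : Y ⟶ Z)
    (hf : IsDominant f) : f (genericPoint Y) = genericPoint Z := by
  refine IsGenericPoint.eq (S := Set.univ) ?_ (genericPoint_spec Z)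
  have := (genericPoint_spec Y).image f.continuous
  rwa [Set.image_univ, f.denseRange.closure_range] at this

theorem subvarι_genericPoint (v : X) : v = subvarι v (genericPoint (subvar v)) := by
  have h : (X.fromSpecResidueField v).toImage (genericPoint _) = genericPoint (subvar v) :=
    map_genericPoint (Z := subvar v) (X.fromSpecResidueField v).toImage
      (inferInstanceAs (IsDominant (X.fromSpecResidueField v).toImage))
  rw [← h]
  change v = ((X.fromSpecResidueField v).toImage ≫ (X.fromSpecResidueField v).imageι) _
  rw [Scheme.Hom.toImage_imageι, Scheme.fromSpecResidueField_apply]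

/-- The normalization of the subvariety with generic point `v`: the normalization of `X` in
`Spec κ(v)`. -/
def normSubvar (v : X) : Scheme.{u} := (X.fromSpecResidueField v).normalization

/-- The normalization map `π` of the subvariety `V` with generic point `v`, composed with the
inclusion of `V` in `X`. -/
def normSubvarπ (v : X) : normSubvar v ⟶ X := (X.fromSpecResidueField v).fromNormalization

instance (v : X) : IsIntegral (normSubvar v) := by
  unfold normSubvar; infer_instance

theorem normSubvarπ_genericPoint (v : X) : v = normSubvarπ v (genericPoint (normSubvar v)) := by
  have h : (X.fromSpecResidueField v).toNormalization (genericPoint _) =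
      genericPoint (normSubvar v) :=
    map_genericPoint (Z := normSubvar v) (X.fromSpecResidueField v).toNormalization
      (inferInstanceAs (IsDominant (X.fromSpecResidueField v).toNormalization))
  rw [← h]
  change v = ((X.fromSpecResidueField v).toNormalization ≫
    (X.fromSpecResidueField v).fromNormalization) _
  rw [Scheme.Hom.toNormalization_fromNormalization, Scheme.fromSpecResidueField_apply]

/-! ### Cycles and rational equivalences -/

/-- The subvariety with generic point `v` has dimension `k`. (In the order of the points of a
scheme, `a ≤ b` means that `a` lies in the closure of `b`.) -/
def IsDim (v : X) (k : ℤ) : Prop := ∃ n : ℕ, height v = n ∧ (n : ℤ) = k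

/-- The `k`-dimensional subvarieties of (the reduced subscheme on) a closed subset `S` of `X`, given
by their generic points. -/
abbrev Subvar (S : Closeds X) (k : ℤ) : Type u := {v : X // v ∈ S ∧ IsDim v k}

/-- `Z_k(S)`: the group of `k`-dimensional cycles on `S`. -/
abbrev Z (S : Closeds X) (k : ℤ) : Type u := Subvar S k →₀ ℤ

/-- `W_k(S)`: the group of rational equivalences of `k`-dimensional cycles on `S`, i.e. the direct
sum of the groups `k(V)^*` over the `(k + 1)`-dimensional subvarieties `V` of `S`. -/
abbrev W (S : Closeds X) (k : ℤ) : Type u :=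
  DirectSum (Subvar S (k + 1)) fun v => Additive (X.residueField v.1)ˣ

/-- The rational function `y ∈ k(V)^*` on the scheme `V`. -/
def funOn (v : X) (y : (X.residueField v)ˣ) : (subvar v).functionField :=
  pullFun (subvarι v) (subvarι_genericPoint v) (y : X.residueField v)

theorem funOn_ne_zero (v : X) (y : (X.residueField v)ˣ) : funOn v y ≠ 0 :=
  (map_ne_zero _).mpr y.ne_zero

/-- The Weil divisor of a rational function on the subvariety with generic point `v`. -/
def weilDiv (v : X) (y : (X.residueField v)ˣ) : subvar v →₀ ℤ :=
  Finsupp.ofSupportFinite (ordAt (subvar v) (funOn v y))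
    (ordAt_support_finite _ _ (funOn_ne_zero v y))

/-- A combination of points of `V` as a cycle of dimension `k` on `S ⊆ X`: the sum is taken over
those subvarieties of `V` which lie in `S` and have dimension `k`. -/
def toCycle (S : Closeds X) (k : ℤ) (v : X) : (subvar v →₀ ℤ) →+ Z S k :=
  (Finsupp.comapDomain.addMonoidHom (Subtype.val_injective (p := fun w : X => w ∈ S ∧ IsDim w k))).comp
    (Finsupp.mapDomain.addMonoidHom (subvarι v))

/-- The boundary map `∂ : W_k(S) → Z_k(S)`, sending `y ∈ k(V)^*` to
`∑ ord_W(y) [W]`, the sum over all subvarieties `W` of `V` of codimension one, i.e. of dimension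
`dim V - 1 = k`. -/
def boundary (S : Closeds X) (k : ℤ) : W S k →+ Z S k :=
  open scoped Classical in
  DirectSum.toAddMonoid fun v =>
    { toFun := fun y => toCycle S k v.1 (weilDiv v.1 y.toMul)
      map_zero' := by
        convert! (toCycle S k v.1).map_zero
        ext w
        change ordAt _ (funOn v.1 1) w = 0
        rw [ordAt_eq_ord _ _ (funOn_ne_zero _ _)]
        have h : funOn v.1 1 = 1 := by simp [funOn]
        by_cases hw : coheight w = 1
        · rw [Scheme.ord_eq_iff hw (funOn_ne_zero _ _), h, map_one]; rfl
        · simp [hw]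
      map_add' := fun y z => by
        rw [← map_add]
        congr 1
        ext w
        change ordAt _ (funOn v.1 (y.toMul * z.toMul)) w =
          ordAt _ (funOn v.1 y.toMul) w + ordAt _ (funOn v.1 z.toMul) w
        have h : funOn v.1 (y.toMul * z.toMul) = funOn v.1 y.toMul * funOn v.1 z.toMul := by
          simp [funOn]
        rw [h, ordAt_eq_ord _ _ (funOn_ne_zero _ _), ordAt_eq_ord _ _ (funOn_ne_zero _ _),
          ordAt_eq_ord _ _ (mul_ne_zero (funOn_ne_zero _ _) (funOn_ne_zero _ _)),
          Scheme.ord_mul (funOn_ne_zero _ _) (funOn_ne_zero _ _)] }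

/-- The Chow group `A_k(S)`: cycles modulo the boundaries of rational equivalences. -/
abbrev Chow (S : Closeds X) (k : ℤ) : Type u := Z S k ⧸ (boundary S k).range

/-! ### `P`-divisors -/

/-- The rational function `y ∈ k(V)^*` on the normalization of `V`. -/
def funOnNorm (v : X) (y : (X.residueField v)ˣ) : (normSubvar v).functionField :=
  pullFun (normSubvarπ v) (normSubvarπ_genericPoint v) (y : X.residueField v)

/-- A nonzero element of the function field of `X` as an element of the residue field at the generic
point. -/
def ratFun [IsIntegral X] (x : (X.functionField)ˣ) : (X.residueField (genericPoint X))ˣ :=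
  Units.map ((X.residue (genericPoint X)).hom : X.functionField →* X.residueField (genericPoint X)) x

/-- The support `|D|` of the Cartier divisor `D` on the variety `X` with local equation `x` on `U`
and local equation `1` on `U'`, where `U ∪ U' = X` and `x` is a unit on `U ∩ U'`: the image in `X` of
the union of those `W` of codimension one in the normalization `π : X̂ ⟶ X` for which
`ord_W (π^* D) ≠ 0`. This order is that of `x` if `W` meets `π⁻¹(U)`, and zero otherwise. -/
def cartierSupport [IsIntegral X] (U : X.Opens) (x : (X.functionField)ˣ) : Set X :=
  normSubvarπ (genericPoint X) ''
    ⋃ w ∈ {w : normSubvar (genericPoint X) | coheight w = 1 ∧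
      normSubvarπ (genericPoint X) w ∈ U ∧ ordAt _ (funOnNorm (genericPoint X) (ratFun x)) w ≠ 0},
    closure {w}

variable (X) in
/-- A `P`-divisor `(U, U', x)` on the variety `X`. -/
structure PDivisor [IsIntegral X] where
  /-- The open subscheme on which `D` has local equation `x`. -/
  U : X.Opens
  /-- The open subscheme on which `D` has local equation `1`. -/
  U' : X.Opens
  nonempty : (U : Set X).Nonempty
  nonempty' : (U' : Set X).Nonempty
  cover : U ⊔ U' = ⊤
  /-- The local defining function, in `k(U)^* = k(X)^*`. -/
  x : (X.functionField)ˣ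
  isUnit : ∃ (h : genericPoint X ∈ U ⊓ U') (s : Γ(X, U ⊓ U')ˣ),
    X.presheaf.germ (U ⊓ U') (genericPoint X) h (s : Γ(X, U ⊓ U')) = x
  support_eq : cartierSupport U x = (U' : Set X)ᶜ

namespace PDivisor

variable [IsIntegral X] (D : PDivisor X)

/-- The support `|D|` of a `P`-divisor, a closed subset of `X`. -/
def supp : Closeds X :=
  ⟨cartierSupport D.U D.x, by rw [D.support_eq]; exact D.U'.isOpen.isClosed_compl⟩

/-- The local defining function as a unit of `𝒪(U ∩ U')`. -/
def sec : Γ(X, D.U ⊓ D.U')ˣ := D.isUnit.choose_spec.choose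

/-- The local defining function `x|_V ∈ k(V)^*` of the restriction of `D` to the subvariety `V` with
generic point `v ∈ U ∩ U'`. (If `V ⊄ |D|`, then `v ∈ U'`; if `v ∈ U' \ U`, then `V` does not meet
`U`, so that the restriction of `D` to `V` has local equation `1` everywhere.) -/
def funAt (v : X) : (X.residueField v)ˣ :=
  open scoped Classical in
  if h : v ∈ D.U ⊓ D.U' then
    Units.map ((X.evaluation _ v h).hom : Γ(X, D.U ⊓ D.U') →* X.residueField v) D.sec
  else 1

/-- The Weil divisor `[D|_V]` of the restriction of `D` to the subvariety `V ⊄ |D|` with generic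
point `v`: this restriction has local equation `x|_V` on `V ∩ U` and `1` on `V ∩ U'`. -/
def restrictDiv (v : X) : subvar v →₀ ℤ :=
  open scoped Classical in
  Finsupp.ofSupportFinite
    (fun w => if subvarι v w ∈ D.U then ordAt (subvar v) (funOn v (D.funAt v)) w else 0)
    ((ordAt_support_finite _ _ (funOn_ne_zero v (D.funAt v))).subset fun w hw h => hw (by
      simp only [h, ite_self]))

/-- The cycle-level intersection operation `D · - : Z_k(X) → Z_{k-1}(|D|)`. -/
def cap (k : ℤ) : Z (⊤ : Closeds X) k →+ Z D.supp (k - 1) :=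
  open scoped Classical in
  Finsupp.liftAddHom fun v => zmultiplesHom _
    (if v.1 ∈ D.supp then 0 else toCycle D.supp (k - 1) v.1 (D.restrictDiv v.1))

/-- The intersection `D · y` for `y ∈ k(V)^*`, where `V` is the `(k + 1)`-dimensional subvariety with
generic point `v`. It is `0` if `V ⊆ |D|`. Otherwise it is the push-forward along the normalization
`π : V̂ ⟶ V ⊆ X` of the sum of `(y ^ ord_W(x) / x ^ ord_W(y))|_W ∈ k(W)^*` over the subvarieties `W` of
codimension one in `V̂` which lie in the support of the pulled back `P`-divisor
`(π⁻¹(U), π⁻¹(U'), π^* x)`, i.e. in `V̂ \ π⁻¹(U') = π⁻¹(|D|)` (all of them, also those along which the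
orders of the zeros and of the poles of `π^* x` cancel, `ord_W(x) = 0`). As `π` is finite, `π(W)` has the
dimension `k` of `W`, and push-forward is the norm from `k(W)` to `k(π(W))`. -/
def capRatSingle (k : ℤ) (v : Subvar (⊤ : Closeds X) (k + 1)) (y : (X.residueField v.1)ˣ) :
    W D.supp (k - 1) :=
  open scoped Classical in
  if v.1 ∈ D.supp then 0 else
    ∑ᶠ w : {w : normSubvar v.1 // coheight w = 1 ∧
        normSubvarπ v.1 w ∈ D.supp ∧ IsDim (normSubvarπ v.1 w) (k - 1 + 1)},
      DirectSum.of (fun v : Subvar D.supp (k - 1 + 1) => Additive (X.residueField v.1)ˣ)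
        ⟨normSubvarπ v.1 w.1, w.2.2⟩
        (Additive.ofMul (normTo (normSubvarπ v.1) w.1 (restrictTo
          (funOnNorm v.1 y ^ ordAt _ (funOnNorm v.1 (D.funAt v.1)) w.1 /
            funOnNorm v.1 (D.funAt v.1) ^ ordAt _ (funOnNorm v.1 y) w.1) w.1)))

/-- The intersection operation `D · - : W_k(X) → W_{k-1}(|D|)` on rational equivalences. -/
def capRat (k : ℤ) (α : W (⊤ : Closeds X) k) : W D.supp (k - 1) :=
  open scoped Classical in
  ∑ v ∈ DFinsupp.support α, D.capRatSingle k v (α v).toMul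

end PDivisor

end Subvarieties

/-- A variety over a field `k`: an integral scheme of finite type over `k`. -/
structure Variety (k : Type u) [Field k] where
  /-- The underlying scheme. -/
  X : Scheme.{u}
  /-- The structure morphism. -/
  str : X ⟶ Spec (.of k)
  [isIntegral : IsIntegral X]
  [locallyOfFiniteType : LocallyOfFiniteType str]
  [quasiCompact : QuasiCompact str]

attribute [instance] Variety.isIntegral Variety.locallyOfFiniteType Variety.quasiCompact

instance {k : Type u} [Field k] (V : Variety k) : AlgebraicGeometry.IsNoetherian V.X where
  toIsLocallyNoetherian := LocallyOfFiniteType.isLocallyNoetherian V.str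
  toCompactSpace := QuasiCompact.compactSpace_of_compactSpace V.str

end DivisorIntersection
end

/-!
The coefficients of `∂(D · y)` and of `D · ∂y` are compared at each point `z` of `|D|`, where `y` is a
rational function on a subvariety `V` not contained in `|D|` and `z` is of codimension two on `V`. Let `x`
be the local equation of `D` on `V`, let `A` be the local ring of the ambient variety at `z`, and let `B` be
the ring of the functions which are regular on the normalization of `V` near the preimage of `z`. Normalization
is finite for varieties (`finite_integralClosure`), also over imperfect fields, so that `B` is a Noetherian
integrally closed domain, finite over `A`; its primes of height one are the prime divisors `W` of the
normalization whose images contain `z` (`exists_localNormalization`).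

The heart of the proof is a reciprocity law (`KrullValuations.tameSum_eq_zero`): for rational functions `x`
and `y`, the orders of the restrictions to `W` of the tame symbols `y ^ ord_W x / x ^ ord_W y`, measured by
lengths over `A`, sum up to zero over all `W`. It is proved for the divisorial valuations of any Noetherian
integrally closed domain, as long as these lengths are finite. The base case is the one of `ρ` and `σ` in `B` which have equal order at each common
zero; there, both sides of the law come from one length of a quotient of divisorial ideals
(`KrullValuations.len_reciprocity`, by the dévissage `KrullValuations.relLength_idealGE`). The general case
follows by bilinearity and antisymmetry: functions with given orders at finitely many places are found by
prime avoidance.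

Lengths over `A` turn into orders of norms on the images of the `W`
(`length_add_length_of_norm_eq`), because the length of the cokernel of a matrix over a one-dimensional
domain is the order of its determinant (`cokerLength_eq_ord_det`). This makes the reciprocity law a statement on
the norms that define `D · y` (`finsum_divCoeff_tameNorm`). The `W` that lie over `|D|` contribute the
coefficient of `∂(D · y)` at `z`. For all the others, `x` is a unit at `W`, and the tame symbol is a power of
`x` restricted to `W`; since the divisor of `y` on `V` is the push-forward of its divisor on the
normalization (`divCoeff_eq_finsum`), these contribute the negative of the coefficient of `D · ∂y`.

Tame symbols are multiplicative in `y`, which makes `y ↦ D · y` a homomorphism (`PDivisor.capRat_eq`).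

Only primes and lengths near `z` enter: of the dimensions, it suffices that those of `z` and `V` differ by
two, so that a subvariety strictly between them has the dimension in the middle (`IsDim.between`), and no
catenarity is needed.
-/

noncomputable section

namespace DivisorIntersection

/-! ### Relative lengths of submodules -/

section RelLength

variable (A : Type*) {B M M' : Type*} [CommRing A] [CommRing B] [Algebra A B]
  [AddCommGroup M] [Module A M] [Module B M] [IsScalarTower A B M]
  [AddCommGroup M'] [Module A M'] [Module B M'] [IsScalarTower A B M']

/-- The length over `A` of the quotient `P / (N ⊓ P)` of two `B`-submodules of an ambient module. -/
def relLength (N P : Submodule B M) : ℕ∞ := Module.length A (P ⧸ N.submoduleOf P)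

theorem relLength_eq_zero {N P : Submodule B M} (h : P ≤ N) : relLength A N P = 0 := by
  have : N.submoduleOf P = ⊤ := Submodule.submoduleOf_eq_top.mpr h
  unfold relLength
  rw [Module.length_eq_zero_iff, this]
  infer_instance

theorem relLength_add {N P Q : Submodule B M} (h₁ : N ≤ P) (h₂ : P ≤ Q) :
    relLength A N Q = relLength A N P + relLength A P Q := by
  let f : (P ⧸ N.submoduleOf P) →ₗ[B] (Q ⧸ N.submoduleOf Q) :=
    (N.submoduleOf P).mapQ (N.submoduleOf Q) (Submodule.inclusion h₂) (fun x hx => hx)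
  let g : (Q ⧸ N.submoduleOf Q) →ₗ[B] (Q ⧸ P.submoduleOf Q) :=
    Submodule.factor (Submodule.comap_mono h₁)
  have hf : Function.Injective f := by
    rw [injective_iff_map_eq_zero]
    intro x hx
    obtain ⟨x, rfl⟩ := Submodule.Quotient.mk_surjective _ x
    exact (Submodule.Quotient.mk_eq_zero _).mpr
      ((Submodule.Quotient.mk_eq_zero (N.submoduleOf Q)).mp hx)
  have hg : Function.Surjective g := Submodule.factor_surjective _
  have hfg : Function.Exact f g := by
    intro x
    obtain ⟨x, rfl⟩ := Submodule.Quotient.mk_surjective _ x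
    constructor
    · intro hx
      exact ⟨Submodule.Quotient.mk ⟨x.1, (Submodule.Quotient.mk_eq_zero (P.submoduleOf Q)).mp hx⟩, rfl⟩
    · rintro ⟨y, hy⟩
      obtain ⟨y, rfl⟩ := Submodule.Quotient.mk_surjective _ y
      rw [← hy]
      exact (Submodule.Quotient.mk_eq_zero (P.submoduleOf Q)).mpr y.2
  exact Module.length_eq_add_of_exact (f.restrictScalars A) (g.restrictScalars A) hf hg hfg

theorem relLength_sup (P Q : Submodule B M) :
    relLength A P (P ⊔ Q) = relLength A (P ⊓ Q) Q := by
  have e := ((LinearMap.quotientInfEquivSupQuotient Q P).restrictScalars A).length_eq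
  unfold relLength
  rw [sup_comm, inf_comm]
  exact e.symm

theorem relLength_map {φ : M →ₗ[B] M'} (hφ : Function.Injective φ) (N P : Submodule B M) :
    relLength A (N.map φ) (P.map φ) = relLength A N P := by
  refine (LinearEquiv.restrictScalars A (Submodule.Quotient.equiv (N.submoduleOf P)
    ((N.map φ).submoduleOf (P.map φ)) (Submodule.equivMapOfInjective φ hφ P) ?_)).length_eq.symm
  ext ⟨x, hx⟩
  constructor
  · rintro ⟨y, hy, e⟩
    have : φ y = x := congrArg Subtype.val e
    exact ⟨y, hy, this⟩
  · rintro ⟨y, hy, e⟩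
    obtain ⟨y', hy', e'⟩ := hx
    have : y = y' := hφ (e.trans e'.symm)
    subst this
    exact ⟨⟨y, hy'⟩, hy, Subtype.ext e⟩

/-- The second isomorphism theorem combined with the modular law. -/
theorem relLength_sup_sup {X P : Submodule B M} (h : X ≤ P) (Y : Submodule B M) :
    relLength A (X ⊔ Y) (P ⊔ Y) = relLength A (X ⊔ P ⊓ Y) P := by
  have h1 : P ⊔ Y = (X ⊔ Y) ⊔ P := by
    rw [sup_comm X, sup_assoc, sup_eq_right.mpr h, sup_comm]
  rw [h1, relLength_sup, inf_comm P Y, ← sup_inf_assoc_of_le _ h]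

theorem relLength_top (N : Submodule B M) : relLength A N ⊤ = Module.length A (M ⧸ N) := by
  refine (LinearEquiv.restrictScalars A (Submodule.Quotient.equiv (N.submoduleOf ⊤)
    N Submodule.topEquiv ?_)).length_eq
  ext x
  simp [Submodule.submoduleOf]

/-- A submodule of finite colength which is stable under an injective endomorphism has the same
cokernel length as the whole module. -/
theorem relLength_map_eq_of_finite {φ : M →ₗ[B] M} (hφ : Function.Injective φ)
    {N P : Submodule B M} (hNP : N ≤ P) (hN : N.map φ ≤ N) (hP : P.map φ ≤ P)
    (hfin : relLength A N P ≠ ⊤) :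
    relLength A (P.map φ) P = relLength A (N.map φ) N := by
  have h1 := relLength_add A hN hNP
  have h2 := relLength_add A (Submodule.map_mono (f := φ) hNP) hP
  rw [relLength_map A hφ] at h2
  rw [h1, add_comm] at h2
  exact ((ENat.add_right_injective_of_ne_top hfin) h2).symm

theorem relLength_sup_span_ne_top {J : Ideal B} (hJ : Module.length A (B ⧸ J) ≠ ⊤)
    (L : Submodule B M) (S : Finset M) (hS : ∀ x ∈ S, ∀ j ∈ J, j • x ∈ L) :
    relLength A L (L ⊔ Submodule.span B (S : Set M)) ≠ ⊤ := by
  classical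
  induction S using Finset.induction_on with
  | empty => simp [relLength_eq_zero]
  | insert x S _ ih =>
    have ih := ih fun y hy => hS y (Finset.mem_insert_of_mem hy)
    set L' := L ⊔ Submodule.span B (S : Set M) with hL'
    have h1 : L ⊔ Submodule.span B ((insert x S : Finset M) : Set M) =
        L' ⊔ Submodule.span B {x} := by
      rw [Finset.coe_insert, Submodule.span_insert, hL', sup_assoc, sup_comm (Submodule.span B {x})]
    rw [h1, relLength_add A (le_sup_left : L ≤ L') le_sup_left]
    refine WithTop.add_ne_top.mpr ⟨ih, ?_⟩
    let P := Submodule.span B {x}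
    have h2 : ∀ j : B, j • x ∈ P := fun j => Submodule.smul_mem _ _ (Submodule.mem_span_singleton_self x)
    let g : B →ₗ[B] P ⧸ (L' ⊓ P).submoduleOf P :=
      (Submodule.mkQ _).comp (LinearMap.toSpanSingleton B P ⟨x, Submodule.mem_span_singleton_self x⟩)
    have hg : ∀ j ∈ J, g j = 0 := fun j hj =>
      (Submodule.Quotient.mk_eq_zero _).mpr
        ⟨(le_sup_left : L ≤ L') (hS x (Finset.mem_insert_self x S) j hj), h2 j⟩
    have hsurj : Function.Surjective (J.liftQ g hg) := by
      intro y
      obtain ⟨⟨y, hy⟩, rfl⟩ := Submodule.Quotient.mk_surjective _ y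
      obtain ⟨b, rfl⟩ := Submodule.mem_span_singleton.mp hy
      exact ⟨Submodule.Quotient.mk b, rfl⟩
    rw [relLength_sup]
    exact ne_top_of_le_ne_top hJ
      (Module.length_le_of_surjective ((J.liftQ g hg).restrictScalars A) hsurj)

/-- If `P` is finitely generated and `J • P ≤ L ≤ P`, where `B / J` has finite length, then `P / L` has
finite length. -/
theorem relLength_ne_top {J : Ideal B} (hJ : Module.length A (B ⧸ J) ≠ ⊤)
    {L P : Submodule B M} (hL : L ≤ P) (hP : P.FG) (h : ∀ x ∈ P, ∀ j ∈ J, j • x ∈ L) :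
    relLength A L P ≠ ⊤ := by
  obtain ⟨S, rfl⟩ := hP
  have := relLength_sup_span_ne_top A hJ L S fun x hx => h x (Submodule.subset_span hx)
  rwa [sup_eq_right.mpr hL] at this

end RelLength

/-! ### Divisorial valuations of a Krull domain -/

/-- The family of normalized valuations of a Krull domain `B` with fraction field `K` at its height
one primes. Only the axioms that enter the argument are listed: `q i` is the center of `v i`, the
valuation ring of `v i` is the localization of `B` at `q i`, the ring `B` is the intersection of these
valuation rings, and each nonzero function has finitely many zeros and poles. The value of `v i` at
`0` is irrelevant. -/
structure KrullValuations (B K ι : Type*) [CommRing B] [IsDomain B] [Field K] [Algebra B K] where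
  v : ι → K → ℤ
  q : ι → Ideal B
  prime : ∀ i, (q i).IsPrime
  map_mul : ∀ i {f g : K}, f ≠ 0 → g ≠ 0 → v i (f * g) = v i f + v i g
  map_add : ∀ i {f g : K}, f ≠ 0 → g ≠ 0 → f + g ≠ 0 → min (v i f) (v i g) ≤ v i (f + g)
  exists_of_nonneg : ∀ {f : K}, f ≠ 0 → (∀ i, 0 ≤ v i f) → ∃ b, algebraMap B K b = f
  nonneg : ∀ i {b : B}, b ≠ 0 → 0 ≤ v i (algebraMap B K b)
  pos_iff : ∀ i {b : B}, b ≠ 0 → (0 < v i (algebraMap B K b) ↔ b ∈ q i)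
  exists_frac : ∀ i {f : K}, f ≠ 0 → 0 ≤ v i f → ∃ a b : B, b ∉ q i ∧ f * algebraMap B K b = algebraMap B K a
  finite : ∀ {f : K}, f ≠ 0 → {i | v i f ≠ 0}.Finite
  exists_uniformizer : ∀ i, ∃ b : B, b ≠ 0 ∧ v i (algebraMap B K b) = 1
  not_le : ∀ {i j}, i ≠ j → ¬ q i ≤ q j

namespace KrullValuations

variable {B K ι : Type*} [CommRing B] [IsDomain B] [Field K] [Algebra B K]
  (D : KrullValuations B K ι)

/-- The valuation of an element of `B`. -/
def ν (i : ι) (b : B) : ℤ := D.v i (algebraMap B K b)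

theorem v_one (i : ι) : D.v i 1 = 0 := by
  have := D.map_mul i (one_ne_zero (α := K)) one_ne_zero
  rw [one_mul] at this
  omega

/-- The valuation `v i` as a homomorphism on `Kˣ`. -/
def vHom (i : ι) : Kˣ →* Multiplicative ℤ where
  toFun u := Multiplicative.ofAdd (D.v i u)
  map_one' := by rw [Units.val_one, D.v_one]; rfl
  map_mul' f g := by rw [Units.val_mul, D.map_mul i f.ne_zero g.ne_zero]; rfl

theorem v_zpow (i : ι) (f : Kˣ) (n : ℤ) : D.v i ((f ^ n : Kˣ) : K) = n * D.v i f := by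
  have := map_zpow (D.vHom i) f n
  have h := congrArg Multiplicative.toAdd this
  rw [toAdd_zpow] at h
  exact h

theorem v_inv (i : ι) (f : Kˣ) : D.v i ((f⁻¹ : Kˣ) : K) = - D.v i f := by
  have := D.v_zpow i f (-1)
  rw [zpow_neg_one] at this
  omega

theorem v_div (i : ι) (f g : Kˣ) : D.v i ((f / g : Kˣ) : K) = D.v i f - D.v i g := by
  rw [div_eq_mul_inv, Units.val_mul, D.map_mul i f.ne_zero (Units.ne_zero _), v_inv]
  omega

theorem ν_eq_zero_iff (i : ι) {b : B} (hb : b ≠ 0) : D.ν i b = 0 ↔ b ∉ D.q i := by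
  rw [← D.pos_iff i hb]
  have := D.nonneg i hb
  rw [ν]
  omega

variable [IsFractionRing B K]

theorem ν_mul (i : ι) {a b : B} (ha : a ≠ 0) (hb : b ≠ 0) : D.ν i (a * b) = D.ν i a + D.ν i b := by
  rw [ν, _root_.map_mul]
  exact D.map_mul i (by simpa using ha) (by simpa using hb)

theorem ν_add (i : ι) {a b : B} (ha : a ≠ 0) (hb : b ≠ 0) (hab : a + b ≠ 0) :
    min (D.ν i a) (D.ν i b) ≤ D.ν i (a + b) := by
  rw [ν, ν, ν, _root_.map_add]
  exact D.map_add i (by simpa using ha) (by simpa using hb)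
    (by
      rw [← _root_.map_add]
      exact (map_ne_zero_iff _ (IsFractionRing.injective B K)).mpr hab)

theorem ν_pow (i : ι) {a : B} (ha : a ≠ 0) (n : ℕ) : D.ν i (a ^ n) = n * D.ν i a := by
  induction n with
  | zero => simp [ν, v_one]
  | succ n ih => rw [pow_succ, D.ν_mul i (pow_ne_zero n ha) ha, ih]; push_cast; ring

theorem ν_prod (i : ι) {κ : Type*} (s : Finset κ) (c : κ → B) (hc : ∀ j ∈ s, c j ≠ 0) :
    D.ν i (∏ j ∈ s, c j) = ∑ j ∈ s, D.ν i (c j) := by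
  classical
  induction s using Finset.induction_on with
  | empty => simp [ν, v_one]
  | insert j s hj ih =>
    have h1 : ∀ j ∈ s, c j ≠ 0 := fun j hj => hc j (Finset.mem_insert_of_mem hj)
    rw [Finset.prod_insert hj, Finset.sum_insert hj,
      D.ν_mul i (hc j (Finset.mem_insert_self j s)) (Finset.prod_ne_zero_iff.mpr h1), ih h1]

/-- `a` divides `b` in `B` if it does so with respect to all the valuations. -/
theorem dvd_of_le {a b : B} (ha : a ≠ 0) (hb : b ≠ 0) (h : ∀ i, D.ν i a ≤ D.ν i b) : a ∣ b := by
  have ha' : algebraMap B K a ≠ 0 := by simpa using ha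
  have hb' : algebraMap B K b ≠ 0 := by simpa using hb
  obtain ⟨c, hc⟩ := D.exists_of_nonneg (f := algebraMap B K b / algebraMap B K a)
    (div_ne_zero hb' ha') fun i => by
      have := D.v_div i (Units.mk0 _ hb') (Units.mk0 _ ha')
      rw [Units.val_div_eq_div_val, Units.val_mk0, Units.val_mk0] at this
      rw [this]
      exact sub_nonneg.mpr (h i)
  refine ⟨c, IsFractionRing.injective B K ?_⟩
  rw [_root_.map_mul, hc, mul_div_cancel₀ _ ha']

/-- The divisor of a nonzero element of `B`. -/
def div (b : B) (hb : b ≠ 0) : ι →₀ ℕ :=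
  Finsupp.ofSupportFinite (fun i => (D.ν i b).toNat)
    ((D.finite (f := algebraMap B K b) (by simpa using hb)).subset fun i hi h => hi (by
      change D.ν i b = 0 at h
      simp [h]))

theorem div_apply (b : B) (hb : b ≠ 0) (i : ι) : (D.div b hb i : ℤ) = D.ν i b :=
  Int.toNat_of_nonneg (D.nonneg i hb)

/-- The divisorial ideal of the elements of `B` whose divisor is at least `n`. -/
def idealGE (n : ι →₀ ℕ) : Ideal B where
  carrier := {b | b = 0 ∨ ∀ i, (n i : ℤ) ≤ D.ν i b}
  zero_mem' := Or.inl rfl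
  add_mem' {a b} ha hb := by
    by_cases ha0 : a = 0
    · simpa [ha0] using hb
    by_cases hb0 : b = 0
    · simpa [hb0] using ha
    by_cases hab : a + b = 0
    · exact Or.inl hab
    refine Or.inr fun i => le_trans (le_min ?_ ?_) (D.ν_add i ha0 hb0 hab)
    · exact ha.resolve_left ha0 i
    · exact hb.resolve_left hb0 i
  smul_mem' c b hb := by
    by_cases hc : c = 0
    · exact Or.inl (by simp [hc])
    by_cases hb0 : b = 0
    · exact Or.inl (by simp [hb0])
    refine Or.inr fun i => ?_
    rw [smul_eq_mul, D.ν_mul i hc hb0]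
    have h1 := hb.resolve_left hb0 i
    have h2 : 0 ≤ D.ν i c := D.nonneg i hc
    omega

theorem mem_idealGE {n : ι →₀ ℕ} {b : B} (hb : b ≠ 0) :
    b ∈ D.idealGE n ↔ ∀ i, (n i : ℤ) ≤ D.ν i b :=
  ⟨fun h => Or.resolve_left h hb, Or.inr⟩

theorem idealGE_zero : D.idealGE 0 = ⊤ := by
  rw [Ideal.eq_top_iff_one]
  refine (D.mem_idealGE one_ne_zero).mpr fun i => ?_
  simp [ν, v_one]

theorem idealGE_anti {m n : ι →₀ ℕ} (h : m ≤ n) : D.idealGE n ≤ D.idealGE m := by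
  intro b hb
  by_cases hb0 : b = 0
  · simp [hb0]
  · rw [D.mem_idealGE hb0] at hb ⊢
    exact fun i => le_trans (by exact_mod_cast h i) (hb i)

/-- Multiplication by an element of `B`, as a `B`-linear map. -/
abbrev mulBy (b : B) : B →ₗ[B] B := LinearMap.mulLeft B b

omit [IsDomain B] in
theorem mem_map_mulBy {b : B} {I : Ideal B} {x : B} :
    x ∈ Submodule.map (mulBy b) I ↔ ∃ y ∈ I, b * y = x := Iff.rfl

theorem mulBy_injective {b : B} (hb : b ≠ 0) : Function.Injective (mulBy b) :=
  fun _ _ h => mul_left_cancel₀ hb h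

omit [IsDomain B] in
theorem map_mulBy_le (b : B) (I : Ideal B) : Submodule.map (mulBy b) I ≤ I := by
  rintro _ ⟨y, hy, rfl⟩
  exact I.mul_mem_left b hy

omit [IsDomain B] in
theorem map_mulBy_top (b : B) : Submodule.map (mulBy b) (⊤ : Ideal B) = Ideal.span {b} := by
  ext x
  rw [mem_map_mulBy, Ideal.mem_span_singleton']
  simp [mul_comm]

theorem idealGE_div (b : B) (hb : b ≠ 0) :
    D.idealGE (D.div b hb) = Submodule.map (mulBy b) ⊤ := by
  rw [map_mulBy_top]
  ext x
  by_cases hx : x = 0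
  · simp [hx]
  rw [D.mem_idealGE hx, Ideal.mem_span_singleton]
  simp only [div_apply]
  refine ⟨D.dvd_of_le hb hx, ?_⟩
  rintro ⟨c, rfl⟩ i
  have hc : c ≠ 0 := right_ne_zero_of_mul hx
  rw [D.ν_mul i hb hc]
  have : 0 ≤ D.ν i c := D.nonneg i hc
  omega

/-- A multiple `b y` lies in `idealGE (n + m)` only if `y` does, provided that `b` does not vanish along the
support of `m`. -/
theorem inf_map_mulBy (n m : ι →₀ ℕ) {b : B} (hb : b ≠ 0) (h : ∀ i, m i ≠ 0 → D.ν i b = 0) :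
    D.idealGE (n + m) ⊓ Submodule.map (mulBy b) (D.idealGE n) =
      Submodule.map (mulBy b) (D.idealGE (n + m)) := by
  apply le_antisymm
  · rintro _ ⟨hx, y, hy, rfl⟩
    refine ⟨y, ?_, rfl⟩
    by_cases hy0 : y = 0
    · simp [hy0]
    change b * y ∈ D.idealGE (n + m) at hx
    rw [SetLike.mem_coe, D.mem_idealGE hy0] at hy
    rw [SetLike.mem_coe, D.mem_idealGE hy0]
    rw [D.mem_idealGE (mul_ne_zero hb hy0)] at hx
    intro i
    have h1 := hx i
    rw [D.ν_mul i hb hy0] at h1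
    by_cases hm : m i = 0
    · simpa [hm] using hy i
    · have := h i hm
      omega
  · exact le_inf (map_mulBy_le _ _) (Submodule.map_mono (D.idealGE_anti le_self_add))

/-- Prime avoidance: there is an element of `B` which is a uniformizer at `i` and a unit at given
finitely many other places. -/
theorem exists_uniformizer_avoiding (i : ι) (T : Finset ι) :
    ∃ b : B, b ≠ 0 ∧ D.ν i b = 1 ∧ ∀ j ∈ T, j ≠ i → D.ν j b = 0 := by
  classical
  -- the ideal indexed by `none` is the one of the elements which vanish twice along `i`
  let F : Option ι → Ideal B := fun o => o.elim (D.idealGE (Finsupp.single i 2)) D.q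
  let s : Finset (Option ι) := insert none ((T.erase i).image some)
  have hF : ¬ ((D.q i : Set B) ⊆ ⋃ o ∈ (s : Set (Option ι)), F o) := by
    rw [Ideal.subset_union_prime none none]
    · rintro ⟨o, ho, hle⟩
      rcases Finset.mem_insert.mp ho with rfl | ho
      · obtain ⟨b, hb, hb1⟩ := D.exists_uniformizer i
        have h1 : b ∈ D.q i := (D.pos_iff i hb).mp (by omega)
        have h2 := (D.mem_idealGE hb).mp (hle h1) i
        rw [Finsupp.single_eq_same] at h2
        change _ ≤ D.v i _ at h2
        omega
      · obtain ⟨j, hj, rfl⟩ := Finset.mem_image.mp ho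
        exact D.not_le (Finset.ne_of_mem_erase hj).symm hle
    · intro o ho hne _
      rcases Finset.mem_insert.mp ho with rfl | ho
      · exact absurd rfl hne
      · obtain ⟨j, hj, rfl⟩ := Finset.mem_image.mp ho
        exact D.prime j
  obtain ⟨b, hbi, hb⟩ := Set.not_subset.mp hF
  simp only [Set.mem_iUnion, not_exists] at hb
  have hb2 : b ∉ D.idealGE (Finsupp.single i 2) := hb none (by simp [s])
  have hb0 : b ≠ 0 := fun h => hb2 (h ▸ Ideal.zero_mem _)
  refine ⟨b, hb0, ?_, fun j hj hji => ?_⟩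
  · have h1 : 0 < D.ν i b := (D.pos_iff i hb0).mpr hbi
    by_contra hne
    refine hb2 ((D.mem_idealGE hb0).mpr fun j => ?_)
    rw [Finsupp.single_apply]
    split_ifs with hij
    · subst hij; push_cast; omega
    · exact_mod_cast D.nonneg j hb0
  · rw [D.ν_eq_zero_iff j hb0]
    exact hb (some j) (by simp [s, hj, hji])

theorem exists_mem_idealGE_eq (n : ι →₀ ℕ) (i : ι) : ∃ f ∈ D.idealGE n, f ≠ 0 ∧ D.ν i f = n i := by
  classical
  choose c hc0 hc1 hc using fun j => D.exists_uniformizer_avoiding j {i}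
  have h0 : ∀ j ∈ insert i n.support, c j ^ n j ≠ 0 := fun j _ => pow_ne_zero _ (hc0 j)
  have hp : ∏ j ∈ insert i n.support, c j ^ n j ≠ 0 := Finset.prod_ne_zero_iff.mpr h0
  have hν : ∀ k, D.ν k (∏ j ∈ insert i n.support, c j ^ n j) =
      ∑ j ∈ insert i n.support, n j * D.ν k (c j) := fun k => by
    rw [D.ν_prod k _ _ h0]
    exact Finset.sum_congr rfl fun j _ => D.ν_pow k (hc0 j) _
  refine ⟨_, (D.mem_idealGE hp).mpr fun k => ?_, hp, ?_⟩
  · rw [hν]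
    by_cases hk : n k = 0
    · rw [hk]
      exact Finset.sum_nonneg fun j _ => mul_nonneg (by positivity) (D.nonneg k (hc0 j))
    · refine le_trans (le_of_eq ?_) (Finset.single_le_sum (f := fun j => (n j : ℤ) * D.ν k (c j))
        (fun j _ => mul_nonneg (by positivity) (D.nonneg k (hc0 j)))
        (Finset.mem_insert_of_mem (Finsupp.mem_support_iff.mpr hk)))
      simp [hc1]
  · rw [hν, Finset.sum_eq_single i]
    · simp [hc1]
    · intro j _ hji
      rw [hc j i (Finset.mem_singleton_self i) hji.symm, mul_zero]
    · simp

/-- Simultaneous denominators: a function which is regular along finitely many places is a quotient of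
elements of `B` whose denominator is a unit at all these places. -/
theorem exists_frac_finset (T : Finset ι) {f : K} (hf : f ≠ 0) (h : ∀ i ∈ T, 0 ≤ D.v i f) :
    ∃ c d : B, d ≠ 0 ∧ (∀ i ∈ T, D.ν i d = 0) ∧ f * algebraMap B K d = algebraMap B K c := by
  let J : Ideal B :=
    { carrier := {d | ∃ c, f * algebraMap B K d = algebraMap B K c}
      zero_mem' := ⟨0, by simp⟩
      add_mem' := by
        rintro a b ⟨c, hc⟩ ⟨d, hd⟩
        exact ⟨c + d, by rw [_root_.map_add, _root_.map_add, mul_add, hc, hd]⟩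
      smul_mem' := by
        rintro r a ⟨c, hc⟩
        exact ⟨r * c, by rw [smul_eq_mul, _root_.map_mul, _root_.map_mul, ← hc]; ring⟩ }
  rcases T.eq_empty_or_nonempty with rfl | ⟨i₀, hi₀⟩
  · obtain ⟨c, d, hd, e⟩ := IsFractionRing.div_surjective (A := B) f
    have hd0 : d ≠ 0 := nonZeroDivisors.ne_zero hd
    exact ⟨c, d, hd0, by simp, by rw [← e, div_mul_cancel₀ _ (by simpa using hd0)]⟩
  have hJ : ¬ ((J : Set B) ⊆ ⋃ i ∈ (T : Set ι), D.q i) := by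
    rw [Ideal.subset_union_prime i₀ i₀ fun i _ _ _ => D.prime i]
    rintro ⟨i, hi, hle⟩
    obtain ⟨a, b, hb, e⟩ := D.exists_frac i hf (h i hi)
    exact hb (hle ⟨a, e⟩)
  obtain ⟨d, ⟨c, hc⟩, hd⟩ := Set.not_subset.mp hJ
  simp only [Set.mem_iUnion, not_exists] at hd
  have hd0 : d ≠ 0 := fun h0 => hd i₀ hi₀ (h0 ▸ Ideal.zero_mem _)
  exact ⟨c, d, hd0, fun i hi => (D.ν_eq_zero_iff i hd0).mpr (hd i hi), hc⟩

end KrullValuations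

/-! ### Lengths of quotients by divisorial ideals -/

namespace KrullValuations

variable (A : Type*) {B K ι : Type*} [CommRing A] [CommRing B] [Algebra A B] [IsDomain B] [Field K]
  [Algebra B K] (D : KrullValuations B K ι)

/-- The length over `A` of `B / (q i, a)`; for `a ∉ q i` this is the order of `a` on the subvariety with
generic point `i`, computed with lengths over `A`. -/
def len (i : ι) (a : B) : ℕ∞ := relLength A (D.q i ⊔ Ideal.span {a}) ⊤

omit [IsDomain B] in
theorem map_mulBy_sup_span (b : B) (I : Ideal B) (a : B) :
    Submodule.map (mulBy b) (I ⊔ Ideal.span {a}) =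
      Submodule.map (mulBy b) I ⊔ Ideal.span {b * a} := by
  rw [Submodule.map_sup]
  congr 1
  rw [Ideal.span, Submodule.map_span, Set.image_singleton]
  rfl

theorem len_mul (i : ι) {a b : B} (ha : a ∉ D.q i) :
    D.len A i (a * b) = D.len A i a + D.len A i b := by
  have hp := D.prime i
  have ha0 : a ≠ 0 := fun h => ha (h ▸ Ideal.zero_mem _)
  have h1 : Ideal.span {a * b} ≤ Ideal.span {a} :=
    Ideal.span_singleton_le_span_singleton.mpr (dvd_mul_right a b)
  rw [len, relLength_add A (sup_le_sup_left h1 (D.q i)) le_top, add_comm]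
  congr 1
  rw [sup_comm, sup_comm (D.q i), relLength_sup_sup A h1]
  have h2 : Ideal.span {a} ⊓ D.q i = Submodule.map (mulBy a) (D.q i) := by
    ext x
    rw [mem_map_mulBy]
    constructor
    · rintro ⟨hx, hx'⟩
      obtain ⟨c, rfl⟩ := Ideal.mem_span_singleton.mp hx
      exact ⟨c, (hp.mem_or_mem hx').resolve_left ha, rfl⟩
    · rintro ⟨y, hy, rfl⟩
      exact ⟨Ideal.mem_span_singleton.mpr (dvd_mul_right a y), Ideal.mul_mem_left _ _ hy⟩
  rw [h2, sup_comm, ← map_mulBy_sup_span, ← map_mulBy_top a, relLength_map A (mulBy_injective ha0)]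
  rfl

theorem len_one (i : ι) : D.len A i 1 = 0 :=
  relLength_eq_zero A (by simp)

variable [IsFractionRing B K] [IsNoetherianRing B]

/-- Multiplication by `f` identifies `B / q i` with a submodule of finite colength of the rank one
module `idealGE n / idealGE (n + i)` over `B / q i`. -/
theorem relLength_step (hfin : ∀ i, ∀ c ∉ D.q i, D.len A i c ≠ ⊤) (n : ι →₀ ℕ) (i : ι) {σ : B}
    (hσ : σ ∉ D.q i ∨ σ = 0 ∧ (D.q i).IsMaximal) :
    relLength A (D.idealGE (n + Finsupp.single i 1) ⊔ Submodule.map (mulBy σ) (D.idealGE n))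
      (D.idealGE n) = D.len A i σ := by
  classical
  set N := D.idealGE n with hN
  set N' := D.idealGE (n + Finsupp.single i 1) with hN'
  have hN'N : N' ≤ N := D.idealGE_anti le_self_add
  obtain ⟨f, hfN, hf0, hf⟩ := D.exists_mem_idealGE_eq n i
  have hq : ∀ b ∈ D.q i, ∀ x ∈ N, b * x ∈ N' := by
    intro b hb x hx
    by_cases hb0 : b = 0
    · simp [hb0]
    by_cases hx0 : x = 0
    · simp [hx0]
    rw [hN, D.mem_idealGE hx0] at hx
    rw [hN', D.mem_idealGE (mul_ne_zero hb0 hx0)]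
    intro j
    rw [D.ν_mul j hb0 hx0, Finsupp.add_apply, Finsupp.single_apply]
    have h1 : 0 ≤ D.ν j b := D.nonneg j hb0
    have h2 := hx j
    split_ifs with h
    · subst h
      have : 0 < D.ν i b := (D.pos_iff i hb0).mpr hb
      push_cast; omega
    · push_cast; omega
  set F := Submodule.map (mulBy f) (⊤ : Ideal B) with hF
  have hFN : F ≤ N := by
    rintro _ ⟨y, -, rfl⟩
    exact Ideal.mul_mem_right _ _ hfN
  have hFN' : F ⊓ N' = Submodule.map (mulBy f) (D.q i) := by
    apply le_antisymm
    · rintro _ ⟨⟨y, -, rfl⟩, hy⟩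
      refine ⟨y, ?_, rfl⟩
      change f * y ∈ N' at hy
      by_cases hy0 : y = 0
      · simp [hy0]
      rw [hN', D.mem_idealGE (mul_ne_zero hf0 hy0)] at hy
      have := hy i
      rw [D.ν_mul i hf0 hy0, hf, Finsupp.add_apply, Finsupp.single_eq_same] at this
      refine (D.pos_iff i hy0).mp ?_
      change 0 < D.ν i y
      push_cast at this
      omega
    · rintro _ ⟨y, hy, rfl⟩
      refine ⟨⟨y, trivial, rfl⟩, ?_⟩
      change f * y ∈ N'
      rw [mul_comm]
      exact hq y hy f hfN
  -- a common denominator of the elements of `idealGE n` with respect to `f`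
  obtain ⟨c, hc, hcN⟩ : ∃ c ∉ D.q i, ∀ x ∈ N, c * x ∈ F := by
    have h1 : ∀ x ∈ N, ∃ c ∉ D.q i, c * x ∈ F := by
      intro x hx
      by_cases hx0 : x = 0
      · exact ⟨1, (Ideal.ne_top_iff_one _).mp (D.prime i).ne_top, by simp [hx0]⟩
      have hx' : algebraMap B K x ≠ 0 := by simpa using hx0
      have hf' : algebraMap B K f ≠ 0 := by simpa using hf0
      have hv := D.v_div i (Units.mk0 _ hx') (Units.mk0 _ hf')
      rw [Units.val_div_eq_div_val, Units.val_mk0, Units.val_mk0] at hv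
      obtain ⟨a, c, hc, e⟩ := D.exists_frac i (div_ne_zero hx' hf') (by
        have h1 := (D.mem_idealGE hx0).mp hx i
        change _ ≤ D.v i (algebraMap B K x) at h1
        change D.v i (algebraMap B K f) = _ at hf
        omega)
      refine ⟨c, hc, a, trivial, IsFractionRing.injective B K ?_⟩
      change algebraMap B K (f * a) = _
      rw [_root_.map_mul, _root_.map_mul, ← e]
      field_simp
    obtain ⟨S, hS⟩ : N.FG := IsNoetherian.noetherian N
    choose! c hc hcF using h1
    have hSN : ∀ x ∈ S, x ∈ N := fun x hx => hS ▸ Submodule.subset_span hx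
    refine ⟨∏ x ∈ S, c x, fun h => ?_, fun x hx => ?_⟩
    · obtain ⟨x, hx, h⟩ := (D.prime i).prod_mem_iff.mp h
      exact hc x (hSN x hx) h
    · have hx' : x ∈ Submodule.span B (S : Set B) := by rw [← hS] at hx; exact hx
      have hle : Submodule.span B (S : Set B) ≤
          Submodule.comap (mulBy (∏ x ∈ S, c x)) F := by
        rw [Submodule.span_le]
        intro x hx
        change (∏ x ∈ S, c x) * x ∈ F
        rw [← Finset.prod_erase_mul _ _ hx, mul_assoc]
        exact Ideal.mul_mem_left _ _ (hcF x (hSN x hx))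
      exact hle hx'
  set L := F ⊔ N' with hL
  have hLN : L ≤ N := sup_le hFN hN'N
  have hLfin : relLength A L N ≠ ⊤ := by
    refine relLength_ne_top A (J := D.q i ⊔ Ideal.span {c}) ?_ hLN (IsNoetherian.noetherian N) ?_
    · rw [← relLength_top]; exact hfin i c hc
    · intro x hx j hj
      obtain ⟨b, hb, y, hy, rfl⟩ := Submodule.mem_sup.mp hj
      obtain ⟨r, rfl⟩ := Ideal.mem_span_singleton'.mp hy
      rw [smul_eq_mul, add_mul, mul_assoc]
      exact add_mem (le_sup_right (a := F) (hq b hb x hx))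
        (le_sup_left (a := F) (Ideal.mul_mem_left _ _ (hcN x hx)))
  have key : relLength A (N' ⊔ Submodule.map (mulBy σ) N) N =
      relLength A (N' ⊔ Submodule.map (mulBy σ) L) L := by
    rcases hσ with hσ | ⟨-, hmax⟩
    · have hσ0 : σ ≠ 0 := fun h => hσ (h ▸ Ideal.zero_mem _)
      have h1 : relLength A (N' ⊔ Submodule.map (mulBy σ) L) (N' ⊔ Submodule.map (mulBy σ) N) =
          relLength A L N := by
        rw [sup_comm, sup_comm N', relLength_sup_sup A (Submodule.map_mono hLN), inf_comm,
          D.inf_map_mulBy n (Finsupp.single i 1) hσ0, ← Submodule.map_sup,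
          relLength_map A (mulBy_injective hσ0), ← hN', sup_eq_left.mpr le_sup_right]
        intro j hj
        have : j = i := by
          by_contra h
          exact hj (Finsupp.single_eq_of_ne h)
        rw [this, D.ν_eq_zero_iff i hσ0]
        exact hσ
      have h2 := relLength_add A
        (sup_le_sup_left (Submodule.map_mono hLN) N' : N' ⊔ Submodule.map (mulBy σ) L ≤ _)
        (sup_le hN'N (map_mulBy_le σ N))
      have h3 := relLength_add A
        (sup_le le_sup_right (map_mulBy_le σ L) : N' ⊔ Submodule.map (mulBy σ) L ≤ L) hLN
      rw [h3, h1, add_comm] at h2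
      exact ((ENat.add_right_injective_of_ne_top hLfin) h2).symm
    · have : L = N := by
        refine le_antisymm hLN fun x hx => ?_
        have h1 : (1 : B) ∈ D.q i ⊔ Ideal.span {c} := by
          rw [← Ideal.eq_top_iff_one]
          refine hmax.out.2 _ (lt_of_le_of_ne le_sup_left fun h => hc ?_)
          rw [h]
          exact Ideal.mem_sup_right (Ideal.mem_span_singleton_self c)
        obtain ⟨b, hb, y, hy, e⟩ := Submodule.mem_sup.mp h1
        obtain ⟨r, rfl⟩ := Ideal.mem_span_singleton'.mp hy
        rw [← one_mul x, ← e, add_mul, mul_assoc]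
        exact add_mem (le_sup_right (a := F) (hq b hb x hx))
          (le_sup_left (a := F) (Ideal.mul_mem_left _ _ (hcN x hx)))
      rw [this]
  rw [key]
  have h4 : N' ⊔ Submodule.map (mulBy σ) L = Submodule.map (mulBy σ) F ⊔ N' := by
    rw [hL, Submodule.map_sup, sup_left_comm, sup_eq_left.mpr (map_mulBy_le σ N')]
  have h5 : Submodule.map (mulBy σ) F = Ideal.span {f * σ} := by
    rw [hF, map_mulBy_top, Ideal.span, Submodule.map_span, Set.image_singleton]
    congr 2
    exact mul_comm σ f
  rw [h4, hL, relLength_sup_sup A (map_mulBy_le σ F), hFN', h5, sup_comm, ← map_mulBy_sup_span,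
    relLength_map A (mulBy_injective hf0)]
  rfl

/-- Dévissage: the length of the module `idealGE n / idealGE (n + m)` modulo `σ`. -/
theorem relLength_idealGE (hfin : ∀ i, ∀ c ∉ D.q i, D.len A i c ≠ ⊤) (n m : ι →₀ ℕ) {σ : B}
    (hσ : ∀ i, m i ≠ 0 → σ ∉ D.q i ∨ σ = 0 ∧ (D.q i).IsMaximal) :
    relLength A (D.idealGE (n + m) ⊔ Submodule.map (mulBy σ) (D.idealGE n)) (D.idealGE n) =
      m.sum fun i k => k * D.len A i σ := by
  classical
  obtain ⟨d, hd⟩ : ∃ d : ℕ, m.sum (fun _ k => k) = d := ⟨_, rfl⟩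
  induction d generalizing m with
  | zero =>
    have : m = 0 := by
      ext i
      by_contra h
      have h1 := (Finset.sum_eq_zero_iff.mp hd) i (Finsupp.mem_support_iff.mpr h)
      exact h h1
    subst this
    rw [add_zero, Finsupp.sum_zero_index]
    exact relLength_eq_zero A le_sup_left
  | succ d ih =>
    obtain ⟨i, hi⟩ : ∃ i, m i ≠ 0 := by
      by_contra! h
      have : m = 0 := Finsupp.ext h
      subst this
      simp at hd
    obtain ⟨m, rfl⟩ : ∃ m', m = m' + Finsupp.single i 1 := by
      refine ⟨m - Finsupp.single i 1, ?_⟩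
      rw [tsub_add_cancel_of_le]
      rw [Finsupp.single_le_iff]
      omega
    have hσi := hσ i hi
    have hσm : ∀ j, m j ≠ 0 → σ ∉ D.q j ∨ σ = 0 ∧ (D.q j).IsMaximal := fun j hj =>
      hσ j (by rw [Finsupp.add_apply]; omega)
    rw [Finsupp.sum_add_index' (fun _ => rfl) (fun _ _ _ => rfl), Finsupp.sum_single_index rfl] at hd
    have ih := ih m hσm (by omega)
    rw [Finsupp.sum_add_index' (by simp) (fun _ _ _ => by push_cast; ring),
      Finsupp.sum_single_index (by simp), ← ih, Nat.cast_one, one_mul, add_comm (relLength A _ _),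
      ← relLength_step A D hfin (n + m) i hσi]
    have h1 : D.idealGE (n + m + Finsupp.single i 1) ≤ D.idealGE (n + m) :=
      D.idealGE_anti le_self_add
    have h2 : D.idealGE (n + m) ≤ D.idealGE n := D.idealGE_anti le_self_add
    rw [← add_assoc, relLength_add A (sup_le_sup_right h1 (Submodule.map (mulBy σ) (D.idealGE n)))
      (sup_le h2 (map_mulBy_le _ _)), relLength_sup_sup A h1]
    congr 3
    by_cases h0 : σ = 0
    · subst h0
      have h3 : ∀ I : Ideal B, Submodule.map (mulBy (0 : B)) I = ⊥ := fun I => by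
        rw [eq_bot_iff]
        rintro _ ⟨y, -, rfl⟩
        simp
      rw [h3, h3, inf_bot_eq]
    · refine D.inf_map_mulBy n m h0 fun j hj => (D.ν_eq_zero_iff j h0).mpr ?_
      exact (hσm j hj).resolve_right fun h => h0 h.1

end KrullValuations

/-! ### The sum of the orders of the tame symbols -/

namespace KrullValuations

variable (A : Type*) {B K ι : Type*} [CommRing A] [CommRing B] [Algebra A B] [IsDomain B] [Field K]
  [Algebra B K] (D : KrullValuations B K ι)

/-- The order of `u ∈ K`, a unit at the place `i`, on the subvariety with generic point `i`,
computed with lengths over `A`. (It is set to be `0` if `u` is not a unit at `i`.) -/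
def chi (i : ι) (u : K) : ℤ :=
  open scoped Classical in
  if h : ∃ ab : B × B, ab.1 ∉ D.q i ∧ ab.2 ∉ D.q i ∧ u * algebraMap B K ab.2 = algebraMap B K ab.1 then
    ((D.len A i h.choose.1).toNat : ℤ) - ((D.len A i h.choose.2).toNat : ℤ)
  else 0

/-- The tame symbol of `f` and `g` at `i`, up to sign, as a function which is a unit at `i`. -/
def tame (i : ι) (f g : Kˣ) : Kˣ := f ^ D.v i g / g ^ D.v i f

theorem v_tame (i : ι) (f g : Kˣ) : D.v i (D.tame i f g : Kˣ) = 0 := by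
  rw [tame, v_div, v_zpow, v_zpow]
  ring

/-- The sum of the orders of all tame symbols of `f` and `g`. -/
def tameSum (f g : Kˣ) : ℤ := ∑ᶠ i, D.chi A i (D.tame i f g : Kˣ)

variable [IsFractionRing B K]

theorem sup_inf_div {ρ σ : B} (hρ : ρ ≠ 0) (hσ : σ ≠ 0) {G R S : ι →₀ ℕ} (h₁ : D.div ρ hρ = G + R)
    (h₂ : D.div σ hσ = G + S) (hR : ∀ i, R i ≠ 0 → S i = 0) :
    Submodule.map (mulBy σ) (⊤ : Ideal B) ⊓ Submodule.map (mulBy ρ) ⊤ =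
      Submodule.map (mulBy σ) (D.idealGE R) := by
  have hd₁ : ∀ i, D.ν i ρ = G i + R i := fun i => by
    rw [← D.div_apply ρ hρ, h₁, Finsupp.add_apply]; push_cast; rfl
  have hd₂ : ∀ i, D.ν i σ = G i + S i := fun i => by
    rw [← D.div_apply σ hσ, h₂, Finsupp.add_apply]; push_cast; rfl
  rw [← D.idealGE_div ρ hρ]
  have key : ∀ y : B, σ * y ∈ D.idealGE (D.div ρ hρ) ↔ y ∈ D.idealGE R := by
    intro y
    by_cases hy : y = 0
    · simp [hy]
    rw [D.mem_idealGE hy, D.mem_idealGE (mul_ne_zero hσ hy)]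
    refine forall_congr' fun i => ?_
    rw [D.div_apply, hd₁, D.ν_mul i hσ hy, hd₂]
    have h3 : 0 ≤ D.ν i y := D.nonneg i hy
    by_cases hRi : R i = 0
    · rw [hRi]; constructor <;> intro <;> push_cast at * <;> omega
    · rw [hR i hRi]; constructor <;> intro <;> push_cast at * <;> omega
  ext x
  constructor
  · rintro ⟨⟨y, -, rfl⟩, hy⟩
    exact ⟨y, (key y).mp hy, rfl⟩
  · rintro ⟨y, hy, rfl⟩
    exact ⟨⟨y, trivial, rfl⟩, (key y).mpr hy⟩

theorem map_mulBy_idealGE_le {ρ σ a b : B} (hρ : ρ ≠ 0) (hσ : σ ≠ 0) {G R S : ι →₀ ℕ}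
    (h₁ : D.div ρ hρ = G + R) (h₂ : D.div σ hσ = G + S) (hR : ∀ i, R i ≠ 0 → S i = 0)
    (hab : b * σ = a * ρ) :
    Submodule.map (mulBy a) (D.idealGE R) ≤ Submodule.map (mulBy b) (D.idealGE S) := by
  have hS : ∀ i, S i ≠ 0 → R i = 0 := fun i h => by
    by_contra h'
    exact h (hR i h')
  rintro _ ⟨y, hy, rfl⟩
  -- `σ y` is a multiple `ρ w` of `ρ`, where `w` vanishes along `S`, and `a y = b w`
  have hm : σ * y ∈ Submodule.map (mulBy σ) (D.idealGE R) := ⟨y, hy, rfl⟩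
  rw [← D.sup_inf_div hρ hσ h₁ h₂ hR] at hm
  rw [inf_comm, D.sup_inf_div hσ hρ h₂ h₁ hS] at hm
  obtain ⟨w, hw, e⟩ := hm
  refine ⟨w, hw, mul_left_cancel₀ hρ ?_⟩
  change ρ * w = σ * y at e
  change ρ * (b * w) = ρ * (a * y)
  linear_combination b * e + y * hab

section

variable [IsNoetherianRing B]

/-- The reciprocity law for two elements `ρ` and `σ` of `B` with divisors `G + R` and `G + S`,
where `G`, `R` and `S` have pairwise disjoint supports. Both sides are the length of
`B / (G-part, a · R-part)` plus the length of the quotient of the `G`-part by `(ρ, σ)`. -/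
theorem len_reciprocity (hfin : ∀ i, ∀ c ∉ D.q i, D.len A i c ≠ ⊤) {ρ σ a b : B} (hρ : ρ ≠ 0)
    (hσ : σ ≠ 0) {G R S : ι →₀ ℕ} (h₁ : D.div ρ hρ = G + R) (h₂ : D.div σ hσ = G + S)
    (hG : ∀ i, G i ≠ 0 → R i = 0 ∧ S i = 0) (hR : ∀ i, R i ≠ 0 → S i = 0)
    (hab : b * σ = a * ρ) (ha : ∀ i, G i ≠ 0 → a ∉ D.q i) (hb : ∀ i, G i ≠ 0 → b ∉ D.q i)
    (ha0 : a ≠ 0) (hb0 : b ≠ 0) :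
    (R.sum fun i k => k * D.len A i σ) + (G.sum fun i k => k * D.len A i a) =
      (S.sum fun i k => k * D.len A i ρ) + (G.sum fun i k => k * D.len A i b) := by
  have hS : ∀ i, S i ≠ 0 → R i = 0 := fun i h => by
    by_contra h'
    exact h (hR i h')
  have step1 : ∀ {ρ σ : B} (hρ : ρ ≠ 0) (hσ : σ ≠ 0) {R S : ι →₀ ℕ} (_ : D.div ρ hρ = G + R)
      (_ : D.div σ hσ = G + S) (_ : ∀ i, G i ≠ 0 → R i = 0 ∧ S i = 0) (_ : ∀ i, R i ≠ 0 → S i = 0),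
      (R.sum fun i k => k * D.len A i σ) = relLength A (D.idealGE G ⊔ D.idealGE R) ⊤ +
        relLength A (Submodule.map (mulBy ρ) ⊤ ⊔ Submodule.map (mulBy σ) ⊤) (D.idealGE G) := by
    intro ρ σ hρ hσ R S h₁ h₂ hG hR
    have hle : ∀ {τ : B} (hτ : τ ≠ 0) {T : ι →₀ ℕ}, D.div τ hτ = G + T →
        Submodule.map (mulBy τ) ⊤ ≤ D.idealGE G := fun hτ T h => by
      rw [← D.idealGE_div _ hτ, h]
      exact D.idealGE_anti le_self_add
    rw [← D.relLength_idealGE A hfin G R (σ := σ), ← h₁, D.idealGE_div,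
      relLength_add A (sup_le_sup_left (Submodule.map_mono le_top) _)
        (sup_le (hle hρ h₁) (hle hσ h₂))]
    · congr 1
      rw [sup_comm, sup_comm (Submodule.map (mulBy ρ) ⊤),
        relLength_sup_sup A (Submodule.map_mono le_top), D.sup_inf_div hρ hσ h₁ h₂ hR,
        ← Submodule.map_sup, relLength_map A (mulBy_injective hσ)]
    · intro i hi
      left
      rw [← D.ν_eq_zero_iff i hσ, ← D.div_apply σ hσ, h₂, Finsupp.add_apply, hR i hi]
      by_cases h : G i = 0
      · simp [h]
      · exact absurd (hG i h).1 hi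
  have step2 : ∀ {c : B} (_ : c ≠ 0) (_ : ∀ i, G i ≠ 0 → c ∉ D.q i) (T : ι →₀ ℕ),
      relLength A (Submodule.map (mulBy c) (D.idealGE T) ⊔ D.idealGE G) ⊤ =
        relLength A (D.idealGE G ⊔ D.idealGE T) ⊤ + (G.sum fun i k => k * D.len A i c) := by
    intro c hc0 hc T
    have h1 := D.relLength_idealGE A hfin 0 G (σ := c) fun i hi => Or.inl (hc i hi)
    have h2 := D.inf_map_mulBy 0 G hc0 fun i hi => (D.ν_eq_zero_iff i hc0).mpr (hc i hi)
    rw [zero_add, D.idealGE_zero] at h1 h2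
    rw [← h1, relLength_add A (sup_le_sup_right (Submodule.map_mono le_top) _) le_top,
      relLength_sup_sup A (Submodule.map_mono le_top), inf_comm, h2, ← Submodule.map_sup,
      relLength_map A (mulBy_injective hc0), sup_comm (D.idealGE T), sup_comm (D.idealGE G)
      (Submodule.map (mulBy c) ⊤)]
  have step3 : Submodule.map (mulBy a) (D.idealGE R) = Submodule.map (mulBy b) (D.idealGE S) :=
    le_antisymm (D.map_mulBy_idealGE_le hρ hσ h₁ h₂ hR hab)
      (D.map_mulBy_idealGE_le hσ hρ h₂ h₁ hS hab.symm)
  have hR' := step1 hρ hσ h₁ h₂ hG hR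
  have hS' := step1 hσ hρ h₂ h₁ (fun i hi => (hG i hi).symm) hS
  have ha' := step2 ha0 ha R
  rw [step3, step2 hb0 hb S] at ha'
  rw [hR', hS', add_right_comm, ← ha', sup_comm (Submodule.map (mulBy σ) _), add_right_comm]

end

variable (hfin : ∀ i, ∀ c ∉ D.q i, D.len A i c ≠ ⊤)

include hfin

theorem chi_eq (i : ι) {u : K} {a b : B} (ha : a ∉ D.q i) (hb : b ∉ D.q i)
    (h : u * algebraMap B K b = algebraMap B K a) :
    D.chi A i u = ((D.len A i a).toNat : ℤ) - ((D.len A i b).toNat : ℤ) := by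
  have h' : ∃ ab : B × B, ab.1 ∉ D.q i ∧ ab.2 ∉ D.q i ∧
      u * algebraMap B K ab.2 = algebraMap B K ab.1 := ⟨(a, b), ha, hb, h⟩
  rw [chi, dif_pos h']
  obtain ⟨hc, hd, e⟩ := h'.choose_spec
  set c := h'.choose.1
  set d := h'.choose.2
  have e' : a * d = c * b := by
    apply IsFractionRing.injective B K
    rw [_root_.map_mul, _root_.map_mul, ← h, ← e]
    ring
  have h1 := congrArg (fun x => (D.len A i x).toNat) e'
  simp only [D.len_mul A i ha, D.len_mul A i hc, ENat.toNat_add (hfin i a ha) (hfin i d hd),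
    ENat.toNat_add (hfin i c hc) (hfin i b hb)] at h1
  omega

omit hfin in
theorem exists_frac_unit (i : ι) {u : Kˣ} (hu : D.v i u = 0) :
    ∃ a b : B, a ∉ D.q i ∧ b ∉ D.q i ∧ (u : K) * algebraMap B K b = algebraMap B K a := by
  obtain ⟨a, b, hb, e⟩ := D.exists_frac i u.ne_zero hu.ge
  have hb0 : b ≠ 0 := fun h => hb (h ▸ Ideal.zero_mem _)
  have hb' : algebraMap B K b ≠ 0 := by simpa using hb0
  have ha0 : a ≠ 0 := by
    rintro rfl
    rw [_root_.map_zero] at e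
    exact mul_ne_zero u.ne_zero hb' e
  refine ⟨a, b, ?_, hb, e⟩
  rw [← D.ν_eq_zero_iff i hb0] at hb
  rw [← D.ν_eq_zero_iff i ha0, ν, ← e, D.map_mul i u.ne_zero hb', hu, zero_add]
  exact hb

theorem chi_mul (i : ι) {f g : Kˣ} (hf : D.v i f = 0) (hg : D.v i g = 0) :
    D.chi A i ((f * g : Kˣ) : K) = D.chi A i f + D.chi A i g := by
  have hp := D.prime i
  obtain ⟨a, b, ha, hb, e⟩ := D.exists_frac_unit i hf
  obtain ⟨c, d, hc, hd, e'⟩ := D.exists_frac_unit i hg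
  have hac : a * c ∉ D.q i := fun h => (hp.mem_or_mem h).elim ha hc
  have hbd : b * d ∉ D.q i := fun h => (hp.mem_or_mem h).elim hb hd
  rw [D.chi_eq A hfin i ha hb e, D.chi_eq A hfin i hc hd e', D.chi_eq A hfin i hac hbd, D.len_mul A i ha,
    D.len_mul A i hb, ENat.toNat_add (hfin i a ha) (hfin i c hc),
    ENat.toNat_add (hfin i b hb) (hfin i d hd)]
  · push_cast; ring
  · rw [Units.val_mul, _root_.map_mul, _root_.map_mul, ← e, ← e']
    ring

theorem chi_one (i : ι) : D.chi A i ((1 : Kˣ) : K) = 0 := by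
  have := D.chi_mul A hfin i (f := 1) (g := 1) (by simp [v_one]) (by simp [v_one])
  rw [mul_one] at this
  omega

theorem chi_zpow (i : ι) {f : Kˣ} (hf : D.v i f = 0) (n : ℤ) :
    D.chi A i ((f ^ n : Kˣ) : K) = n * D.chi A i f := by
  let φ : (D.vHom i).ker →* Multiplicative ℤ :=
    { toFun := fun u => Multiplicative.ofAdd (D.chi A i (u.1 : K))
      map_one' := by rw [OneMemClass.coe_one, D.chi_one A hfin i]; rfl
      map_mul' := fun u w => by
        rw [Subgroup.coe_mul, D.chi_mul A hfin i]
        · rfl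
        · exact congrArg Multiplicative.toAdd u.2
        · exact congrArg Multiplicative.toAdd w.2 }
  have h := congrArg Multiplicative.toAdd (map_zpow φ ⟨f, congrArg Multiplicative.ofAdd hf⟩ n)
  rw [toAdd_zpow] at h
  exact h

omit hfin [IsFractionRing B K] in
theorem tame_eq_one (i : ι) {f g : Kˣ} (hf : D.v i f = 0) (hg : D.v i g = 0) :
    D.tame i f g = 1 := by
  simp [tame, hf, hg]

theorem finite_support_chi_tame (f g : Kˣ) :
    (Function.support fun i => D.chi A i (D.tame i f g : Kˣ)).Finite := by
  refine ((D.finite f.ne_zero).union (D.finite g.ne_zero)).subset fun i hi => ?_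
  by_contra h
  simp only [Set.mem_union, Set.mem_ofPred_eq, not_or, not_not] at h
  exact hi (by simp only [D.tame_eq_one i h.1 h.2]; exact D.chi_one A hfin i)

theorem tameSum_mul_left (f f' g : Kˣ) :
    D.tameSum A (f * f') g = D.tameSum A f g + D.tameSum A f' g := by
  rw [tameSum, tameSum, tameSum, ← finsum_add_distrib (D.finite_support_chi_tame A hfin _ _)
    (D.finite_support_chi_tame A hfin _ _)]
  refine finsum_congr fun i => ?_
  rw [← D.chi_mul A hfin i (D.v_tame i _ _) (D.v_tame i _ _)]
  congr 2
  rw [tame, tame, tame, Units.val_mul, D.map_mul i f.ne_zero f'.ne_zero, zpow_add, mul_zpow,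
    mul_div_mul_comm]

theorem tameSum_symm (f g : Kˣ) : D.tameSum A g f = - D.tameSum A f g := by
  rw [tameSum, tameSum, ← finsum_neg_distrib]
  refine finsum_congr fun i => ?_
  have := D.chi_zpow A hfin i (D.v_tame i f g) (-1)
  rw [neg_one_mul] at this
  rw [← this, zpow_neg_one, tame, tame, inv_div]

variable [IsNoetherianRing B]

/-- The reciprocity law for two elements of `B` which have the same order at each common zero: this is
`len_reciprocity`, with `G` the divisor of the common zeros. -/
theorem tameSum_eq_zero_of_mem {ρ σ : B} (hρ : ρ ≠ 0) (hσ : σ ≠ 0)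
    (h : ∀ i, D.ν i ρ = 0 ∨ D.ν i σ = 0 ∨ D.ν i ρ = D.ν i σ) {f g : Kˣ}
    (hf : f = algebraMap B K ρ) (hg : g = algebraMap B K σ) : D.tameSum A f g = 0 := by
  classical
  set dρ := D.div ρ hρ with hdρ
  set dσ := D.div σ hσ with hdσ
  have eρ : ∀ i, D.v i f = dρ i := fun i => by rw [hf, hdρ, D.div_apply]; rfl
  have eσ : ∀ i, D.v i g = dσ i := fun i => by rw [hg, hdσ, D.div_apply]; rfl
  have h' : ∀ i, dρ i = 0 ∨ dσ i = 0 ∨ dρ i = dσ i := fun i => by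
    have := h i
    rw [← D.div_apply ρ hρ, ← D.div_apply σ hσ, ← hdρ, ← hdσ] at this
    omega
  set G := dρ ⊓ dσ with hGd
  have h₁ : dρ = G + (dρ - G) := (add_tsub_cancel_of_le inf_le_left).symm
  have h₂ : dσ = G + (dσ - G) := (add_tsub_cancel_of_le inf_le_right).symm
  set R := dρ - G with hRd
  set S := dσ - G with hSd
  have hGi : ∀ i, G i = min (dρ i) (dσ i) := fun i => rfl
  have hRi : ∀ i, R i = dρ i - G i := fun i => rfl
  have hSi : ∀ i, S i = dσ i - G i := fun i => rfl
  -- numerator and denominator of `g / f`, which is a unit along `G`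
  obtain ⟨a, b, hb0, hb, e⟩ := D.exists_frac_finset G.support (f := ((g / f : Kˣ) : K))
    (Units.ne_zero _) fun i hi => by
      rw [v_div, eρ, eσ]
      have := Finsupp.mem_support_iff.mp hi
      rw [hGi] at this
      have := h' i
      omega
  have hab : b * σ = a * ρ := by
    apply IsFractionRing.injective B K
    rw [_root_.map_mul, _root_.map_mul, ← e, ← hf, ← hg, Units.val_div_eq_div_val]
    field_simp
  have ha0 : a ≠ 0 := by
    rintro rfl
    rw [zero_mul] at hab
    exact mul_ne_zero hb0 hσ hab
  have hbG : ∀ i, G i ≠ 0 → b ∉ D.q i := fun i hi =>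
    (D.ν_eq_zero_iff i hb0).mp (hb i (Finsupp.mem_support_iff.mpr hi))
  have haG : ∀ i, G i ≠ 0 → a ∉ D.q i := fun i hi => by
    have h3 := congrArg (D.ν i) hab
    rw [D.ν_mul i hb0 hσ, D.ν_mul i ha0 hρ, hb i (Finsupp.mem_support_iff.mpr hi),
      ← D.div_apply ρ hρ, ← D.div_apply σ hσ, ← hdρ, ← hdσ] at h3
    rw [← D.ν_eq_zero_iff i ha0]
    rw [hGi] at hi
    have := h' i
    omega
  have hσR : ∀ i, R i ≠ 0 → σ ∉ D.q i := fun i hi => by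
    rw [← D.ν_eq_zero_iff i hσ, ← D.div_apply σ hσ, ← hdσ]
    rw [hRi, hGi] at hi
    have := h' i
    omega
  have hρS : ∀ i, S i ≠ 0 → ρ ∉ D.q i := fun i hi => by
    rw [← D.ν_eq_zero_iff i hρ, ← D.div_apply ρ hρ, ← hdρ]
    rw [hSi, hGi] at hi
    have := h' i
    omega
  have key := D.len_reciprocity A hfin hρ hσ h₁ h₂
    (fun i hi => by rw [hGi] at hi; rw [hRi, hSi, hGi]; have := h' i; omega)
    (fun i hi => by rw [hRi, hGi] at hi; rw [hSi, hGi]; have := h' i; omega) hab haG hbG ha0 hb0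
  -- the identity of lengths as an identity of integers
  set T := dρ.support ∪ dσ.support with hT
  have conv : ∀ (m : ι →₀ ℕ) (c : B), m ≤ dρ ⊔ dσ → (∀ i, m i ≠ 0 → c ∉ D.q i) →
      (m.sum fun i k => k * D.len A i c) =
        ((∑ i ∈ T, m i * (D.len A i c).toNat : ℕ) : ℕ∞) := by
    intro m c hm hc
    have hsub : m.support ⊆ T := by
      intro i hi
      have h1 : m i ≤ max (dρ i) (dσ i) := hm i
      rw [hT, Finset.mem_union, Finsupp.mem_support_iff, Finsupp.mem_support_iff]
      have := Finsupp.mem_support_iff.mp hi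
      by_contra! h4
      rw [h4.1, h4.2] at h1
      simp at h1
      exact this h1
    rw [Finsupp.sum_of_support_subset m hsub _ (by simp)]
    push_cast
    refine Finset.sum_congr rfl fun i _ => ?_
    by_cases hi : m i = 0
    · simp [hi]
    · rw [ENat.natCast_toNat (hfin i c (hc i hi))]
  have hGle : G ≤ dρ ⊔ dσ := inf_le_left.trans le_sup_left
  rw [conv R σ (tsub_le_self.trans le_sup_left) hσR, conv G a hGle haG,
    conv S ρ (tsub_le_self.trans le_sup_right) hρS, conv G b hGle hbG] at key
  have key' : (∑ i ∈ T, R i * (D.len A i σ).toNat) + (∑ i ∈ T, G i * (D.len A i a).toNat) =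
      (∑ i ∈ T, S i * (D.len A i ρ).toNat) + (∑ i ∈ T, G i * (D.len A i b).toNat) := by
    exact_mod_cast key
  have hone : ∀ i, (1 : B) ∉ D.q i := fun i => (Ideal.ne_top_iff_one _).mp (D.prime i).ne_top
  have hlen1 : ∀ i, (D.len A i 1).toNat = 0 := fun i => by rw [len_one]; rfl
  have hterm : ∀ i, D.chi A i (D.tame i f g : Kˣ) = (S i * (D.len A i ρ).toNat : ℤ) +
      G i * (D.len A i b).toNat - R i * (D.len A i σ).toNat - G i * (D.len A i a).toNat := by
    intro i
    rw [tame, eρ, eσ]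
    have h4 := h' i
    by_cases hG0 : G i = 0
    · rw [hG0]
      rcases Nat.eq_zero_or_pos (dρ i) with h5 | h5
      · have h6 : S i = dσ i := by rw [hSi, hG0, Nat.sub_zero]
        have h7 : R i = 0 := by rw [hRi, h5, Nat.zero_sub]
        rw [h5, h6, h7, Nat.cast_zero, zpow_zero, div_one,
          D.chi_zpow A hfin i (by rw [eρ, h5]; rfl)]
        by_cases h8 : dσ i = 0
        · simp [h8]
        · rw [D.chi_eq A hfin i (hρS i (by omega)) (hone i) (by simp [hf]), hlen1]
          push_cast; ring
      · have h6 : dσ i = 0 := by rw [hGi] at hG0; omega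
        have h7 : R i = dρ i := by rw [hRi, hG0, Nat.sub_zero]
        have h8 : S i = 0 := by rw [hSi, h6, Nat.zero_sub]
        rw [h6, h7, h8, Nat.cast_zero, zpow_zero, one_div, ← zpow_neg,
          D.chi_zpow A hfin i (by rw [eσ, h6]; rfl),
          D.chi_eq A hfin i (hσR i (by omega)) (hone i) (by simp [hg]), hlen1]
        push_cast; ring
    · have h5 : dρ i = dσ i := by rw [hGi] at hG0; omega
      have h6 : G i = dρ i := by rw [hGi, h5, min_self]
      have h7 : R i = 0 := by rw [hRi, h6, Nat.sub_self]
      have h8 : S i = 0 := by rw [hSi, h6, h5, Nat.sub_self]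
      rw [← h5, ← div_zpow, D.chi_zpow A hfin i (by rw [v_div, eρ, eσ, h5]; ring),
        D.chi_eq A hfin i (hbG i hG0) (haG i hG0), h6, h7, h8]
      · push_cast; ring
      · rw [← e, ← mul_assoc, ← Units.val_mul, div_mul_div_cancel, div_self', Units.val_one, one_mul]
  rw [tameSum, finsum_eq_sum_of_support_subset (s := T)]
  · simp_rw [hterm]
    rw [Finset.sum_sub_distrib, Finset.sum_sub_distrib, Finset.sum_add_distrib]
    zify at key'
    linarith
  · intro i hi
    by_contra h4
    rw [hT, Finset.mem_coe, Finset.mem_union, Finsupp.mem_support_iff, Finsupp.mem_support_iff,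
      not_or, not_not, not_not] at h4
    exact hi (by
      simp only [D.tame_eq_one i (f := f) (g := g) (by rw [eρ, h4.1]; rfl) (by rw [eσ, h4.2]; rfl)]
      exact D.chi_one A hfin i)

/-- Functions without common zeros and poles satisfy the reciprocity law. -/
theorem tameSum_eq_zero_of_disjoint {f g : Kˣ} (h : ∀ i, D.v i f = 0 ∨ D.v i g = 0) :
    D.tameSum A f g = 0 := by
  have split : ∀ {f g a b : Kˣ}, f * b = a → D.tameSum A a g = 0 → D.tameSum A b g = 0 →
      D.tameSum A f g = 0 := by
    intro f g a b e h1 h2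
    rw [← e, D.tameSum_mul_left A hfin, h2, add_zero] at h1
    exact h1
  have hinj : ∀ {b : B}, b ≠ 0 → algebraMap B K b ≠ 0 := fun hb => by simpa using hb
  -- first make `f` a quotient of elements of `B` which do not vanish along the divisor of `g`
  obtain ⟨c, d, hd0, hd, e⟩ := D.exists_frac_finset (D.finite g.ne_zero).toFinset f.ne_zero
    fun i hi => by
      rw [Set.Finite.mem_toFinset] at hi
      exact ((h i).resolve_right hi).ge
  have hc0 : c ≠ 0 := by
    rintro rfl
    rw [_root_.map_zero] at e
    exact mul_ne_zero f.ne_zero (hinj hd0) e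
  have hgd : ∀ i, D.ν i d = 0 ∨ D.v i g = 0 := fun i => by
    by_cases hi : D.v i g = 0
    · exact Or.inr hi
    · exact Or.inl (hd i ((Set.Finite.mem_toFinset _).mpr hi))
  have hgc : ∀ i, D.ν i c = 0 ∨ D.v i g = 0 := fun i => by
    by_cases hi : D.v i g = 0
    · exact Or.inr hi
    · left
      have h1 := hd i ((Set.Finite.mem_toFinset _).mpr hi)
      rw [ν, ← e, D.map_mul i f.ne_zero (hinj hd0), (h i).resolve_right hi, zero_add]
      exact h1
  -- then make `g` a quotient of elements of `B` which do not vanish along the divisor of `x`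
  have aux : ∀ {x : B} (hx : x ≠ 0), (∀ i, D.ν i x = 0 ∨ D.v i g = 0) →
      D.tameSum A (Units.mk0 _ (hinj hx)) g = 0 := by
    intro x hx hgx
    obtain ⟨c', d', hd0', hd', e'⟩ := D.exists_frac_finset (D.finite (hinj hx)).toFinset g.ne_zero
      fun i hi => by
        rw [Set.Finite.mem_toFinset] at hi
        exact ((hgx i).resolve_left hi).ge
    have hc0' : c' ≠ 0 := by
      rintro rfl
      rw [_root_.map_zero] at e'
      exact mul_ne_zero g.ne_zero (hinj hd0') e'
    rw [D.tameSum_symm A hfin, neg_eq_zero]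
    refine split (a := Units.mk0 _ (hinj hc0')) (b := Units.mk0 _ (hinj hd0')) (Units.ext e') ?_ ?_
    · refine D.tameSum_eq_zero_of_mem A hfin hc0' hx (fun i => ?_) rfl rfl
      by_cases hi : D.ν i x = 0
      · exact Or.inr (Or.inl hi)
      · left
        rw [ν, ← e', D.map_mul i g.ne_zero (hinj hd0'), (hgx i).resolve_left hi, zero_add]
        exact hd' i ((Set.Finite.mem_toFinset _).mpr hi)
    · refine D.tameSum_eq_zero_of_mem A hfin hd0' hx (fun i => ?_) rfl rfl
      by_cases hi : D.ν i x = 0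
      · exact Or.inr (Or.inl hi)
      · exact Or.inl (hd' i ((Set.Finite.mem_toFinset _).mpr hi))
  exact split (a := Units.mk0 _ (hinj hc0)) (b := Units.mk0 _ (hinj hd0)) (Units.ext e)
    (aux hc0 hgc) (aux hd0 hgd)

omit hfin [IsFractionRing B K] [IsNoetherianRing B] in
/-- Moving: a homomorphism on `Kˣ` vanishes at `h` if it vanishes on the functions which are units along
the finite set `T` and on uniformizers of the places in `T` along which `h` is not a unit. -/
theorem eq_zero_of_uniformizers (θ : Kˣ →* Multiplicative ℤ) (T : Finset ι) (π : ι → Kˣ)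
    (hπ : ∀ i, D.v i (π i) = 1) (hπ' : ∀ i, ∀ j ∈ T, j ≠ i → D.v j (π i) = 0)
    (h₁ : ∀ u : Kˣ, (∀ i ∈ T, D.v i u = 0) → θ u = 1) (h : Kˣ)
    (h₂ : ∀ i ∈ T, D.v i h ≠ 0 → θ (π i) = 1) : θ h = 1 := by
  classical
  set p := ∏ i ∈ T, π i ^ D.v i h with hp
  have hθp : θ p = 1 := by
    rw [hp, map_prod]
    refine Finset.prod_eq_one fun i hi => ?_
    by_cases hv : D.v i h = 0
    · rw [hv, zpow_zero, _root_.map_one]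
    · rw [map_zpow, h₂ i hi hv, one_zpow]
  have hθ : θ (h / p) = 1 := by
    refine h₁ _ fun j hj => ?_
    have : D.v j (p : K) = D.v j h := by
      have h3 : D.vHom j p = ∏ i ∈ T, D.vHom j (π i ^ D.v i h) := by rw [hp, map_prod]
      rw [Finset.prod_eq_single_of_mem j hj] at h3
      · have := congrArg Multiplicative.toAdd h3
        change D.v j (p : K) = D.v j ((π j ^ D.v j h : Kˣ) : K) at this
        rw [this, v_zpow, hπ, mul_one]
      · intro i _ hij
        change Multiplicative.ofAdd (D.v j ((π i ^ D.v i h : Kˣ) : K)) = 1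
        rw [v_zpow, hπ' i j hj hij.symm, mul_zero]
        rfl
    rw [v_div, this, sub_self]
  rw [← div_mul_cancel h p, _root_.map_mul, hθ, hθp, one_mul]

/-- **Reciprocity law**: the orders of the tame symbols of two functions `f` and `g` sum up to zero. By
moving, this is reduced to functions with disjoint divisors, and to functions which have a single common
zero, of multiplicity one. -/
theorem tameSum_eq_zero (f g : Kˣ) : D.tameSum A f g = 0 := by
  classical
  let θ : Kˣ → Kˣ →* Multiplicative ℤ := fun g =>
    MonoidHom.mk' (fun f => Multiplicative.ofAdd (D.tameSum A f g)) fun f f' =>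
      congrArg Multiplicative.ofAdd (D.tameSum_mul_left A hfin f f' g)
  have hθ : ∀ {f g}, θ g f = 1 ↔ D.tameSum A f g = 0 := Iff.rfl
  have hinj : ∀ {b : B}, b ≠ 0 → algebraMap B K b ≠ 0 := fun hb => by simpa using hb
  set T := (D.finite f.ne_zero).toFinset with hT
  have hT' : ∀ {i}, i ∈ T ↔ D.v i f ≠ 0 := fun {i} => Set.Finite.mem_toFinset _
  choose π hπ0 hπ1 hπ using fun i => D.exists_uniformizer_avoiding i T
  rw [D.tameSum_symm A hfin, neg_eq_zero, ← hθ]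
  refine D.eq_zero_of_uniformizers (θ f) T (fun i => Units.mk0 _ (hinj (hπ0 i))) hπ1 hπ
    (fun u hu => hθ.mpr (D.tameSum_eq_zero_of_disjoint A hfin fun i => ?_)) g fun i hi _ => ?_
  · by_cases h : i ∈ T
    · exact Or.inl (hu i h)
    · exact Or.inr (not_not.mp (mt hT'.mpr h))
  set T' := (D.finite (hinj (hπ0 i))).toFinset with hTd
  have hT'' : ∀ {j}, j ∈ T' ↔ D.ν j (π i) ≠ 0 := fun {j} => Set.Finite.mem_toFinset _
  choose σ hσ0 hσ1 hσ using fun j => D.exists_uniformizer_avoiding j T'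
  rw [hθ, D.tameSum_symm A hfin, neg_eq_zero, ← hθ]
  refine D.eq_zero_of_uniformizers (θ (Units.mk0 _ (hinj (hπ0 i)))) T'
    (fun j => Units.mk0 _ (hinj (hσ0 j))) hσ1 hσ
    (fun u hu => hθ.mpr (D.tameSum_eq_zero_of_disjoint A hfin fun j => ?_)) f fun j hj hjf => ?_
  · by_cases h : j ∈ T'
    · exact Or.inl (hu j h)
    · exact Or.inr (not_not.mp (mt hT''.mpr h))
  rw [hθ]
  -- `j` is a zero of `π i` and lies in the support of `f`, so that `j = i`
  have hji : j = i := by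
    by_contra h
    exact hT''.mp hj (hπ i j (hT'.mpr hjf) h)
  subst hji
  refine D.tameSum_eq_zero_of_mem A hfin (hσ0 j) (hπ0 j) (fun l => ?_) rfl rfl
  by_cases hl : D.ν l (π j) = 0
  · exact Or.inr (Or.inl hl)
  · by_cases hlj : l = j
    · subst hlj
      exact Or.inr (Or.inr ((hσ1 l).trans (hπ1 l).symm))
    · exact Or.inl (hσ j l (hT''.mpr hl) hlj)

end KrullValuations

/-! ### Orders, determinants and norms over one-dimensional domains -/

section Order

open Matrix nonZeroDivisors

variable {R : Type*} [CommRing R] [IsDomain R]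

/-- The length of the cokernel of a square matrix. -/
def cokerLength {n : Type*} [Fintype n] [DecidableEq n] (M : Matrix n n R) : ℕ∞ :=
  relLength R (LinearMap.range M.mulVecLin) ⊤

variable {n : Type*} [Fintype n] [DecidableEq n]

theorem cokerLength_mul {M N : Matrix n n R} (hM : M.det ≠ 0) :
    cokerLength (M * N) = cokerLength M + cokerLength N := by
  have hinj : Function.Injective M.mulVecLin := by
    rw [injective_iff_map_eq_zero]
    exact fun v hv => Matrix.eq_zero_of_mulVec_eq_zero hM hv
  have h : LinearMap.range (M * N).mulVecLin ≤ LinearMap.range M.mulVecLin := by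
    rw [mulVecLin_mul]
    exact LinearMap.range_comp_le_range _ _
  have h' : relLength R (LinearMap.range (M * N).mulVecLin) (LinearMap.range M.mulVecLin) =
      cokerLength N := by
    rw [mulVecLin_mul, LinearMap.range_comp, LinearMap.range_eq_map M.mulVecLin,
      relLength_map R hinj]
    rfl
  rw [cokerLength, relLength_add R h le_top, add_comm, h']
  rfl

theorem cokerLength_of_isUnit_det {M : Matrix n n R} (hM : IsUnit M.det) : cokerLength M = 0 := by
  refine relLength_eq_zero R fun v _ => ⟨M⁻¹ *ᵥ v, ?_⟩
  rw [mulVecLin_apply, mulVec_mulVec, Matrix.mul_nonsing_inv M hM, one_mulVec]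

theorem ord_prod {κ : Type*} (s : Finset κ) (d : κ → R) (hd : ∀ i ∈ s, d i ≠ 0) :
    Ring.ord R (∏ i ∈ s, d i) = ∑ i ∈ s, Ring.ord R (d i) := by
  classical
  induction s using Finset.induction_on with
  | empty => simp
  | insert i s hi ih =>
    rw [Finset.prod_insert hi, Finset.sum_insert hi, Ring.ord_mul, ih]
    · exact fun j hj => hd j (Finset.mem_insert_of_mem hj)
    · exact mem_nonZeroDivisors_of_ne_zero
        (Finset.prod_ne_zero_iff.mpr fun j hj => hd j (Finset.mem_insert_of_mem hj))

theorem cokerLength_diagonal (d : n → R) (hd : ∀ i, d i ≠ 0) :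
    cokerLength (diagonal d) = Ring.ord R (diagonal d).det := by
  have h : LinearMap.range (diagonal d).mulVecLin =
      Submodule.pi Set.univ fun i => Ideal.span {d i} := by
    ext v
    simp only [LinearMap.mem_range, Submodule.mem_pi, Set.mem_univ, forall_const,
      Ideal.mem_span_singleton, mulVecLin_apply]
    constructor
    · rintro ⟨w, rfl⟩ i
      rw [mulVec_diagonal]
      exact dvd_mul_right _ _
    · intro h
      choose w hw using h
      exact ⟨w, funext fun i => by rw [mulVec_diagonal, hw]⟩
  rw [cokerLength, relLength_top, h, (Submodule.quotientPi _).length_eq,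
    Module.length_pi_of_fintype, det_diagonal, ord_prod _ _ fun i _ => hd i]
  rfl

variable [IsNoetherianRing R] [Ring.KrullDimLE 1 R]

variable (E : Type*) [Field E] [Algebra R E] [IsFractionRing R E]

omit [IsNoetherianRing R] [Ring.KrullDimLE 1 R] [IsDomain R] [DecidableEq n] in
/-- Clearing the denominators of a matrix. -/
theorem exists_smul_eq_map (M : Matrix n n E) :
    ∃ c : R, c ∈ R⁰ ∧ ∃ M' : Matrix n n R, M'.map (algebraMap R E) = algebraMap R E c • M := by
  obtain ⟨c, hc⟩ := IsLocalization.exist_integer_multiples_of_finite R⁰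
    (fun ij : n × n => M ij.1 ij.2)
  choose f hf using hc
  refine ⟨c, c.2, Matrix.of fun i j => f (i, j), ?_⟩
  ext i j
  rw [Matrix.map_apply, Matrix.of_apply, hf (i, j), Matrix.smul_apply, Algebra.smul_def, smul_eq_mul]

/-- The length of the cokernel of a matrix is the order of its determinant. Both sides extend to
homomorphisms on the general linear group of the fraction field, and agree on transvections and
on diagonal matrices. -/
theorem cokerLength_eq_ord_det {M : Matrix n n R} (hM : M.det ≠ 0) :
    cokerLength M = Ring.ord R M.det := by
  let E := FractionRing R
  have hinj : Function.Injective (algebraMap R E) := IsFractionRing.injective R E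
  have hdet : ∀ N : Matrix n n R, (N.map (algebraMap R E)).det = algebraMap R E N.det := fun N =>
    ((algebraMap R E).map_det N).symm
  have hmap : ∀ (c : R) (N : Matrix n n R), (diagonal (fun _ => c) * N).map (algebraMap R E) =
      algebraMap R E c • N.map (algebraMap R E) := fun c N => by
    ext i j
    simp [Matrix.diagonal_mul]
  have hdiagdet : ∀ c : R, c ≠ 0 → (diagonal (fun _ : n => c)).det ≠ 0 := fun c hc => by
    rw [det_diagonal]
    exact Finset.prod_ne_zero_iff.mpr fun _ _ => hc
  have hord : ∀ {N N' : Matrix n n R}, N'.det ≠ 0 →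
      Ring.ord R (N * N').det = Ring.ord R N.det + Ring.ord R N'.det := fun h => by
    rw [det_mul, Ring.ord_mul R (mem_nonZeroDivisors_of_ne_zero h)]
  -- the claim for all multiples of a matrix over `E` which have entries in `R`
  let P : Matrix n n E → Prop := fun N => ∀ (c : R) (N' : Matrix n n R), c ≠ 0 → N'.det ≠ 0 →
    N'.map (algebraMap R E) = algebraMap R E c • N → cokerLength N' = Ring.ord R N'.det
  have hP : P (M.map (algebraMap R E)) := by
    refine diagonal_transvection_induction_of_det_ne_zero P _ ?_ ?_ ?_ ?_
    · rw [hdet]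
      exact (map_ne_zero_iff _ hinj).mpr hM
    · intro d _ c N' hc hN' h
      have hN : N' = diagonal fun i => N' i i := by
        ext i j
        rw [diagonal_apply]
        split_ifs with hij
        · rw [hij]
        · apply hinj
          have := congrFun (congrFun h i) j
          rw [map_apply, Matrix.smul_apply, diagonal_apply_ne _ hij, smul_zero] at this
          rw [this, map_zero]
      rw [hN] at hN' ⊢
      rw [det_diagonal, Finset.prod_ne_zero_iff] at hN'
      exact cokerLength_diagonal _ fun i => hN' i (Finset.mem_univ i)
    · rintro ⟨i, j, hij, s⟩ c N' hc hN' h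
      -- conjugating by a diagonal matrix turns the transvection into one over `R`
      set d : n → R := Function.update (fun _ => 1) i c with hd
      have hd0 : ∀ k, d k ≠ 0 := fun k => by
        rw [hd, Function.update_apply]
        split_ifs
        exacts [hc, one_ne_zero]
      have hdd : (diagonal d).det ≠ 0 := by
        rw [det_diagonal]
        exact Finset.prod_ne_zero_iff.mpr fun k _ => hd0 k
      set T : Matrix n n R := transvection i j (N' i j) with hT
      have hTdet : T.det = 1 := det_transvection_of_ne i j hij _
      have e : diagonal d * N' = diagonal (fun _ => c) * (T * diagonal d) := by
        ext k l
        rw [diagonal_mul, diagonal_mul, mul_diagonal]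
        apply hinj
        have h1 := congrFun (congrFun h k) l
        have h2 := congrFun (congrFun h i) j
        rw [map_apply, Matrix.smul_apply, TransvectionStruct.toMatrix_mk, transvection, Matrix.add_apply,
          smul_eq_mul] at h1 h2
        rw [one_apply_ne hij, zero_add, single_apply_same] at h2
        rw [_root_.map_mul, h1, hT, transvection, Matrix.add_apply, _root_.map_mul, _root_.map_mul,
          _root_.map_add]
        by_cases hk : k = i ∧ l = j
        · obtain ⟨rfl, rfl⟩ := hk
          rw [single_apply_same, single_apply_same, one_apply_ne hij, one_apply_ne hij, h2, hd,
            Function.update_self, Function.update_of_ne hij.symm, _root_.map_zero, _root_.map_one]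
          ring
        · have hk' : ¬ (i = k ∧ j = l) := fun h => hk ⟨h.1.symm, h.2.symm⟩
          rw [single_apply_of_ne _ _ _ _ _ hk', single_apply_of_ne _ _ _ _ _ hk', add_zero,
            _root_.map_zero, add_zero]
          by_cases hkl : k = l
          · subst hkl
            simp
            ring
          · simp [one_apply_ne hkl]
      have h3 := congrArg cokerLength e
      have h4 := congrArg (fun N => Ring.ord R N.det) e
      have hTd : (T * diagonal d).det ≠ 0 := by rw [det_mul, hTdet, one_mul]; exact hdd
      rw [cokerLength_mul hdd, cokerLength_mul (hdiagdet c hc),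
        cokerLength_mul (M := T) (by rw [hTdet]; exact one_ne_zero),
        cokerLength_of_isUnit_det (M := T) (by rw [hTdet]; exact isUnit_one), zero_add] at h3
      simp only [hord hN', hord hTd, hord hdd, hTdet, Ring.ord_one, zero_add] at h4
      rw [cokerLength_diagonal d hd0, cokerLength_diagonal _ (fun _ => hc), ← h4] at h3
      exact ENat.add_right_injective_of_ne_top
        (Ring.ord_ne_top (mem_nonZeroDivisors_of_ne_zero hdd)) h3
    · intro F G hF hG hPF hPG c N' hc hN' h
      obtain ⟨a, ha, F', hF'⟩ := exists_smul_eq_map (R := R) E F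
      obtain ⟨b, hb, G', hG'⟩ := exists_smul_eq_map (R := R) E G
      have ha0 : a ≠ 0 := nonZeroDivisors.ne_zero ha
      have hb0 : b ≠ 0 := nonZeroDivisors.ne_zero hb
      have hdet' : ∀ {x : R} {H' : Matrix n n R} {H : Matrix n n E}, x ≠ 0 → H.det ≠ 0 →
          H'.map (algebraMap R E) = algebraMap R E x • H → H'.det ≠ 0 := by
        intro x H' H hx hH hH' h0
        have := hdet H'
        rw [h0, hH', _root_.map_zero, det_smul] at this
        exact mul_ne_zero (pow_ne_zero _ ((map_ne_zero_iff _ hinj).mpr hx)) hH this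
      have hF'd := hdet' ha0 hF hF'
      have hG'd := hdet' hb0 hG hG'
      have e : diagonal (fun _ => a * b) * N' = diagonal (fun _ => c) * (F' * G') := by
        apply Matrix.map_injective hinj
        change Matrix.map _ _ = Matrix.map _ _
        rw [hmap, hmap, Matrix.map_mul, hF', hG', h, _root_.map_mul]
        simp only [smul_mul_assoc, mul_smul_comm, smul_smul]
        congr 1
        ring
      have h3 := congrArg cokerLength e
      have h4 := congrArg (fun N => Ring.ord R N.det) e
      have hFG : (F' * G').det ≠ 0 := by rw [det_mul]; exact mul_ne_zero hF'd hG'd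
      rw [cokerLength_mul (hdiagdet _ (mul_ne_zero ha0 hb0)), cokerLength_mul (hdiagdet c hc),
        cokerLength_mul hF'd, hPF a F' ha0 hF'd hF', hPG b G' hb0 hG'd hG'] at h3
      simp only [hord hN', hord hFG, hord hG'd] at h4
      rw [cokerLength_diagonal _ (fun _ => mul_ne_zero ha0 hb0), cokerLength_diagonal _ (fun _ => hc),
        ← h4] at h3
      exact ENat.add_right_injective_of_ne_top
        (Ring.ord_ne_top (mem_nonZeroDivisors_of_ne_zero (hdiagdet _ (mul_ne_zero ha0 hb0)))) h3
  exact hP 1 M one_ne_zero hM (by rw [_root_.map_one, one_smul])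

end Order

section OrderExtension

open Matrix nonZeroDivisors

variable {R : Type*} [CommRing R] [IsDomain R]

section Norm

variable (E : Type*) {D F : Type*} [Field E] [Algebra R E] [IsFractionRing R E]
  [CommRing D] [IsDomain D] [Algebra R D] [FaithfulSMul R D]
  [Field F] [Algebra D F] [IsFractionRing D F] [Algebra R F] [Algebra E F]
  [IsScalarTower R D F] [IsScalarTower R E F]

variable (R D) in
/-- The fraction field of an integral extension `D` of `R` is the localization of `D` at the nonzero
elements of `R`. -/
theorem isLocalization_algebraMapSubmonoid [Algebra.IsIntegral R D] (F : Type*) [CommRing F]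
    [Algebra D F]
    [IsFractionRing D F] : IsLocalization (Algebra.algebraMapSubmonoid D R⁰) F := by
  refine (IsLocalization.iff_of_le_of_exists_dvd (S := F) (Algebra.algebraMapSubmonoid D R⁰) D⁰ ?_ ?_).mpr
    inferInstance
  · exact algebraMapSubmonoid_le_nonZeroDivisors_of_faithfulSMul _ le_rfl
  · intro d hd
    have h := Ideal.comap_ne_bot_of_integral_mem (R := R) (nonZeroDivisors.ne_zero hd)
      (Ideal.mem_span_singleton_self d) (Algebra.IsIntegral.isIntegral d)
    obtain ⟨r, hr, hr0⟩ := Submodule.exists_mem_ne_zero_of_ne_bot h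
    exact ⟨_, ⟨r, mem_nonZeroDivisors_of_ne_zero hr0, rfl⟩, Ideal.mem_span_singleton.mp hr⟩

variable (R D F) in
include R D in
theorem finite_fractionField [Module.Finite R D] : Module.Finite E F := by
  have := isLocalization_algebraMapSubmonoid R D F
  exact Module.Finite.of_isLocalization R D R⁰

variable (R D F) in
include R in
/-- An integral extension `D` of `R` contains a basis of its fraction field. -/
theorem exists_basis_mem [Algebra.IsIntegral R D] [Module.Finite E F] :
    ∃ (n : ℕ) (b : Module.Basis (Fin n) E F) (e : Fin n → D),
    ∀ i, b i = algebraMap D F (e i) := by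
  have := isLocalization_algebraMapSubmonoid R D F
  let b := Module.finBasis E F
  obtain ⟨⟨_, r, hr, rfl⟩, hc⟩ :=
    IsLocalization.exist_integer_multiples_of_finite (Algebra.algebraMapSubmonoid D R⁰) b
  choose e he using hc
  have hr0 : algebraMap R E r ≠ 0 :=
    (map_ne_zero_iff _ (IsFractionRing.injective R E)).mpr (nonZeroDivisors.ne_zero hr)
  refine ⟨_, b.isUnitSMul (fun _ => IsUnit.mk0 _ hr0), e, fun i => ?_⟩
  rw [he i, Module.Basis.isUnitSMul_apply, algebraMap_smul, Algebra.smul_def, Algebra.smul_def,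
    ← IsScalarTower.algebraMap_apply]

omit [IsDomain R] in
theorem length_quotient_span_singleton {D : Type*} [CommRing D] [Algebra R D] (d : D) :
    Module.length R (D ⧸ Ideal.span {d}) = relLength R (Submodule.map (LinearMap.mulLeft R d) ⊤) ⊤ := by
  rw [relLength_top]
  have h : Submodule.map (LinearMap.mulLeft R d) ⊤ = (Ideal.span {d}).restrictScalars R := by
    ext x
    simp [Ideal.mem_span_singleton', mul_comm]
  rw [h]
  exact (Submodule.Quotient.restrictScalarsEquiv R (Ideal.span {d})).length_eq.symm

theorem length_quotient_span_mul {D : Type*} [CommRing D] [IsDomain D] [Algebra R D] {c d : D}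
    (hc : c ≠ 0) : Module.length R (D ⧸ Ideal.span {c * d}) =
      Module.length R (D ⧸ Ideal.span {d}) + Module.length R (D ⧸ Ideal.span {c}) := by
  simp only [length_quotient_span_singleton]
  have hinj : Function.Injective (LinearMap.mulLeft R c) := fun _ _ h => mul_left_cancel₀ hc h
  rw [LinearMap.mulLeft_mul, Submodule.map_comp,
    relLength_add R (Submodule.map_mono le_top) le_top, relLength_map R hinj]

variable [IsNoetherianRing R] [Ring.KrullDimLE 1 R] [Module.Finite R D]

omit [FaithfulSMul R D] [IsDomain D] in
/-- If each element of a finite `R`-module is moved into a submodule by a nonzero element of `R`, then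
the submodule has finite colength. -/
theorem relLength_top_ne_top_of_torsion {L : Submodule R D}
    (hL : ∀ d : D, ∃ r : R, r ≠ 0 ∧ r • d ∈ L) :
    ∃ r : R, r ≠ 0 ∧ (∀ d, r • d ∈ L) ∧ relLength R L ⊤ ≠ ⊤ := by
  classical
  obtain ⟨S, hS⟩ := (inferInstance : Module.Finite R D)
  choose c hc0 hc using hL
  have hp0 : ∏ x ∈ S, c x ≠ 0 := Finset.prod_ne_zero_iff.mpr fun x _ => hc0 x
  have h1 : ∀ d : D, (∏ x ∈ S, c x) • d ∈ L := by
    have hle : Submodule.span R (S : Set D) ≤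
        Submodule.comap (LinearMap.lsmul R D (∏ x ∈ S, c x)) L := by
      rw [Submodule.span_le]
      intro x hx
      change (∏ x ∈ S, c x) • x ∈ L
      rw [← Finset.prod_erase_mul _ _ hx, mul_smul]
      exact L.smul_mem _ (hc x)
    rw [hS] at hle
    exact fun d => hle trivial
  refine ⟨_, hp0, h1, relLength_ne_top R (J := Ideal.span {∏ x ∈ S, c x})
    (Ring.ord_ne_top (mem_nonZeroDivisors_of_ne_zero hp0)) le_top Module.Finite.fg_top ?_⟩
  intro d _ j hj
  obtain ⟨r, rfl⟩ := Ideal.mem_span_singleton'.mp hj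
  rw [mul_smul]
  exact L.smul_mem _ (h1 d)

/-- The order of a norm: if `N(d) = a / b` for an element `d` of a finite extension `D` of `R`, then the
length of `D / d` is the difference of the orders of `a` and `b`. -/
theorem length_add_ord_of_norm_eq {d : D} (hd : d ≠ 0) {a b : R} (ha : a ≠ 0) (hb : b ≠ 0)
    (h : Algebra.norm E (algebraMap D F d) * algebraMap R E b = algebraMap R E a) :
    Module.length R (D ⧸ Ideal.span {d}) + Ring.ord R b = Ring.ord R a := by
  classical
  have hRE : Function.Injective (algebraMap R E) := IsFractionRing.injective R E
  have hDF : Function.Injective (algebraMap D F) := IsFractionRing.injective D F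
  have hRD : Function.Injective (algebraMap R D) := FaithfulSMul.algebraMap_injective R D
  have := finite_fractionField R E D F
  obtain ⟨n, v, e, he⟩ := exists_basis_mem R E D F
  -- the free `R`-module spanned by the basis, as a submodule of `D`
  let j : (Fin n → R) →ₗ[R] D := Fintype.linearCombination R e
  have hjF : ∀ w : Fin n → R, algebraMap D F (j w) = ∑ i, algebraMap R E (w i) • v i := fun w => by
    rw [Fintype.linearCombination_apply, map_sum]
    refine Finset.sum_congr rfl fun i _ => ?_
    rw [Algebra.smul_def, _root_.map_mul, ← IsScalarTower.algebraMap_apply, he, Algebra.smul_def,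
      ← IsScalarTower.algebraMap_apply]
  have hj : Function.Injective j := by
    rw [injective_iff_map_eq_zero]
    intro w hw
    have h1 := hjF w
    rw [hw, _root_.map_zero] at h1
    have h2 := Fintype.linearIndependent_iff.mp v.linearIndependent _ h1.symm
    exact funext fun i => hRE (by rw [h2 i, Pi.zero_apply, _root_.map_zero])
  set L := Submodule.map j ⊤ with hL
  obtain ⟨c, hc0, hcL, hfin⟩ := relLength_top_ne_top_of_torsion (L := L) (fun x => by
    obtain ⟨r, hr⟩ := IsLocalization.exist_integer_multiples_of_finite R⁰
      (fun i => v.repr (algebraMap D F x) i)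
    choose w hw using hr
    refine ⟨r, nonZeroDivisors.ne_zero r.2, w, trivial, hDF ?_⟩
    rw [hjF, Algebra.smul_def, _root_.map_mul, ← IsScalarTower.algebraMap_apply]
    conv_rhs => rw [← v.sum_repr (algebraMap D F x), Finset.mul_sum]
    refine Finset.sum_congr rfl fun i _ => ?_
    rw [hw i, Algebra.smul_def, Algebra.smul_def, Algebra.smul_def, _root_.map_mul,
      ← IsScalarTower.algebraMap_apply, mul_assoc])
  -- the statement for an element `x` with `x • L ≤ L`
  have key : ∀ x : D, x ≠ 0 → (∀ y ∈ L, x * y ∈ L) → ∃ m : R, m ≠ 0 ∧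
      algebraMap R E m = Algebra.norm E (algebraMap D F x) ∧
      Module.length R (D ⧸ Ideal.span {x}) = Ring.ord R m := by
    intro x hx hxL
    have hex : ∀ l, ∃ w : Fin n → R, j w = x * e l := fun l => by
      obtain ⟨w, -, hw⟩ := hxL (e l) ⟨Pi.single l 1, trivial, by
        simp [j]⟩
      exact ⟨w, hw⟩
    choose w hw using hex
    let M : Matrix (Fin n) (Fin n) R := Matrix.of fun i l => w l i
    have hM : M.map (algebraMap R E) = Algebra.leftMulMatrix v (algebraMap D F x) := by
      ext i l
      rw [Algebra.leftMulMatrix_eq_repr_mul, he, ← _root_.map_mul, ← hw l, hjF, v.repr_sum_self]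
      rfl
    have hdet : algebraMap R E M.det = Algebra.norm E (algebraMap D F x) := by
      rw [Algebra.norm_eq_matrix_det v, ← hM]
      exact (algebraMap R E).map_det M
    have hM0 : M.det ≠ 0 := by
      intro h0
      rw [h0, _root_.map_zero, eq_comm, Algebra.norm_eq_zero_iff] at hdet
      exact hx (hDF (by rw [hdet, _root_.map_zero]))
    have hcomm : (LinearMap.mulLeft R x).comp j = j.comp M.mulVecLin := by
      refine LinearMap.pi_ext' fun l => LinearMap.ext_ring ?_
      change x * j (Pi.single l 1) = j (M *ᵥ Pi.single l 1)
      have h1 : j (Pi.single l 1) = e l := by simp [j]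
      rw [h1, ← hw l]
      congr 1
      ext i
      simp [M]
    have hinj : Function.Injective (LinearMap.mulLeft R x) := fun _ _ h => mul_left_cancel₀ hx h
    refine ⟨M.det, hM0, hdet, ?_⟩
    rw [length_quotient_span_singleton, ← cokerLength_eq_ord_det hM0,
      relLength_map_eq_of_finite R hinj (le_top : L ≤ ⊤) _ le_top hfin, hL,
      ← Submodule.map_comp, hcomm, Submodule.map_comp, relLength_map R hj, cokerLength,
      LinearMap.range_eq_map]
    rintro _ ⟨y, hy, rfl⟩
    exact hxL y hy
  have hc0' : algebraMap R D c ≠ 0 := (map_ne_zero_iff _ hRD).mpr hc0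
  obtain ⟨m₁, hm₁, e₁, l₁⟩ := key (algebraMap R D c) hc0' fun y hy => by
    rw [← Algebra.smul_def]
    exact hcL y
  obtain ⟨m₂, hm₂, e₂, l₂⟩ := key (algebraMap R D c * d) (mul_ne_zero hc0' hd) fun y hy => by
    rw [mul_assoc, ← Algebra.smul_def]
    exact hcL _
  have e₃ : m₂ * b = m₁ * a := by
    apply hRE
    rw [_root_.map_mul, _root_.map_mul, e₁, e₂, _root_.map_mul, _root_.map_mul, mul_assoc, h]
  have h4 := congrArg (Ring.ord R) e₃
  rw [Ring.ord_mul R (mem_nonZeroDivisors_of_ne_zero hb), Ring.ord_mul R (mem_nonZeroDivisors_of_ne_zero ha),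
    ← l₁, ← l₂, length_quotient_span_mul hc0'] at h4
  have h5 : Module.length R (D ⧸ Ideal.span {algebraMap R D c}) ≠ ⊤ := by
    rw [l₁]
    exact Ring.ord_ne_top (mem_nonZeroDivisors_of_ne_zero hm₁)
  refine ENat.add_right_injective_of_ne_top h5 ?_
  change Module.length R (D ⧸ Ideal.span {algebraMap R D c}) + (_ + _) =
    Module.length R (D ⧸ Ideal.span {algebraMap R D c}) + Ring.ord R a
  rw [← h4]
  ring

end Norm

/-- The order of `a ∈ R` can be computed in a finite birational extension of `R`. -/
theorem ord_eq_length [IsNoetherianRing R] [Ring.KrullDimLE 1 R] {B : Type*} [CommRing B]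
    [IsDomain B]
    [Algebra R B] [Module.Finite R B] [FaithfulSMul R B]
    (hB : ∀ b : B, ∃ r s : R, r ≠ 0 ∧ r • b = algebraMap R B s) {a : R} (ha : a ≠ 0) :
    Ring.ord R a = Module.length R (B ⧸ Ideal.span {algebraMap R B a}) := by
  have hRB : Function.Injective (algebraMap R B) := FaithfulSMul.algebraMap_injective R B
  let j : R →ₗ[R] B := Algebra.linearMap R B
  obtain ⟨-, -, -, hfin⟩ := relLength_top_ne_top_of_torsion (L := Submodule.map j ⊤) fun b => by
    obtain ⟨r, s, hr, e⟩ := hB b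
    exact ⟨r, hr, s, trivial, e.symm⟩
  have hinj : Function.Injective (LinearMap.mulLeft R (algebraMap R B a)) := fun _ _ h =>
    mul_left_cancel₀ ((map_ne_zero_iff _ hRB).mpr ha) h
  have hcomm : (LinearMap.mulLeft R (algebraMap R B a)).comp j = j.comp (LinearMap.mulLeft R a) :=
    LinearMap.ext fun x => (_root_.map_mul (algebraMap R B) a x).symm
  have hle : Submodule.map (LinearMap.mulLeft R (algebraMap R B a)) (Submodule.map j ⊤) ≤
      Submodule.map j ⊤ := by
    rw [← Submodule.map_comp, hcomm, Submodule.map_comp]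
    exact Submodule.map_mono le_top
  rw [length_quotient_span_singleton, relLength_map_eq_of_finite R hinj le_top hle le_top hfin,
    ← Submodule.map_comp, hcomm, Submodule.map_comp, relLength_map R hRB,
    ← length_quotient_span_singleton]
  rfl

end OrderExtension

/-! ### Noetherian integrally closed domains -/

section IntegrallyClosed

variable {B K : Type*} [CommRing B] [IsDomain B] [IsNoetherianRing B] [Field K]
  [Algebra B K] [IsFractionRing B K]

omit [IsDomain B] [IsNoetherianRing B] [IsFractionRing B K] in
variable (B) in
/-- The ideal of denominators of an element of the fraction field. -/
def denominators (f : K) : Ideal B :=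
  Submodule.comap (LinearMap.toSpanSingleton B K f) (Submodule.map (Algebra.linearMap B K) ⊤)

omit [IsDomain B] [IsNoetherianRing B] [IsFractionRing B K] in
theorem mem_denominators {f : K} {c : B} :
    c ∈ denominators B f ↔ ∃ a : B, algebraMap B K a = algebraMap B K c * f := by
  simp [denominators, Algebra.smul_def]

/-- In a Noetherian integrally closed domain, the denominators of an element of the fraction field
which is not in `B` are contained in a prime of height one. A prime `q` which is maximal among the
ideals of denominators of the multiples of the element will do: if `g` is such a multiple,
then `q g ⊆ B`, and `q g ⊆ q` would make `g` integral over `B`. So `p₀ g ∉ q` for some `p₀ ∈ q`, and then `q`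
is minimal over `p₀`. -/
theorem exists_height_one_prime [IsIntegrallyClosed B] {f : K} (hf : ∀ b, algebraMap B K b ≠ f) :
    ∃ q : Ideal B, q.IsPrime ∧ q.height = 1 ∧ denominators B f ≤ q := by
  have hinj : Function.Injective (algebraMap B K) := IsFractionRing.injective B K
  let S : Set (Ideal B) := {I | denominators B f ≤ I ∧ I ≠ ⊤ ∧ ∃ c : B, I = denominators B (algebraMap B K c * f)}
  have hone : ∀ g : K, denominators B g ≠ ⊤ ↔ ∀ b, algebraMap B K b ≠ g := fun g => by
    rw [Ne, Ideal.eq_top_iff_one, mem_denominators]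
    simp
  obtain ⟨q, ⟨hfq, hq, c, rfl⟩, hmax⟩ := set_has_maximal_iff_noetherian.mpr (inferInstance : IsNoetherian B B) S
    ⟨denominators B f, le_rfl, (hone f).mpr hf, 1, by simp⟩
  set g := algebraMap B K c * f with hg
  have hgB := (hone g).mp hq
  have hmem : ∀ {x : B}, x ∈ denominators B g ↔ ∃ a, algebraMap B K a = algebraMap B K x * g := mem_denominators
  have hprime : (denominators B g).IsPrime := by
    refine ⟨hq, fun {x y} hxy => or_iff_not_imp_right.mpr fun hy => ?_⟩
    have hle : denominators B g ≤ denominators B (algebraMap B K (y * c) * f) := by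
      intro z hz
      obtain ⟨a, ha⟩ := hmem.mp hz
      exact mem_denominators.mpr ⟨y * a, by rw [map_mul, ha, map_mul, hg]; ring⟩
    have h2 : denominators B (algebraMap B K (y * c) * f) ≠ ⊤ := by
      rw [hone]
      intro b hb
      exact hy (hmem.mpr ⟨b, by rw [hb, map_mul, hg]; ring⟩)
    have h3 := hmax _ ⟨hfq.trans hle, h2, y * c, rfl⟩
    have h4 : denominators B g = denominators B (algebraMap B K (y * c) * f) := by
      by_contra hne
      exact h3 (lt_of_le_of_ne hle hne)
    rw [h4]
    obtain ⟨a, ha⟩ := hmem.mp hxy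
    exact mem_denominators.mpr ⟨a, by rw [ha, map_mul, map_mul, hg]; ring⟩
  have hg0 : denominators B g ≠ ⊥ := by
    obtain ⟨a, b, hb, e⟩ := IsFractionRing.div_surjective (A := B) g
    have hb' : algebraMap B K b ≠ 0 := by simpa using nonZeroDivisors.ne_zero hb
    intro h
    have : b ∈ denominators B g := hmem.mpr ⟨a, by rw [← e]; field_simp⟩
    rw [h, Submodule.mem_bot] at this
    exact nonZeroDivisors.ne_zero hb this
  obtain ⟨p₀, hp₀, s, hs, e⟩ : ∃ p₀ ∈ denominators B g, ∃ s, s ∉ denominators B g ∧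
      algebraMap B K s = algebraMap B K p₀ * g := by
    by_contra! hcon
    have hint : IsIntegral B g := by
      refine isIntegral_of_smul_mem_submodule (Submodule.map (Algebra.linearMap B K) (denominators B g)) ?_ ?_ g ?_
      · obtain ⟨x, hx, hx0⟩ := Submodule.exists_mem_ne_zero_of_ne_bot hg0
        intro h
        have : algebraMap B K x ∈ Submodule.map (Algebra.linearMap B K) (denominators B g) := ⟨x, hx, rfl⟩
        rw [h, Submodule.mem_bot] at this
        exact hx0 (hinj (by rw [this, map_zero]))
      · exact (IsNoetherian.noetherian _).map _
      · rintro _ ⟨x, hx, rfl⟩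
        obtain ⟨a, ha⟩ := hmem.mp hx
        have := hcon x hx a
        refine ⟨a, ?_, by change algebraMap B K a = g * algebraMap B K x; rw [ha, mul_comm]⟩
        by_contra h
        exact this h ha
    obtain ⟨b, hb⟩ := IsIntegrallyClosed.isIntegral_iff.mp hint
    exact hgB b hb
  have hmin : denominators B g ∈ (Ideal.span {p₀}).minimalPrimes := by
    refine ⟨⟨hprime, by simpa using hp₀⟩, ?_⟩
    rintro q' ⟨hq', hle⟩ hle' x hx
    have hp : p₀ ∈ q' := hle (Ideal.mem_span_singleton_self p₀)
    obtain ⟨a, ha⟩ := hmem.mp hx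
    have h1 : x * s = a * p₀ := hinj (by rw [map_mul, map_mul, e, ha]; ring)
    exact (hq'.mem_or_mem (h1 ▸ Ideal.mul_mem_left _ _ hp)).resolve_right fun h => hs (hle' h)
  refine ⟨_, hprime, le_antisymm (Ideal.height_le_one_of_isPrincipal_of_mem_minimalPrimes _ _ hmin) ?_, hfq⟩
  rw [Order.one_le_iff_ne_zero]
  exact fun h => hg0 (Ideal.height_eq_zero_iff_eq_bot.mp h)

/-- The localization of a Noetherian integrally closed domain at a prime of height one is a discrete
valuation ring. -/
theorem isDiscreteValuationRing_of_height_eq_one [IsIntegrallyClosed B] (q : Ideal B) [q.IsPrime]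
    (hq : q.height = 1) (O : Type*) [CommRing O] [IsDomain O] [Algebra B O]
    [IsLocalization.AtPrime O q] :
    IsDiscreteValuationRing O := by
  have hloc : IsLocalRing O := IsLocalization.AtPrime.isLocalRing O q
  have hnoeth : IsNoetherianRing O := IsLocalization.isNoetherianRing q.primeCompl O inferInstance
  have hic : IsIntegrallyClosed O :=
    isIntegrallyClosed_of_isLocalization (R := B) O q.primeCompl q.primeCompl_le_nonZeroDivisors
  have hdim : ringKrullDim O = 1 := by
    rw [IsLocalization.AtPrime.ringKrullDim_eq_height q O, hq]; rfl
  have hf : ¬ IsField O := by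
    intro h
    rw [ringKrullDim_eq_zero_of_isField h] at hdim
    exact zero_ne_one hdim
  have hle : Ring.KrullDimLE 1 O := by
    rw [Ring.krullDimLE_iff, hdim]; rfl
  have hdl : Ring.DimensionLEOne O := ⟨fun {p} hp hp' =>
    Ring.krullDimLE_one_iff_of_noZeroDivisors.mp hle p hp hp'⟩
  refine ((IsDiscreteValuationRing.TFAE O hf).out 0 2).mpr ?_
  have : IsDedekindRing O := (isDedekindRing_iff O (FractionRing O)).mpr
    ⟨hnoeth, hdl, fun h => IsIntegrallyClosed.isIntegral_iff.mp h⟩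
  exact {}

variable {ι : Type*} (O : ι → Type*) [∀ i, CommRing (O i)] [∀ i, IsDomain (O i)]
  [∀ i, IsDiscreteValuationRing (O i)] [∀ i, Algebra B (O i)] [∀ i, Algebra (O i) K]
  [∀ i, IsFractionRing (O i) K] [∀ i, IsScalarTower B (O i) K]

/-- The valuations of a Noetherian integrally closed domain at its primes of height one, given by
the localizations `O i` of `B` at these primes. -/
def KrullValuations.ofLocalizations [IsIntegrallyClosed B] (q : ι → Ideal B) [∀ i, (q i).IsPrime]
    [∀ i, IsLocalization.AtPrime (O i) (q i)]
    (hq : ∀ i, (q i).height = 1) (hinj : Function.Injective q)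
    (hsurj : ∀ p : Ideal B, p.IsPrime → p.height = 1 → ∃ i, q i = p)
    (v : ι → K → ℤ) (hv : ∀ i f, f ≠ 0 → Ring.ordFrac (O i) f = WithZero.exp (v i f))
    (hfin : ∀ f, f ≠ 0 → {i | v i f ≠ 0}.Finite) : KrullValuations B K ι :=
  have hK : ∀ {b : B}, b ≠ 0 → algebraMap B K b ≠ 0 := fun hb => by simpa using hb
  have hO : ∀ i {b : O i}, b ≠ 0 → algebraMap (O i) K b ≠ 0 := fun i b hb => by simpa using hb
  have hnonneg : ∀ i {b : O i}, b ≠ 0 → 0 ≤ v i (algebraMap (O i) K b) := fun i b hb => by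
    have := Ring.ordFrac_ge_one_of_ne_zero (K := K) hb
    rwa [hv i _ (hO i hb), ← WithZero.exp_zero, WithZero.exp_le_exp] at this
  have hunit : ∀ i {b : O i}, b ≠ 0 → (v i (algebraMap (O i) K b) = 0 ↔ IsUnit b) := fun i b hb => by
    rw [Ring.isUnit_iff_ordFrac_one_of_isDiscreteValuationRing (K := K), hv i _ (hO i hb), ← WithZero.exp_zero,
      WithZero.exp_inj]
  have hmul : ∀ i {f g : K}, f ≠ 0 → g ≠ 0 → v i (f * g) = v i f + v i g := fun i f g hf hg => by
    have := _root_.map_mul (Ring.ordFrac (O i)) f g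
    rwa [hv i _ (mul_ne_zero hf hg), hv i _ hf, hv i _ hg, ← WithZero.exp_add, WithZero.exp_inj] at this
  have hfrac : ∀ i {f : K}, f ≠ 0 → 0 ≤ v i f →
      ∃ a b : B, b ∉ q i ∧ f * algebraMap B K b = algebraMap B K a := fun i f hf h => by
    obtain ⟨c, rfl⟩ : ∃ c : O i, algebraMap (O i) K c = f := by
      have h1 : (IsDiscreteValuationRing.maximalIdeal (O i)).valuation K f ≤ 1 := by
        have h2 := Ring.ordFrac_eq_valuation_inv (R := O i) f
        rw [hv i f hf, ← inv_eq_iff_eq_inv] at h2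
        rw [← h2, ← WithZero.exp_neg, ← WithZero.exp_zero, WithZero.exp_le_exp]
        omega
      exact IsDiscreteValuationRing.exists_lift_of_le_one h1
    obtain ⟨a, b, rfl⟩ := IsLocalization.exists_mk'_eq (q i).primeCompl c
    refine ⟨a, b, b.2, ?_⟩
    rw [IsScalarTower.algebraMap_apply B (O i) K, IsScalarTower.algebraMap_apply B (O i) K, ← _root_.map_mul,
      IsLocalization.mk'_spec]
  { v := v
    q := q
    prime := inferInstance
    map_mul := hmul
    map_add := fun i f g hf hg hfg => by
      have := Ring.ordFrac_add (R := O i) f g hfg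
      rw [hv i _ hfg, hv i _ hf, hv i _ hg] at this
      rcases min_le_iff.mp this with h | h <;> rw [WithZero.exp_le_exp] at h
      · exact min_le_of_left_le h
      · exact min_le_of_right_le h
    exists_of_nonneg := fun {f} hf h => by
      by_contra! hcon
      obtain ⟨p, hp, hp1, hle⟩ := exists_height_one_prime hcon
      obtain ⟨i, rfl⟩ := hsurj p hp hp1
      obtain ⟨a, b, hb, e⟩ := hfrac i hf (h i)
      exact hb (hle (mem_denominators.mpr ⟨a, by rw [← e, mul_comm]⟩))
    nonneg := fun i b hb => by
      rw [IsScalarTower.algebraMap_apply B (O i) K]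
      refine hnonneg i fun h => hK hb ?_
      rw [IsScalarTower.algebraMap_apply B (O i) K, h, map_zero]
    pos_iff := fun i b hb => by
      have hb' : algebraMap B (O i) b ≠ 0 := fun h => hK hb (by
        rw [IsScalarTower.algebraMap_apply B (O i) K, h, map_zero])
      rw [IsScalarTower.algebraMap_apply B (O i) K, lt_iff_le_and_ne]
      simp only [hnonneg i hb', true_and]
      rw [ne_comm, Ne, hunit i hb', IsLocalization.AtPrime.isUnit_to_map_iff (O i) (q i)]
      exact not_not
    exists_frac := hfrac
    finite := fun {f} hf => hfin f hf
    exists_uniformizer := fun i => by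
      obtain ⟨ϖ, hϖ⟩ := IsDiscreteValuationRing.exists_irreducible (O i)
      obtain ⟨a, b, rfl⟩ := IsLocalization.exists_mk'_eq (q i).primeCompl ϖ
      have hb0 : (b : B) ≠ 0 := fun h => b.2 (h ▸ zero_mem _)
      have e : algebraMap (O i) K (IsLocalization.mk' (O i) a b) * algebraMap B K b = algebraMap B K a := by
        rw [IsScalarTower.algebraMap_apply B (O i) K, IsScalarTower.algebraMap_apply B (O i) K, ← _root_.map_mul,
          IsLocalization.mk'_spec]
      have h1 : v i (algebraMap (O i) K (IsLocalization.mk' (O i) a b)) = 1 := by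
        have := Ring.ordFrac_irreducible (K := K) hϖ
        rwa [hv i _ (hO i hϖ.ne_zero), WithZero.exp_inj] at this
      have h2 : v i (algebraMap B K b) = 0 := by
        have hb' : algebraMap B (O i) b ≠ 0 := fun h => hK hb0 (by
          rw [IsScalarTower.algebraMap_apply B (O i) K, h, map_zero])
        rw [IsScalarTower.algebraMap_apply B (O i) K, hunit i hb']
        exact IsLocalization.map_units (O i) b
      have h3 := hmul i (hO i hϖ.ne_zero) (hK hb0)
      rw [e, h1, h2, add_zero] at h3
      refine ⟨a, ?_, h3⟩
      rintro rfl
      rw [map_zero] at e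
      exact mul_ne_zero (hO i hϖ.ne_zero) (hK hb0) e
    not_le := fun {i j} hij hle => by
      have hfin : (q i).FiniteHeight := ⟨Or.inr (by rw [hq]; exact ENat.one_ne_top)⟩
      have hlt : q i < q j := lt_of_le_of_ne hle fun h => hij (hinj h)
      have := Ideal.height_strict_mono_of_isPrime_of_isPrime hlt
      rw [hq, hq] at this
      exact lt_irrefl _ this }

end IntegrallyClosed

/-! ### Finiteness of integral closures -/

section FiniteIntegralClosure

open nonZeroDivisors

/-- A nonzero functional forces an integral extension `B` of a Noetherian domain `S` to be finite:
the functional composed with the multiplications by the elements of a basis of the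
fraction field embeds `B` into a finite free module. -/
theorem finite_of_linearMap_ne_zero {S B : Type*} (L K : Type*) [CommRing S] [IsDomain S]
    [IsNoetherianRing S]
    [CommRing B] [IsDomain B] [Algebra S B] [FaithfulSMul S B] [Algebra.IsIntegral S B]
    [Field L] [Algebra S L] [IsFractionRing S L] [Field K] [Algebra B K] [IsFractionRing B K]
    [Algebra S K] [Algebra L K] [IsScalarTower S B K] [IsScalarTower S L K] [Module.Finite L K]
    (l : B →ₗ[S] S) (hl : l ≠ 0) : Module.Finite S B := by
  have hBK : Function.Injective (algebraMap B K) := IsFractionRing.injective B K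
  have hSB : Function.Injective (algebraMap S B) := FaithfulSMul.algebraMap_injective S B
  obtain ⟨n, v, e, he⟩ := exists_basis_mem S L B K
  let Φ : B →ₗ[S] (Fin n → S) := LinearMap.pi fun i => l.comp (LinearMap.mulLeft S (e i))
  refine Module.Finite.of_injective Φ ((injective_iff_map_eq_zero Φ).mpr fun b hb => ?_)
  by_contra hb0
  refine hl (LinearMap.ext fun c => ?_)
  have h1 := Ideal.comap_ne_bot_of_integral_mem (R := S) hb0
    (Ideal.mem_span_singleton_self b) (Algebra.IsIntegral.isIntegral b)
  obtain ⟨d, hd, hd0⟩ := Submodule.exists_mem_ne_zero_of_ne_bot h1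
  obtain ⟨a, ha⟩ := Ideal.mem_span_singleton.mp (Ideal.mem_comap.mp hd)
  obtain ⟨s, hs⟩ := IsLocalization.exist_integer_multiples_of_finite S⁰
    (fun i => v.repr (algebraMap B K (a * c)) i)
  choose w hw using hs
  have h2 : s.1 • (a * c) = ∑ i, w i • e i := by
    apply hBK
    rw [map_sum, Algebra.smul_def, map_mul, ← IsScalarTower.algebraMap_apply S B K]
    conv_lhs => rw [← v.sum_repr (algebraMap B K (a * c)), Finset.mul_sum]
    refine Finset.sum_congr rfl fun i _ => ?_
    rw [Algebra.smul_def (w i) (e i), map_mul _ (algebraMap S B (w i)), ← he, ← IsScalarTower.algebraMap_apply S B K, IsScalarTower.algebraMap_apply S L K (w i),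
      hw i, Algebra.smul_def, Algebra.smul_def, map_mul (algebraMap L K), ← IsScalarTower.algebraMap_apply, mul_assoc]
  have h3 : s.1 • (d • c) = ∑ i, w i • (e i * b) := by
    rw [Algebra.smul_def d, ha, mul_assoc, ← mul_smul_comm, h2, Finset.mul_sum]
    exact Finset.sum_congr rfl fun i _ => by rw [mul_smul_comm, mul_comm]
  have h4 : s.1 * (d * l c) = 0 := by
    rw [← smul_eq_mul, ← smul_eq_mul, ← map_smul, ← map_smul, h3, map_sum]
    refine Finset.sum_eq_zero fun i _ => ?_
    rw [map_smul]
    have := congrFun hb i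
    change l (e i * b) = 0 at this
    rw [this, smul_zero]
  exact (mul_eq_zero.mp ((mul_eq_zero.mp h4).resolve_left (nonZeroDivisors.ne_zero s.2))).resolve_left hd0

/-- A `p ^ e`-th root map on a field `k`: an additive retraction of the iterated Frobenius map, linear over
`k ^ (p ^ e)`. -/
theorem exists_frobenius_retraction (k : Type*) [Field k] (p e : ℕ) [ExpChar k p] :
    ∃ r : k →+ k, r 1 = 1 ∧ ∀ a b, r (a ^ p ^ e * b) = a * r b := by
  let φ : k →+* k := iterateFrobenius k p e
  obtain ⟨f, hf⟩ := (Algebra.linearMap φ.fieldRange k).exists_leftInverse_of_injective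
    (LinearMap.ker_eq_bot.mpr (algebraMap φ.fieldRange k).injective)
  let ψ : k ≃+* φ.fieldRange := φ.rangeRestrictFieldEquiv
  refine ⟨ψ.symm.toAddMonoidHom.comp f.toAddMonoidHom, ?_, fun a b => ?_⟩
  · have := LinearMap.congr_fun hf 1
    change f (algebraMap φ.fieldRange k 1) = 1 at this
    rw [map_one] at this
    change ψ.symm (f 1) = 1
    rw [this, map_one]
  · change ψ.symm (f (ψ a • b)) = a * ψ.symm (f b)
    rw [map_smul, smul_eq_mul, map_mul, RingEquiv.symm_apply_apply]

/-- Polynomial rings over a field are Frobenius split. -/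
theorem exists_frobenius_splitting (k σ : Type*) [Field k] (p e : ℕ) [ExpChar k p] :
    ∃ m : MvPolynomial σ k →+ MvPolynomial σ k, m 1 = 1 ∧ ∀ a b, m (a ^ p ^ e * b) = a * m b := by
  obtain ⟨r, hr1, hr⟩ := exists_frobenius_retraction k p e
  have hq0 : p ^ e ≠ 0 := (expChar_pow_pos k p e).ne'
  have hinj : Function.Injective fun α : σ →₀ ℕ => p ^ e • α := fun α β h => by
    ext i
    exact Nat.eq_of_mul_eq_mul_left (Nat.pos_of_ne_zero hq0) (DFunLike.congr_fun h i)
  let m : MvPolynomial σ k →+ MvPolynomial σ k :=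
    (AddMonoidAlgebra.coeffAddEquiv.symm.toAddMonoidHom.comp
      ((Finsupp.mapRange.addMonoidHom r).comp (Finsupp.comapDomain.addMonoidHom hinj))).comp
        AddMonoidAlgebra.coeffAddEquiv.toAddMonoidHom
  have hm : ∀ f α, (m f).coeff α = r (f.coeff (p ^ e • α)) := fun f α => rfl
  refine ⟨m, ?_, fun a b => ?_⟩
  · classical
    ext α
    rw [hm, MvPolynomial.coeff_one, MvPolynomial.coeff_one]
    by_cases h : (0 : σ →₀ ℕ) = α
    · subst h; simp [hr1]
    · rw [if_neg h, if_neg fun h' => h (hinj (by simpa using h')), map_zero]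
  · have : ExpChar (MvPolynomial σ k) p :=
      expChar_of_injective_ringHom (MvPolynomial.C_injective σ k) p
    induction a using MvPolynomial.induction_on' with
    | monomial β c =>
      ext α
      rw [hm, MvPolynomial.monomial_pow, MvPolynomial.coeff_monomial_mul', MvPolynomial.coeff_monomial_mul', hm]
      by_cases h : β ≤ α
      · rw [if_pos h, if_pos (nsmul_le_nsmul_right h _), hr]
        congr 3
        ext i
        exact (Nat.mul_sub _ _ _).symm
      · rw [if_neg h, if_neg, map_zero]
        intro h'
        exact h fun i => Nat.le_of_mul_le_mul_left (h' i) (Nat.pos_of_ne_zero hq0)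
    | add f g hf hg =>
      rw [add_pow_expChar_pow, add_mul, map_add, hf, hg, add_mul]

/-- An integral extension of a polynomial ring over a field whose fraction field is a finite
extension is finite. By a separable trace, a high power of Frobenius and a Frobenius splitting of the polynomial
ring one obtains a nonzero functional. -/
theorem finite_of_isIntegral_mvPolynomial {k σ B : Type*} [Field k] [Finite σ] (L K : Type*)
    [CommRing B] [IsDomain B] [Algebra (MvPolynomial σ k) B] [FaithfulSMul (MvPolynomial σ k) B]
    [Algebra.IsIntegral (MvPolynomial σ k) B]
    [Field L] [Algebra (MvPolynomial σ k) L] [IsFractionRing (MvPolynomial σ k) L] [Field K]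
    [Algebra B K]
    [IsFractionRing B K] [Algebra (MvPolynomial σ k) K] [Algebra L K]
    [IsScalarTower (MvPolynomial σ k) B K]
    [IsScalarTower (MvPolynomial σ k) L K] [Module.Finite L K] :
    Module.Finite (MvPolynomial σ k) B := by
  set S := MvPolynomial σ k
  obtain ⟨p, _⟩ := ExpChar.exists k
  have hSL : Function.Injective (algebraMap S L) := IsFractionRing.injective S L
  have hkL : Function.Injective ((algebraMap S L).comp MvPolynomial.C) := hSL.comp (MvPolynomial.C_injective σ k)
  have : ExpChar L p := expChar_of_injective_ringHom hkL p
  set E := separableClosure L K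
  have : ExpChar E p := expChar_of_injective_algebraMap (algebraMap L E).injective p
  have : ExpChar K p := expChar_of_injective_algebraMap (algebraMap L K).injective p
  set e := IsPurelyInseparable.exponent E K
  let φ : K →+* E := IsPurelyInseparable.iterateFrobenius E K p (le_refl e)
  have hφ : ∀ a, algebraMap E K (φ a) = a ^ p ^ e := IsPurelyInseparable.algebraMap_iterateFrobenius E p (le_refl e)
  obtain ⟨m, hm1, hm⟩ := exists_frobenius_splitting k σ p e
  -- an integral element of nonzero trace
  obtain ⟨w, hw⟩ : ∃ w : E, Algebra.trace L E w ≠ 0 := by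
    by_contra! h
    exact Algebra.trace_ne_zero L E (LinearMap.ext h)
  have : IsScalarTower S E K := IsScalarTower.of_algebraMap_eq fun x => by
    rw [IsScalarTower.algebraMap_apply S L E, IsScalarTower.algebraMap_apply S L K]
    rfl
  have halg : Algebra.IsAlgebraic S E := by
    have := IsLocalization.isAlgebraic (S := L) S⁰
    exact Algebra.IsAlgebraic.trans S L E
  obtain ⟨s, hs0, hs⟩ := (halg.isAlgebraic w).exists_integral_multiple
  have hint : ∀ b : B, ∃ y : S, algebraMap S L y = Algebra.trace L E (s • w * φ (algebraMap B K b)) := fun b => by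
    have h1 : IsIntegral S (φ (algebraMap B K b)) := by
      rw [← isIntegral_algebraMap_iff (algebraMap E K).injective, hφ]
      exact ((Algebra.IsIntegral.isIntegral b).map (IsScalarTower.toAlgHom S B K)).pow _
    exact IsIntegrallyClosed.isIntegral_iff.mp (Algebra.isIntegral_trace (hs.mul h1))
  choose y hy using hint
  have hφS : ∀ a : S, φ (algebraMap S K a) = algebraMap S E (a ^ p ^ e) := fun a => by
    apply (algebraMap E K).injective
    rw [hφ, ← IsScalarTower.algebraMap_apply, map_pow]
  let l : B →ₗ[S] S :=
    { toFun := fun b => m (y 1 ^ (p ^ e - 1) * y b)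
      map_add' := fun a b => by
        rw [← map_add, ← mul_add]
        congr 2
        apply hSL
        rw [map_add, hy, hy, hy, map_add, map_add, mul_add, map_add]
      map_smul' := fun a b => by
        have : y (a • b) = a ^ p ^ e * y b := by
          apply hSL
          rw [hy, Algebra.smul_def a b, map_mul (algebraMap B K), map_mul φ, ← IsScalarTower.algebraMap_apply S B K, hφS,
            IsScalarTower.algebraMap_apply S L E (a ^ p ^ e), mul_left_comm, ← Algebra.smul_def, map_smul, smul_eq_mul, map_mul (algebraMap S L), hy]
        rw [this, mul_left_comm, hm]
        rfl }
  refine finite_of_linearMap_ne_zero L K l fun hl => ?_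
  have h1 : l 1 = y 1 := by
    change m (y 1 ^ (p ^ e - 1) * y 1) = y 1
    rw [← pow_succ, Nat.sub_add_cancel (expChar_pow_pos k p e), ← mul_one (y 1 ^ p ^ e), hm, hm1, mul_one]
  rw [hl, LinearMap.zero_apply] at h1
  have h2 := hy 1
  rw [← h1, map_zero, map_one, map_one, mul_one, ← algebraMap_smul L s w, map_smul, smul_eq_mul, eq_comm,
    mul_eq_zero] at h2
  refine h2.elim (fun h => hs0 (hSL (by rw [h, map_zero]))) hw

/-- The integral closure of a domain which is finitely generated over a field in its fraction
field is finite. -/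
theorem finite_integralClosure (k : Type*) {R : Type*} (K : Type*) [Field k] [CommRing R]
    [IsDomain R] [Algebra k R]
    [Algebra.FiniteType k R] [Field K] [Algebra R K] [IsFractionRing R K] :
    Module.Finite R (integralClosure R K) := by
  obtain ⟨n, g, hg, hgf⟩ := exists_finite_inj_algHom_of_fg k R
  set S := MvPolynomial (Fin n) k
  let : Algebra S R := g.toRingHom.toAlgebra
  have : Module.Finite S R := hgf
  have : FaithfulSMul S R := (faithfulSMul_iff_algebraMap_injective S R).mpr hg
  let : Algebra S K := ((algebraMap R K).comp (algebraMap S R)).toAlgebra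
  have : IsScalarTower S R K := IsScalarTower.of_algebraMap_eq' rfl
  have : FaithfulSMul S K := (faithfulSMul_iff_algebraMap_injective S K).mpr
    ((IsFractionRing.injective R K).comp hg)
  let : Algebra (FractionRing S) K := FractionRing.liftAlgebra S K
  have : IsScalarTower S (FractionRing S) K := FractionRing.isScalarTower_liftAlgebra S K
  have := finite_fractionField S (FractionRing S) R K
  have : Algebra.IsAlgebraic R K := IsLocalization.isAlgebraic (S := K) R⁰
  have : IsFractionRing (integralClosure R K) K :=
    IsIntegralClosure.isFractionRing_of_algebraic R _ fun _ h => (map_eq_zero_iff _ (IsFractionRing.injective R K)).mp h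
  have : IsScalarTower S R (integralClosure R K) := inferInstance
  have : Algebra.IsIntegral S (integralClosure R K) := Algebra.IsIntegral.trans R
  have : FaithfulSMul S (integralClosure R K) := (faithfulSMul_iff_algebraMap_injective _ _).mpr fun a b h =>
    FaithfulSMul.algebraMap_injective S K (congrArg (algebraMap (integralClosure R K) K) h)
  have : Module.Finite S (integralClosure R K) := finite_of_isIntegral_mvPolynomial (FractionRing S) K
  exact Module.Finite.of_restrictScalars_finite S R _

end FiniteIntegralClosure

/-! ### The local ring of a point and the subvarieties through it -/

section Specialization

variable {X : Scheme.{u}}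

/-- The restriction to the subvariety with generic point `v` of the functions which are regular at
the point `z` of this subvariety. -/
def specRes {v z : X} (h : v ⤳ z) : X.presheaf.stalk z →+* X.residueField v :=
  (X.presheaf.stalkSpecializes h ≫ X.residue v).hom

theorem specRes_apply {v z : X} (h : v ⤳ z) (a : X.presheaf.stalk z) :
    specRes h a = X.residue v (X.presheaf.stalkSpecializes h a) := rfl

theorem specRes_germ {v z : X} (h : v ⤳ z) {U : X.Opens} (hz : z ∈ U) (s : Γ(X, U)) :
    specRes h (X.presheaf.germ U z hz s) = X.evaluation U v (h.mem_open U.isOpen hz) s := by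
  exact congrArg (X.residue v) (ConcreteCategory.congr_hom (X.presheaf.germ_stalkSpecializes hz h) s)

theorem exists_affine_mem (z : X) : ∃ U : X.Opens, IsAffineOpen U ∧ z ∈ U := by
  obtain ⟨_, ⟨U, hU, rfl⟩, hz, -⟩ := X.isBasis_affineOpens.exists_subset_of_mem_open
    (Set.mem_univ z) isOpen_univ
  exact ⟨U, hU, hz⟩

/-- The residue field of a point of an affine open `U` is a field of fractions for the image of the
functions on `U`. -/
theorem exists_evaluation_frac {U : X.Opens} (hU : IsAffineOpen U) {v : X} (hv : v ∈ U)
    (t : X.residueField v) : ∃ a b : Γ(X, U), X.evaluation U v hv b ≠ 0 ∧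
      t * X.evaluation U v hv b = X.evaluation U v hv a := by
  obtain ⟨s, rfl⟩ := X.residue_surjective v t
  let := TopCat.Presheaf.algebra_section_stalk X.presheaf (⟨v, hv⟩ : U)
  have := hU.isLocalization_stalk ⟨v, hv⟩
  obtain ⟨a, b, rfl⟩ := IsLocalization.exists_mk'_eq (hU.primeIdealOf ⟨v, hv⟩).asIdeal.primeCompl s
  refine ⟨a, b, ?_, ?_⟩
  · have h1 : IsUnit (X.presheaf.germ U v hv b) :=
      IsLocalization.map_units (X.presheaf.stalk v) b
    exact (h1.map (X.residue v).hom).ne_zero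
  · have h1 := IsLocalization.mk'_spec (X.presheaf.stalk v) a b
    have h2 := congrArg (X.residue v) h1
    rw [map_mul] at h2
    exact h2

theorem exists_specRes_frac {v z : X} (h : v ⤳ z) (t : X.residueField v) :
    ∃ a b : X.presheaf.stalk z, specRes h b ≠ 0 ∧ t * specRes h b = specRes h a := by
  obtain ⟨U, hU, hz⟩ := exists_affine_mem z
  obtain ⟨a, b, hb, e⟩ := exists_evaluation_frac hU (h.mem_open U.isOpen hz) t
  refine ⟨X.presheaf.germ U z hz a, X.presheaf.germ U z hz b, ?_, ?_⟩
  · rwa [specRes_germ]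
  · rwa [specRes_germ, specRes_germ]

theorem fromSpecStalk_ker_specRes {v z : X} (h : v ⤳ z) :
    X.fromSpecStalk z ⟨RingHom.ker (specRes h), RingHom.ker_isPrime _⟩ = v := by
  have h1 : Spec.map (X.presheaf.stalkSpecializes h ≫ X.residue v) ≫ X.fromSpecStalk z =
      X.fromSpecResidueField v := by
    rw [Spec.map_comp, Category.assoc, Scheme.SpecMap_stalkSpecializes_fromSpecStalk]
    rfl
  have h2 : (Spec.map (X.presheaf.stalkSpecializes h ≫ X.residue v) ≫ X.fromSpecStalk z)
      (⊥ : PrimeSpectrum (X.residueField v)) = v := by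
    rw [h1]
    exact Scheme.fromSpecResidueField_apply v _
  exact h2

/-- Every prime of the local ring at `z` is the ideal of a subvariety through `z`. -/
theorem exists_ker_specRes_eq {z : X} (p : Ideal (X.presheaf.stalk z)) [hp : p.IsPrime] :
    ∃ (w : X) (h : w ⤳ z), RingHom.ker (specRes h) = p := by
  have h : X.fromSpecStalk z ⟨p, hp⟩ ⤳ z := by
    have : X.fromSpecStalk z ⟨p, hp⟩ ∈ Set.range (X.fromSpecStalk z) := ⟨_, rfl⟩
    rwa [Scheme.range_fromSpecStalk] at this
  refine ⟨_, h, ?_⟩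
  have h1 := fromSpecStalk_ker_specRes h
  have h2 := (X.fromSpecStalk z).isEmbedding.injective h1
  exact congrArg PrimeSpectrum.asIdeal h2

theorem ker_specRes_le_iff {v w z : X} (hv : v ⤳ z) (hw : w ⤳ z) :
    RingHom.ker (specRes hv) ≤ RingHom.ker (specRes hw) ↔ v ⤳ w := by
  have h1 := fromSpecStalk_ker_specRes hv
  have h2 := fromSpecStalk_ker_specRes hw
  refine (PrimeSpectrum.le_iff_specializes ⟨_, RingHom.ker_isPrime (specRes hv)⟩
    ⟨_, RingHom.ker_isPrime (specRes hw)⟩).trans ?_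
  refine (X.fromSpecStalk z).isEmbedding.specializes_iff.symm.trans ?_
  exact iff_of_eq (congrArg₂ (· ⤳ ·) h1 h2)

theorem ker_specRes_self (z : X) : RingHom.ker (specRes (specializes_refl z)) =
    IsLocalRing.maximalIdeal (X.presheaf.stalk z) := by
  ext a
  rw [RingHom.mem_ker, specRes_apply, X.presheaf.stalkSpecializes_refl]
  exact IsLocalRing.residue_eq_zero_iff a

/-- The pull-back of rational functions is compatible with the pull-back of regular functions. -/
theorem pullFun_specRes {Y : Scheme.{u}} [IsIntegral Y] (g : Y ⟶ X) {v z : X}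
    (hv : v = g (genericPoint Y))
    (h : v ⤳ z) (y : Y) (h' : g y ⤳ z) (a : X.presheaf.stalk z) :
    pullFun g hv (specRes h a) =
      algebraMap (Y.presheaf.stalk y) Y.functionField (g.stalkMap y (X.presheaf.stalkSpecializes h' a)) := by
  subst hv
  have hy : genericPoint Y ⤳ y := genericPoint_specializes y
  have h1 : ∀ b, pullFun g rfl (X.residue _ b) = g.stalkMap (genericPoint Y) b := fun b => by
    simp [pullFun]
    rfl
  have h2 := g.stalkSpecializes_stalkMap_apply _ _ hy (X.presheaf.stalkSpecializes h' a)
  rw [specRes_apply, h1]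
  refine Eq.trans (congrArg (g.stalkMap (genericPoint Y)) ?_) h2
  exact (ConcreteCategory.congr_hom (X.presheaf.stalkSpecializes_comp (g.base.hom.map_specializes hy) h') a).symm

end Specialization

/-! ### The normalization of a subvariety -/

section IntegralClosureInField

variable {R T : Type*} [CommRing R] [Field T] [Algebra R T]

theorem isFractionRing_integralClosure
    (h : ∀ t : T, ∃ a b : R, algebraMap R T b ≠ 0 ∧ t * algebraMap R T b = algebraMap R T a) :
    IsFractionRing (integralClosure R T) T := by
  refine IsFractionRing.of_field _ _ fun t => ?_
  obtain ⟨a, b, hb, e⟩ := h t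
  exact ⟨algebraMap R _ a, algebraMap R _ b, by
    rw [← IsScalarTower.algebraMap_apply, ← IsScalarTower.algebraMap_apply, eq_div_iff hb, e]⟩

theorem isIntegrallyClosed_integralClosure
    (h : ∀ t : T, ∃ a b : R, algebraMap R T b ≠ 0 ∧ t * algebraMap R T b = algebraMap R T a) :
    IsIntegrallyClosed (integralClosure R T) := by
  have := isFractionRing_integralClosure h
  exact (isIntegrallyClosed_iff_isIntegrallyClosedIn T).mpr inferInstance

theorem finite_integralClosure_of_frac (k : Type*) [Field k] [Algebra k R] [Algebra.FiniteType k R]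
    (h : ∀ t : T, ∃ a b : R, algebraMap R T b ≠ 0 ∧ t * algebraMap R T b = algebraMap R T a) :
    Module.Finite R (integralClosure R T) := by
  let I := RingHom.ker (algebraMap R T)
  have : I.IsPrime := RingHom.ker_isPrime _
  let : Algebra (R ⧸ I) T := (RingHom.kerLift (algebraMap R T)).toAlgebra
  have : IsScalarTower R (R ⧸ I) T := IsScalarTower.of_algebraMap_eq fun _ => rfl
  have : FaithfulSMul (R ⧸ I) T := (faithfulSMul_iff_algebraMap_injective _ _).mpr
    (RingHom.kerLift_injective (algebraMap R T))
  have : IsFractionRing (R ⧸ I) T := IsFractionRing.of_field _ _ fun t => by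
    obtain ⟨a, b, hb, e⟩ := h t
    exact ⟨algebraMap R _ a, algebraMap R _ b, by
      rw [← IsScalarTower.algebraMap_apply, ← IsScalarTower.algebraMap_apply, eq_div_iff hb, e]⟩
  have : Algebra.FiniteType k (R ⧸ I) :=
    Algebra.FiniteType.of_surjective (Ideal.Quotient.mkₐ k I) Ideal.Quotient.mk_surjective
  have h1 : Module.Finite (R ⧸ I) (integralClosure (R ⧸ I) T) := finite_integralClosure k T
  have h2 : Module.Finite R (R ⧸ I) := inferInstance
  have h3 : Module.Finite R (integralClosure (R ⧸ I) T) := Module.Finite.trans (R ⧸ I) _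
  have h4 : (integralClosure (R ⧸ I) T).restrictScalars R = integralClosure R T := by
    ext x
    exact ⟨fun hx => isIntegral_trans (R := R) (A := R ⧸ I) x hx, fun hx => IsIntegral.tower_top hx⟩
  rw [← h4]
  exact h3

end IntegralClosureInField

section Normalization

variable {X : Scheme.{u}}

theorem fromSpecResidueField_app {U : X.Opens} {v : X} (hv : v ∈ U) :
    (X.fromSpecResidueField v).appLE U ⊤ (fun x _ => by
      change X.fromSpecResidueField v x ∈ U
      rwa [Scheme.fromSpecResidueField_apply]) ≫ (Scheme.ΓSpecIso (X.residueField v)).hom =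
      X.evaluation U v hv := by
  rw [Scheme.Hom.appLE, ← Iso.eq_comp_inv]
  have : (X.fromSpecResidueField v).app U = (X.fromSpecStalk v).app U ≫ (Spec.map (X.residue v)).app _ :=
    Scheme.Hom.comp_app _ _ _
  rw [this, Scheme.fromSpecStalk_app hv]
  simp only [Scheme.evaluation, Category.assoc, Scheme.ΓSpecIso_inv_naturality]
  refine (Category.assoc _ _ _).trans (congrArg (fun t => X.presheaf.germ U v hv ≫ t) ?_)
  refine (Category.assoc _ _ _).trans (congrArg (fun t => (Scheme.ΓSpecIso (X.presheaf.stalk v)).inv ≫ t) ?_)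
  refine (Category.assoc _ _ _).trans ?_
  rw [Scheme.Hom.app_eq_appLE]
  refine (congrArg (fun t => _ ≫ t) (Scheme.Hom.appLE_map _ _ _)).trans ?_
  refine (Scheme.Hom.map_appLE _ _ _).trans ?_
  rw [Scheme.Hom.appTop, Scheme.Hom.app_eq_appLE]
  rfl

theorem isIso_map_of_eq_top {Y : Scheme.{u}} {W : Y.Opens} (h : ⊤ ≤ W) :
    IsIso (Y.presheaf.map (homOfLE h).op) := by
  obtain rfl : W = ⊤ := top_le_iff.mp h
  rw [show (homOfLE h) = 𝟙 _ from rfl, op_id, CategoryTheory.Functor.map_id]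
  infer_instance

/-- Over an affine open `U`, the normalization of the subvariety with generic point `v` is the spectrum of
the integral closure of the functions on `U` in `κ(v)`. -/
theorem exists_normSubvar_equiv {U : X.Opens} (hU : IsAffineOpen U) {v : X} (hv : v ∈ U) :
    let _ := (X.evaluation U v hv).hom.toAlgebra
    ∃ e : Γ(normSubvar v, normSubvarπ v ⁻¹ᵁ U) ≃+* integralClosure Γ(X, U) (X.residueField v),
      ∀ r, e ((normSubvarπ v).app U r) = algebraMap _ _ r := by
  intro _
  set f := X.fromSpecResidueField v with hf
  have htop : ⊤ ≤ f ⁻¹ᵁ U := fun x _ => by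
    change X.fromSpecResidueField v x ∈ U
    rwa [Scheme.fromSpecResidueField_apply]
  have := isIso_map_of_eq_top htop
  let φ : Γ(Spec (X.residueField v), f ⁻¹ᵁ U) ≅ X.residueField v :=
    asIso ((Spec (X.residueField v)).presheaf.map (homOfLE htop).op) ≪≫ Scheme.ΓSpecIso _
  have hφ : f.app U ≫ φ.hom = X.evaluation U v hv := by
    rw [← fromSpecResidueField_app hv]
    exact (Category.assoc _ _ _).symm
  let := (f.app U).hom.toAlgebra
  let φ' : Γ(Spec (X.residueField v), f ⁻¹ᵁ U) ≃ₐ[Γ(X, U)] X.residueField v :=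
    AlgEquiv.ofRingEquiv (f := φ.commRingCatIsoToRingEquiv) fun r => ConcreteCategory.congr_hom hφ r
  let ψ := (f.normalizationObjIso hU).commRingCatIsoToRingEquiv
  refine ⟨ψ.trans φ'.mapIntegralClosure.toRingEquiv, fun r => ?_⟩
  have h1 : ψ ((normSubvarπ v).app U r) = algebraMap _ _ r := by
    have h2 := ConcreteCategory.congr_hom (f.fromNormalization_app hU) r
    change ψ (f.fromNormalization.app U r) = _
    rw [h2]
    exact ψ.apply_symm_apply _
  change φ'.mapIntegralClosure (ψ ((normSubvarπ v).app U r)) = _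
  rw [h1]
  exact φ'.mapIntegralClosure.commutes r

theorem isIntegrallyClosed_normSubvar {U : X.Opens} (hU : IsAffineOpen U) {v : X} (hv : v ∈ U) :
    IsIntegrallyClosed Γ(normSubvar v, normSubvarπ v ⁻¹ᵁ U) := by
  let := (X.evaluation U v hv).hom.toAlgebra
  obtain ⟨e, -⟩ := exists_normSubvar_equiv hU hv
  have := isIntegrallyClosed_integralClosure (R := Γ(X, U)) (T := X.residueField v)
    (exists_evaluation_frac hU hv)
  exact IsIntegrallyClosed.of_equiv e.symm

/-- Each function on the normalization of a subvariety is a quotient of functions on the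
subvariety. -/
theorem exists_normSubvar_frac {U : X.Opens} (hU : IsAffineOpen U) {v : X} (hv : v ∈ U)
    (b : Γ(normSubvar v, normSubvarπ v ⁻¹ᵁ U)) : ∃ r s : Γ(X, U), X.evaluation U v hv r ≠ 0 ∧
      (normSubvarπ v).app U r * b = (normSubvarπ v).app U s := by
  let := (X.evaluation U v hv).hom.toAlgebra
  obtain ⟨e, he⟩ := exists_normSubvar_equiv hU hv
  obtain ⟨s, r, hr, h⟩ := exists_evaluation_frac hU hv ((e b : _) : X.residueField v)
  refine ⟨r, s, hr, e.injective (Subtype.ext ?_)⟩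
  rw [map_mul, he, he, mul_comm]
  exact h

variable {k : Type u} [Field k] (str : X ⟶ Spec (.of k)) [LocallyOfFiniteType str]

include str in
theorem isFinite_normSubvarπ [AlgebraicGeometry.IsNoetherian X] (v : X) :
    IsFinite (normSubvarπ v) := by
  have : IsIntegralHom (normSubvarπ v) := inferInstanceAs (IsIntegralHom (X.fromSpecResidueField v).fromNormalization)
  refine { finite_app := fun U hU => ?_ }
  by_cases hv : v ∈ U
  · let : Algebra k Γ(X, U) := ((Scheme.ΓSpecIso (.of k)).inv ≫ str.appLE ⊤ U le_top).hom.toAlgebra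
    have : Algebra.FiniteType k Γ(X, U) := by
      have h1 := str.finiteType_appLE (isAffineOpen_top _) hU le_top
      have h2 : (Scheme.ΓSpecIso (.of k)).inv.hom.FiniteType :=
        RingHom.FiniteType.of_surjective _ (Scheme.ΓSpecIso (.of k)).symm.commRingCatIsoToRingEquiv.surjective
      exact h1.comp h2
    let := (X.evaluation U v hv).hom.toAlgebra
    obtain ⟨e, he⟩ := exists_normSubvar_equiv hU hv
    have h1 := finite_integralClosure_of_frac (R := Γ(X, U)) (T := X.residueField v) k
      (exists_evaluation_frac hU hv)
    let := ((normSubvarπ v).app U).hom.toAlgebra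
    let e' : integralClosure Γ(X, U) (X.residueField v) ≃ₐ[Γ(X, U)] Γ(normSubvar v, normSubvarπ v ⁻¹ᵁ U) :=
      AlgEquiv.ofRingEquiv (f := e.symm) fun r => by
        rw [← he, RingEquiv.symm_apply_apply]
        rfl
    exact Module.Finite.equiv e'.toLinearEquiv
  · have hW : normSubvarπ v ⁻¹ᵁ U = ⊥ := by
      by_contra hne
      have h1 : genericPoint (normSubvar v) ∈ normSubvarπ v ⁻¹ᵁ U :=
        ((genericPoint_spec (normSubvar v)).mem_open_set_iff (normSubvarπ v ⁻¹ᵁ U).isOpen).mpr (by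
          rw [Set.univ_inter]
          by_contra h
          exact hne (Opens.ext (Set.not_nonempty_iff_eq_empty.mp h)))
      apply hv
      rw [normSubvarπ_genericPoint v]
      exact h1
    have : Subsingleton Γ(normSubvar v, normSubvarπ v ⁻¹ᵁ U) := by
      rw [hW]
      infer_instance
    exact RingHom.Finite.of_surjective _ fun b => ⟨0, Subsingleton.elim _ _⟩

include str in
theorem isNoetherian_normSubvar [AlgebraicGeometry.IsNoetherian X] (v : X) :
    AlgebraicGeometry.IsNoetherian (normSubvar v) := by
  have := isFinite_normSubvarπ str v
  exact { toIsLocallyNoetherian := LocallyOfFiniteType.isLocallyNoetherian (normSubvarπ v)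
          toCompactSpace := QuasiCompact.compactSpace_of_compactSpace (normSubvarπ v) }

end Normalization

/-! ### The normalization near a point -/

/-- The normalization of a variety near a point `z` of it, in terms of rings: `φ : A → κ` restricts the functions
on the ambient scheme which are regular at `z` to the variety, `κ` being its function field,
`θ : κ → K` is the identification with the function field of the normalization,
and the `O i` are the local rings of the normalization at the prime divisors whose images contain
`z`. The ring `B` consists of the functions which are regular on the normalization near the
preimage of `z`. -/
structure LocalNormalization {A κ K ι : Type*} [CommRing A] [Field κ] [Field K] (φ : A →+* κ)
    (θ : κ →+* K)
    (O : ι → Type*) [∀ i, CommRing (O i)] [∀ i, IsLocalRing (O i)] [∀ i, Algebra (O i) K] where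
  /-- The semilocal ring of the normalization. -/
  B : Type u
  [commRing : CommRing B]
  [isDomain : IsDomain B]
  [isNoetherianRing : IsNoetherianRing B]
  [algebra : Algebra A B]
  [finite : Module.Finite A B]
  [algebraField : Algebra B K]
  [isFractionRing : IsFractionRing B K]
  /-- The orders of the zeros along the prime divisors. -/
  D : KrullValuations B K ι
  /-- The passage to the local rings of the prime divisors. -/
  toLocal : ∀ i, B →+* O i
  /-- `B` is a subring of each of the local rings. -/
  algebraMap_toLocal : ∀ i b, algebraMap (O i) K (toLocal i b) = algebraMap B K b
  /-- `q i` is the ideal of the prime divisor `i`. -/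
  mem_q : ∀ i b, b ∈ D.q i ↔ toLocal i b ∈ IsLocalRing.maximalIdeal (O i)
  /-- `O i` is the localization of `B` at `q i`. -/
  exists_frac : ∀ i (x : O i), ∃ a b : B, b ∉ D.q i ∧ x * toLocal i b = toLocal i a
  algebraMap_algebraMap : ∀ a, algebraMap B K (algebraMap A B a) = θ (φ a)
  /-- `B` is contained in the field of fractions of the image of `A`. -/
  birational : ∀ b : B, ∃ r s : A, φ r ≠ 0 ∧ algebraMap A B r * b = algebraMap A B s

attribute [instance] LocalNormalization.commRing LocalNormalization.isDomain
  LocalNormalization.isNoetherianRing LocalNormalization.algebra LocalNormalization.finite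
  LocalNormalization.algebraField LocalNormalization.isFractionRing

/-- The normalization near a point is obtained from that of an affine neighbourhood by localization. -/
theorem exists_localNormalization_of_isLocalization {R A κ K ι : Type*} {B₀ : Type u} [CommRing R]
    [IsNoetherianRing R] [CommRing A] [Algebra R A] (p : Ideal R) [p.IsPrime]
    [IsLocalization.AtPrime A p]
    [CommRing B₀] [IsDomain B₀] [IsIntegrallyClosed B₀] [Algebra R B₀] [Module.Finite R B₀]
    [Field K] [Algebra B₀ K] [IsFractionRing B₀ K] [Field κ] (φ : A →+* κ) (θ : κ →+* K)
    (hφ : ∀ r, algebraMap B₀ K (algebraMap R B₀ r) = θ (φ (algebraMap R A r)))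
    (hbir : ∀ b : B₀, ∃ r s : R, φ (algebraMap R A r) ≠ 0 ∧ algebraMap R B₀ r * b = algebraMap R B₀ s)
    (O : ι → Type*) [∀ i, CommRing (O i)] [∀ i, IsDomain (O i)] [∀ i, IsLocalRing (O i)]
    [∀ i, IsNoetherianRing (O i)] [∀ i, Ring.KrullDimLE 1 (O i)]
    [∀ i, Algebra B₀ (O i)] [∀ i, Algebra (O i) K] [∀ i, IsScalarTower B₀ (O i) K]
    [∀ i, IsFractionRing (O i) K]
    (q : ι → Ideal B₀) [∀ i, (q i).IsPrime] [∀ i, IsLocalization.AtPrime (O i) (q i)]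
    (hq : ∀ i, (q i).height = 1) (hqp : ∀ i r, algebraMap R B₀ r ∈ q i → r ∈ p) (hinj : Function.Injective q)
    (hsurj : ∀ Q : Ideal B₀, Q.IsPrime → Q.height = 1 → (∀ r, algebraMap R B₀ r ∈ Q → r ∈ p) → ∃ i, q i = Q)
    (v : ι → K → ℤ) (hv : ∀ i f, f ≠ 0 → Ring.ordFrac (O i) f = WithZero.exp (v i f))
    (hfin : ∀ f, f ≠ 0 → {i | v i f ≠ 0}.Finite) :
    ∃ L : LocalNormalization.{u} φ θ O, L.D.v = v := by
  have hBK : Function.Injective (algebraMap B₀ K) := IsFractionRing.injective B₀ K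
  set M := Algebra.algebraMapSubmonoid B₀ p.primeCompl with hM
  have hM0 : M ≤ nonZeroDivisors B₀ := by
    rintro _ ⟨r, hr, rfl⟩
    refine mem_nonZeroDivisors_of_ne_zero fun h => ?_
    have h1 := hφ r
    rw [h, map_zero, eq_comm, map_eq_zero] at h1
    exact ((IsLocalization.map_units A (⟨r, hr⟩ : p.primeCompl)).map φ).ne_zero h1
  let B := Localization M
  have hdom : IsDomain B := IsLocalization.isDomain_localization hM0
  have hB₀ : IsNoetherianRing B₀ := IsNoetherianRing.of_finite R B₀
  have hnoeth : IsNoetherianRing B := IsLocalization.isNoetherianRing M B hB₀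
  have hic : IsIntegrallyClosed B := isIntegrallyClosed_of_isLocalization (R := B₀) B M hM0
  have hle : p.primeCompl ≤ M.comap (algebraMap R B₀) := fun r hr => ⟨r, hr, rfl⟩
  let : Algebra A B := (IsLocalization.map (S := A) B (algebraMap R B₀) hle).toAlgebra
  have hAB : ∀ r, algebraMap A B (algebraMap R A r) = algebraMap B₀ B (algebraMap R B₀ r) :=
    fun r => IsLocalization.map_eq hle r
  have : IsScalarTower R A B := IsScalarTower.of_algebraMap_eq fun r => by
    rw [hAB, ← IsScalarTower.algebraMap_apply]
  have : Module.Finite A B := Module.Finite.of_isLocalization R B₀ p.primeCompl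
  let : Algebra B K := (IsLocalization.lift (M := M) (S := B) (g := algebraMap B₀ K) fun y =>
    IsUnit.mk0 _ ((map_ne_zero_iff _ hBK).mpr (nonZeroDivisors.ne_zero (hM0 y.2)))).toAlgebra
  have : IsScalarTower B₀ B K := IsScalarTower.of_algebraMap_eq fun b => (IsLocalization.lift_eq _ b).symm
  have : IsFractionRing B K := IsFractionRing.isFractionRing_of_isDomain_of_isLocalization M B K
  have hunit : ∀ i (y : M), IsUnit (algebraMap B₀ (O i) y) := by
    rintro i ⟨_, r, hr, rfl⟩
    rw [IsLocalization.AtPrime.isUnit_to_map_iff (O i) (q i)]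
    exact fun h => hr (hqp i r h)
  let : ∀ i, Algebra B (O i) := fun i => (IsLocalization.lift (M := M) (S := B) (hunit i)).toAlgebra
  have htow (i) : IsScalarTower B₀ B (O i) :=
    IsScalarTower.of_algebraMap_eq fun b => (IsLocalization.lift_eq (hunit i) b).symm
  have htow' (i) : IsScalarTower B (O i) K := by
    refine IsScalarTower.of_algebraMap_eq' (IsLocalization.ringHom_ext M ?_)
    ext b
    simp only [RingHom.comp_apply]
    rw [← IsScalarTower.algebraMap_apply B₀ B K, ← IsScalarTower.algebraMap_apply B₀ B (O i),
      ← IsScalarTower.algebraMap_apply B₀ (O i) K]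
  have hdvr (i) : IsDiscreteValuationRing (O i) := isDiscreteValuationRing_of_height_eq_one (q i) (hq i) (O i)
  let q' : ι → Ideal B := fun i => (IsLocalRing.maximalIdeal (O i)).comap (algebraMap B (O i))
  have hq' : ∀ i, (q' i).under B₀ = q i := fun i => by
    ext b
    change algebraMap B (O i) (algebraMap B₀ B b) ∈ IsLocalRing.maximalIdeal (O i) ↔ b ∈ q i
    rw [← IsScalarTower.algebraMap_apply B₀ B (O i), IsLocalization.AtPrime.to_map_mem_maximal_iff (O i) (q i)]
  have hprime (i) : (q' i).IsPrime := Ideal.comap_isPrime _ _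
  have hBO : ∀ i, Function.Injective (algebraMap B (O i)) := fun i => by
    have h1 := IsFractionRing.injective B K
    rw [IsScalarTower.algebraMap_eq B (O i) K] at h1
    exact Function.Injective.of_comp h1
  have hfrac : ∀ i (x : O i), ∃ a b : B, b ∉ q' i ∧ x * algebraMap B (O i) b = algebraMap B (O i) a := fun i x => by
    obtain ⟨a, b, rfl⟩ := IsLocalization.exists_mk'_eq (q i).primeCompl x
    refine ⟨algebraMap B₀ B a, algebraMap B₀ B b, fun h => b.2 ?_, ?_⟩
    · have h1 : (b : B₀) ∈ (q' i).under B₀ := h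
      rwa [hq' i] at h1
    · rw [← IsScalarTower.algebraMap_apply, ← IsScalarTower.algebraMap_apply, IsLocalization.mk'_spec]
  have hloc (i) : IsLocalization.AtPrime (O i) (q' i) :=
    { map_units := fun y => by
        have h1 := y.2
        by_contra h
        exact h1 ((IsLocalRing.mem_maximalIdeal _).mpr h)
      surj := fun x => by
        obtain ⟨a, b, hb, e⟩ := hfrac i x
        exact ⟨(a, ⟨b, hb⟩), e⟩
      exists_of_eq := fun h => ⟨1, by rw [hBO i h]⟩ }
  refine ⟨{ B := B
            D := KrullValuations.ofLocalizations O q' (fun i => ?_) (fun i j h => hinj ?_) (fun Q hQ hQ1 => ?_) v hv hfin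
            toLocal := fun i => algebraMap B (O i)
            algebraMap_toLocal := fun i b => (IsScalarTower.algebraMap_apply B (O i) K b).symm
            mem_q := fun i b => Iff.rfl
            exists_frac := hfrac
            algebraMap_algebraMap := fun a => ?_
            birational := fun b => ?_ }, rfl⟩
  · rw [← hq i, ← hq' i, IsLocalization.height_under M]
  · rw [← hq' i, ← hq' j, h]
  · obtain ⟨i, hi⟩ := hsurj (Q.under B₀) inferInstance (by rw [IsLocalization.height_under M, hQ1]) fun r hr => by
      by_contra hrp
      have h1 : IsUnit (algebraMap B₀ B (algebraMap R B₀ r)) := IsLocalization.map_units B (⟨_, r, hrp, rfl⟩ : M)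
      exact hQ.ne_top (Ideal.eq_top_of_isUnit_mem _ hr h1)
    refine ⟨i, ?_⟩
    rw [← IsLocalization.map_under M B Q, ← IsLocalization.map_under M B (q' i)]
    exact congrArg _ ((hq' i).trans hi)
  · obtain ⟨r, s, rfl⟩ := IsLocalization.exists_mk'_eq p.primeCompl a
    have hs : θ (φ (algebraMap R A s)) ≠ 0 := by
      rw [Ne, map_eq_zero]
      exact ((IsLocalization.map_units A s).map φ).ne_zero
    refine mul_right_cancel₀ hs ?_
    rw [← map_mul θ, ← map_mul φ, IsLocalization.mk'_spec, ← hφ, ← hφ, IsScalarTower.algebraMap_apply B₀ B K, ← hAB,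
      IsScalarTower.algebraMap_apply B₀ B K, ← hAB, ← map_mul, ← map_mul, IsLocalization.mk'_spec]
  · obtain ⟨b, y, rfl⟩ := IsLocalization.exists_mk'_eq M b
    obtain ⟨m, hm, hy⟩ := y.2
    obtain ⟨r, s, hr, e⟩ := hbir b
    refine ⟨algebraMap R A (r * m), algebraMap R A s, ?_, ?_⟩
    · rw [map_mul, map_mul]
      exact mul_ne_zero hr ((IsLocalization.map_units A (⟨m, hm⟩ : p.primeCompl)).map φ).ne_zero
    · rw [hAB, hAB, ← e, map_mul, map_mul, map_mul, mul_assoc, hy, IsLocalization.mk'_spec']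

section LocalNormalization

variable {X : Scheme.{u}}

theorem mem_primeIdealOf_iff {U : X.Opens} (hU : IsAffineOpen U) {x : X} (hx : x ∈ U)
    (r : Γ(X, U)) :
    r ∈ (hU.primeIdealOf ⟨x, hx⟩).asIdeal ↔ ¬ IsUnit (X.presheaf.germ U x hx r) := by
  let := TopCat.Presheaf.algebra_section_stalk X.presheaf (⟨x, hx⟩ : U)
  have := hU.isLocalization_stalk ⟨x, hx⟩
  exact (not_congr (IsLocalization.AtPrime.isUnit_to_map_iff (X.presheaf.stalk x)
    (hU.primeIdealOf ⟨x, hx⟩).asIdeal r)).trans (not_not (a := r ∈ (hU.primeIdealOf ⟨x, hx⟩).asIdeal)) |>.symm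

theorem primeIdealOf_fromSpec {U : X.Opens} (hU : IsAffineOpen U) (Q : PrimeSpectrum Γ(X, U))
    (h : hU.fromSpec Q ∈ U) : hU.primeIdealOf ⟨hU.fromSpec Q, h⟩ = Q :=
  hU.fromSpec.isOpenEmbedding.injective (hU.fromSpec_primeIdealOf ⟨_, h⟩)

theorem specializes_of_primeIdealOf_le {U : X.Opens} (hU : IsAffineOpen U) {x y : U}
    (h : (hU.primeIdealOf x).asIdeal ≤ (hU.primeIdealOf y).asIdeal) : (x : X) ⤳ y := by
  rw [← hU.fromSpec_primeIdealOf x, ← hU.fromSpec_primeIdealOf y]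
  exact ((PrimeSpectrum.le_iff_specializes _ _).mp h).map hU.fromSpec.continuous

theorem height_primeIdealOf {U : X.Opens} (hU : IsAffineOpen U) (x : U) :
    (hU.primeIdealOf x).asIdeal.height = coheight (x : X) := by
  let := TopCat.Presheaf.algebra_section_stalk X.presheaf x
  have := hU.isLocalization_stalk x
  have h1 := IsLocalization.AtPrime.ringKrullDim_eq_height (hU.primeIdealOf x).asIdeal (X.presheaf.stalk (x : X))
  rw [ringKrullDim_stalk_eq_coheight] at h1
  exact_mod_cast h1.symm

variable {k : Type u} [Field k] (str : X ⟶ Spec (.of k)) [LocallyOfFiniteType str]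
  [AlgebraicGeometry.IsNoetherian X]

/-- The prime divisors of the normalization of a subvariety whose images contain `z`. -/
abbrev PrimeDivisorsAt (v z : X) : Type u :=
  {w : normSubvar v // coheight w = 1 ∧ normSubvarπ v w ⤳ z}

include str in
/-- The normalization of a subvariety near a point `z` of it. The ring `B` is the localization at `z` of
the integral closure of the functions on an affine neighbourhood of `z`, and its primes of height one are
the prime divisors of the normalization whose images contain `z`. -/
theorem exists_localNormalization {v z : X} (h : v ⤳ z) :
    ∃ L : LocalNormalization.{u} (specRes h) (pullFun (normSubvarπ v) (normSubvarπ_genericPoint v))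
      (fun i : PrimeDivisorsAt v z => (normSubvar v).presheaf.stalk i.1),
      L.D.v = fun i f => ordAt (normSubvar v) f i.1 := by
  obtain ⟨U, hU, hz⟩ := exists_affine_mem z
  have hv : v ∈ U := h.mem_open U.isOpen hz
  set Y := normSubvar v with hY
  set π : Y ⟶ X := normSubvarπ v with hπ
  have := isNoetherian_normSubvar str v
  have hfinπ : IsFinite π := isFinite_normSubvarπ str v
  set V : Y.Opens := π ⁻¹ᵁ U with hV'
  have hV : IsAffineOpen V := hU.preimage π
  have hgen : genericPoint Y ∈ V := by
    change π _ ∈ U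
    rw [hπ, ← normSubvarπ_genericPoint v]
    exact hv
  have hne : Nonempty V := ⟨⟨_, hgen⟩⟩
  have := functionField_isFractionRing_of_isAffineOpen Y V hV
  have := isIntegrallyClosed_normSubvar hU hv
  let : Algebra Γ(X, U) Γ(Y, V) := (π.app U).hom.toAlgebra
  have : Module.Finite Γ(X, U) Γ(Y, V) := hfinπ.finite_app U hU
  have : IsNoetherianRing Γ(X, U) := IsLocallyNoetherian.component_noetherian ⟨U, hU⟩
  let := TopCat.Presheaf.algebra_section_stalk X.presheaf (⟨z, hz⟩ : U)
  have := hU.isLocalization_stalk ⟨z, hz⟩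
  have hmem : ∀ i : PrimeDivisorsAt v z, i.1 ∈ V := fun i => i.2.2.mem_open U.isOpen hz
  let : ∀ i : PrimeDivisorsAt v z, Algebra Γ(Y, V) (Y.presheaf.stalk i.1) := fun i =>
    TopCat.Presheaf.algebra_section_stalk Y.presheaf (⟨i.1, hmem i⟩ : V)
  have (i : PrimeDivisorsAt v z) : IsScalarTower Γ(Y, V) (Y.presheaf.stalk i.1) Y.functionField :=
    functionField_isScalarTower Y V (⟨i.1, hmem i⟩ : V)
  have (i : PrimeDivisorsAt v z) : IsLocalization.AtPrime (Y.presheaf.stalk i.1)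
      (hV.primeIdealOf ⟨i.1, hmem i⟩).asIdeal := hV.isLocalization_stalk ⟨i.1, hmem i⟩
  have (i : PrimeDivisorsAt v z) : Ring.KrullDimLE 1 (Y.presheaf.stalk i.1) :=
    krullDimLE_of_coheight_le i.2.1.le
  refine exists_localNormalization_of_isLocalization (R := Γ(X, U)) (hU.primeIdealOf ⟨z, hz⟩).asIdeal
    (B₀ := Γ(Y, V)) _ _ (fun r => ?_) (fun b => ?_) (fun i : PrimeDivisorsAt v z => Y.presheaf.stalk i.1)
    (fun i => (hV.primeIdealOf ⟨i.1, hmem i⟩).asIdeal) (fun i => ?_) (fun i r hr => ?_) (fun i j e => ?_)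
    (fun Q hQ hQ1 hQp => ?_) _ (fun i f hf => ?_) (fun f hf => ?_)
  · change Y.presheaf.germ V (genericPoint Y) hgen (π.app U r) =
      pullFun π _ (specRes h (X.presheaf.germ U z hz r))
    have hg : π (genericPoint Y) ⤳ z := by
      rw [hπ, ← normSubvarπ_genericPoint v]
      exact h
    rw [pullFun_specRes π _ h (genericPoint Y) hg]
    have h1 : X.presheaf.stalkSpecializes hg (X.presheaf.germ U z hz r) =
        X.presheaf.germ U _ hgen r :=
      ConcreteCategory.congr_hom (X.presheaf.germ_stalkSpecializes hz hg) r
    rw [h1]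
    refine Eq.symm ((congrArg (stalkFunctionFieldAlgebra Y (genericPoint Y)).algebraMap
      (Scheme.Hom.germ_stalkMap_apply π U (genericPoint Y) hgen r)).trans ?_)
    exact Scheme.algebraMap_germ_eq_germToFunctionField Y hgen _
  · obtain ⟨r, s, hr, e⟩ := exists_normSubvar_frac hU hv b
    refine ⟨r, s, ?_, e⟩
    change specRes h (X.presheaf.germ U z hz r) ≠ 0
    rwa [specRes_germ]
  · rw [height_primeIdealOf hV, i.2.1]
  · by_contra hr'
    rw [mem_primeIdealOf_iff hU hz, not_not] at hr'
    refine (mem_primeIdealOf_iff hV (hmem i) _).mp hr ?_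
    have h1 : X.presheaf.germ U _ (hmem i) r = X.presheaf.stalkSpecializes i.2.2 (X.presheaf.germ U z hz r) :=
      (ConcreteCategory.congr_hom (X.presheaf.germ_stalkSpecializes hz i.2.2) r).symm
    change IsUnit (Y.presheaf.germ V i.1 (hmem i) (π.app U r))
    rw [← Scheme.Hom.germ_stalkMap_apply π U i.1 (hmem i) r, h1]
    exact (hr'.map (X.presheaf.stalkSpecializes i.2.2).hom).map (π.stalkMap i.1).hom
  · have h1 := congrArg hV.fromSpec (PrimeSpectrum.ext e)
    rw [hV.fromSpec_primeIdealOf, hV.fromSpec_primeIdealOf] at h1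
    exact Subtype.ext h1
  · set y := hV.fromSpec ⟨Q, hQ⟩ with hy
    have hyV : y ∈ V := by
      have h1 : y ∈ Set.range hV.fromSpec := ⟨_, rfl⟩
      rwa [hV.range_fromSpec] at h1
    have hyQ : hV.primeIdealOf ⟨y, hyV⟩ = ⟨Q, hQ⟩ := primeIdealOf_fromSpec hV ⟨Q, hQ⟩ hyV
    have hspec : π y ⤳ z := by
      refine specializes_of_primeIdealOf_le hU (x := ⟨π y, hyV⟩) (y := ⟨z, hz⟩) fun r hr => hQp r ?_
      replace hr := (mem_primeIdealOf_iff hU hyV r).mp hr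
      have h1 : π.app U r ∈ (hV.primeIdealOf ⟨y, hyV⟩).asIdeal := by
        rw [mem_primeIdealOf_iff, ← Scheme.Hom.germ_stalkMap_apply π U y hyV r]
        exact fun h2 => hr (isUnit_of_map_unit (π.stalkMap y).hom _ h2)
      rwa [hyQ] at h1
    refine ⟨⟨y, ?_, hspec⟩, congrArg PrimeSpectrum.asIdeal hyQ⟩
    rw [← hQ1, ← height_primeIdealOf hV ⟨y, hyV⟩, hyQ]
  · rw [ordAt_eq_ord _ _ hf]
    exact (Scheme.ord_eq_iff i.2.1 hf).mp rfl
  · exact (ordAt_support_finite Y f hf).preimage Subtype.val_injective.injOn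

end LocalNormalization

/-! ### Lengths over a local ring of orders on subvarieties -/

section LengthOverBase

variable {A B : Type*} [CommRing A] [CommRing B] [Algebra A B]

omit [Algebra A B] in
theorem isMaximal_of_isMaximal_comap_of_surjective {f : A →+* B} (hf : Function.Surjective f)
    {p : Ideal B}
    [hp : p.IsPrime] (h : (p.comap f).IsMaximal) : p.IsMaximal := by
  have h1 := Ideal.map_eq_top_or_isMaximal_of_surjective f hf h
  rw [Ideal.map_comap_of_surjective f hf] at h1
  exact h1.resolve_left hp.ne_top

theorem length_quotient_eq_of_surjective {R D : Type*} [CommRing R] [Algebra A R] [CommRing D]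
    [Algebra A D]
    [Algebra R D] [IsScalarTower A R D] (h : Function.Surjective (algebraMap A R)) (I : Ideal D) :
    Module.length R (D ⧸ I) = Module.length A (D ⧸ I) :=
  (Module.length_eq_of_surjective h).symm

theorem length_quotient_span_of_surjective {D : Type*} [CommRing D] [Algebra A D] (φ : B →ₐ[A] D)
    (hφ : Function.Surjective φ) (b : B) :
    Module.length A (D ⧸ Ideal.span {φ b}) = Module.length A (B ⧸ (RingHom.ker φ ⊔ Ideal.span {b})) := by
  let g : B →ₗ[A] D ⧸ Ideal.span {φ b} := ((Ideal.Quotient.mkₐ A (Ideal.span {φ b})).comp φ).toLinearMap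
  have hg : Function.Surjective g := (Ideal.Quotient.mkₐ_surjective A _).comp hφ
  have hker : LinearMap.ker g = (RingHom.ker φ ⊔ Ideal.span {b}).restrictScalars A := by
    ext x
    have h1 : x ∈ LinearMap.ker g ↔ φ x ∈ Ideal.span {φ b} := Ideal.Quotient.eq_zero_iff_mem
    rw [h1, Submodule.restrictScalars_mem, Ideal.mem_span_singleton', Submodule.mem_sup]
    constructor
    · rintro ⟨r, hr⟩
      obtain ⟨r, rfl⟩ := hφ r
      refine ⟨x - r * b, ?_, r * b, Ideal.mul_mem_left _ _ (Ideal.mem_span_singleton_self b), sub_add_cancel _ _⟩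
      rw [RingHom.mem_ker, map_sub, map_mul, hr, sub_self]
    · rintro ⟨y, hy, w, hw, rfl⟩
      obtain ⟨r, rfl⟩ := Ideal.mem_span_singleton'.mp hw
      refine ⟨φ r, ?_⟩
      rw [map_add, (RingHom.mem_ker).mp hy, zero_add, map_mul]
  have e := (LinearMap.quotKerEquivOfSurjective g hg).length_eq
  rw [← e, hker]
  exact (Submodule.Quotient.restrictScalarsEquiv A (RingHom.ker φ ⊔ Ideal.span {b})).length_eq

/-- A finite module over `A` has finite length if the primes in its support are maximal. -/
theorem length_quotient_ne_top [IsNoetherianRing A] [Module.Finite A B] (I : Ideal B)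
    (h : ∀ p : Ideal A, p.IsPrime → I.comap (algebraMap A B) ≤ p → p.IsMaximal) :
    Module.length A (B ⧸ I) ≠ ⊤ := by
  set J := I.comap (algebraMap A B) with hJ
  have h1 : Ring.KrullDimLE 0 (A ⧸ J) := Ring.krullDimLE_zero_iff.mpr fun p hp => by
    have h2 := h (p.comap (Ideal.Quotient.mk J)) inferInstance fun a ha => by
      rw [Ideal.mem_comap, Ideal.Quotient.eq_zero_iff_mem.mpr ha]
      exact p.zero_mem
    exact isMaximal_of_isMaximal_comap_of_surjective Ideal.Quotient.mk_surjective h2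
  have h3 : IsArtinianRing (A ⧸ J) := isArtinianRing_iff_krullDimLE_zero.mpr h1
  have h4 : IsScalarTower A (A ⧸ J) (B ⧸ I) := IsScalarTower.of_algebraMap_eq fun _ => rfl
  have h5 : Module.Finite (A ⧸ J) (B ⧸ I) := Module.Finite.of_restrictScalars_finite A _ _
  rw [Module.length_eq_of_surjective (R := A ⧸ J) (S := A) Ideal.Quotient.mk_surjective,
    Module.length_ne_top_iff, isFiniteLength_iff_isNoetherian_isArtinian]
  exact ⟨inferInstance, inferInstance⟩

theorem krullDimLE_one_quotient {P : Ideal A} (hP : P.IsPrime)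
    (hdim : ∀ p : Ideal A, p.IsPrime → P < p → p.IsMaximal) : Ring.KrullDimLE 1 (A ⧸ P) := by
  refine Ring.krullDimLE_one_iff_of_isPrime_bot.mpr fun p hp hp' => ?_
  refine isMaximal_of_isMaximal_comap_of_surjective (f := Ideal.Quotient.mk P) Ideal.Quotient.mk_surjective
    (hdim _ (hp'.comap _) (lt_of_le_of_ne (fun a ha => ?_) fun h => hp ?_))
  · rw [Ideal.mem_comap, Ideal.Quotient.eq_zero_iff_mem.mpr ha]
    exact p.zero_mem
  · rw [← Ideal.map_comap_of_surjective (Ideal.Quotient.mk P) Ideal.Quotient.mk_surjective p, ← h,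
      Ideal.map_quotient_self]

/-- The order of a norm, with lengths over a ring `A` of functions on an ambient scheme: `ker φ` is the
ideal of a curve with function field `E` and `ker ψ` that of a curve with function field `F` finite over
it. -/
theorem length_add_length_of_norm_eq [IsNoetherianRing A] [Module.Finite A B] {E F : Type*}
    [Field E] [Field F]
    [Algebra E F] (φ : A →+* E) (ψ : B →+* F)
    (hφψ : ∀ a, ψ (algebraMap A B a) = algebraMap E F (φ a))
    (hφ : ∀ t, ∃ a b, φ b ≠ 0 ∧ t * φ b = φ a) (hψ : ∀ t, ∃ a b, ψ b ≠ 0 ∧ t * ψ b = ψ a)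
    (hdim : ∀ p : Ideal A, p.IsPrime → RingHom.ker φ < p → p.IsMaximal) {c : B} (hc : ψ c ≠ 0)
    {a b : A} (ha : φ a ≠ 0) (hb : φ b ≠ 0) (h : Algebra.norm E (ψ c) * φ b = φ a) :
    Module.length A (B ⧸ (RingHom.ker ψ ⊔ Ideal.span {c})) +
      Module.length A (A ⧸ (RingHom.ker φ ⊔ Ideal.span {b})) =
        Module.length A (A ⧸ (RingHom.ker φ ⊔ Ideal.span {a})) := by
  let R := A ⧸ RingHom.ker φ
  let D := B ⧸ RingHom.ker ψ
  have hP : (RingHom.ker φ).IsPrime := RingHom.ker_isPrime φ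
  have hQ : (RingHom.ker ψ).IsPrime := RingHom.ker_isPrime ψ
  let : Algebra R E := (RingHom.kerLift φ).toAlgebra
  let : Algebra D F := (RingHom.kerLift ψ).toAlgebra
  have hRE : ∀ x, algebraMap R E (Ideal.Quotient.mk _ x) = φ x := RingHom.kerLift_mk φ
  have hDF : ∀ x, algebraMap D F (Ideal.Quotient.mk _ x) = ψ x := RingHom.kerLift_mk ψ
  have hle : RingHom.ker φ ≤ (RingHom.ker ψ).comap (algebraMap A B) := fun x hx => by
    rw [Ideal.mem_comap, RingHom.mem_ker, hφψ, (RingHom.mem_ker).mp hx, map_zero]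
  let : Algebra R D := (Ideal.quotientMap (RingHom.ker ψ) (algebraMap A B) hle).toAlgebra
  have hRD : ∀ x : A, algebraMap R D (Ideal.Quotient.mk _ x) = Ideal.Quotient.mk _ (algebraMap A B x) :=
    fun x => Ideal.quotientMap_mk
  let : Algebra R F := ((algebraMap E F).comp (algebraMap R E)).toAlgebra
  have : IsScalarTower R E F := IsScalarTower.of_algebraMap_eq fun _ => rfl
  have : IsScalarTower R D F := IsScalarTower.of_algebraMap_eq fun x => by
    obtain ⟨x, rfl⟩ := Ideal.Quotient.mk_surjective x
    rw [hRD, hDF, hφψ, ← hRE]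
    rfl
  have : IsScalarTower A R D := IsScalarTower.of_algebraMap_eq fun x => (hRD x).symm
  have : Module.Finite R D := Module.Finite.of_restrictScalars_finite A R D
  have : FaithfulSMul R E := (faithfulSMul_iff_algebraMap_injective R E).mpr (RingHom.kerLift_injective φ)
  have : FaithfulSMul D F := (faithfulSMul_iff_algebraMap_injective D F).mpr (RingHom.kerLift_injective ψ)
  have : FaithfulSMul R D := (faithfulSMul_iff_algebraMap_injective R D).mpr (by
    have h1 : Function.Injective (algebraMap R F) :=
      (algebraMap E F).injective.comp (RingHom.kerLift_injective φ)
    rw [IsScalarTower.algebraMap_eq R D F] at h1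
    exact Function.Injective.of_comp h1)
  have : IsFractionRing R E := IsFractionRing.of_field R E fun t => by
    obtain ⟨x, y, hy, e⟩ := hφ t
    exact ⟨Ideal.Quotient.mk _ x, Ideal.Quotient.mk _ y, by rw [hRE, hRE, eq_div_iff hy, e]⟩
  have : IsFractionRing D F := IsFractionRing.of_field D F fun t => by
    obtain ⟨x, y, hy, e⟩ := hψ t
    exact ⟨Ideal.Quotient.mk _ x, Ideal.Quotient.mk _ y, by rw [hDF, hDF, eq_div_iff hy, e]⟩
  have : Ring.KrullDimLE 1 R := krullDimLE_one_quotient hP hdim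
  have hne : ∀ {x : A}, φ x ≠ 0 → (Ideal.Quotient.mk (RingHom.ker φ) x) ≠ 0 := fun hx h0 =>
    hx (Ideal.Quotient.eq_zero_iff_mem.mp h0)
  have hne' : (Ideal.Quotient.mk (RingHom.ker ψ) c) ≠ 0 := fun h0 =>
    hc (Ideal.Quotient.eq_zero_iff_mem.mp h0)
  have key := length_add_ord_of_norm_eq (R := R) E (D := D) (F := F) hne' (hne ha) (hne hb) (by
    rw [hRE, hRE, hDF, h])
  have hord : ∀ x : A, Ring.ord R (Ideal.Quotient.mk _ x) =
      Module.length A (A ⧸ (RingHom.ker φ ⊔ Ideal.span {x})) := fun x => by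
    have h1 := length_quotient_span_of_surjective (Ideal.Quotient.mkₐ A (RingHom.ker φ))
      (Ideal.Quotient.mkₐ_surjective A _) x
    have h2 : RingHom.ker (Ideal.Quotient.mkₐ A (RingHom.ker φ)) = RingHom.ker φ := Ideal.mk_ker
    rw [h2] at h1
    exact (length_quotient_eq_of_surjective (R := R) (A := A) Ideal.Quotient.mk_surjective _).trans h1
  have hlen : Module.length R (D ⧸ Ideal.span {(Ideal.Quotient.mk (RingHom.ker ψ) c)}) =
      Module.length A (B ⧸ (RingHom.ker ψ ⊔ Ideal.span {c})) := by
    have h1 := length_quotient_span_of_surjective (Ideal.Quotient.mkₐ A (RingHom.ker ψ))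
      (Ideal.Quotient.mkₐ_surjective A _) c
    have h2 : RingHom.ker (Ideal.Quotient.mkₐ A (RingHom.ker ψ)) = RingHom.ker ψ := Ideal.mk_ker
    rw [h2] at h1
    exact (length_quotient_eq_of_surjective (R := R) (A := A) Ideal.Quotient.mk_surjective _).trans h1
  rw [← hlen, ← hord, ← hord]
  exact key

end LengthOverBase

namespace LocalNormalization

variable {A κ K ι : Type*} [CommRing A] [Field κ] [Field K] {φ : A →+* κ} {θ : κ →+* K}
    {O : ι → Type*} [∀ i, CommRing (O i)] [∀ i, IsLocalRing (O i)] [∀ i, Algebra (O i) K]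
    (L : LocalNormalization.{u} φ θ O)

theorem algebraMap_eq_zero_iff {a : A} : algebraMap A L.B a = 0 ↔ φ a = 0 := by
  rw [← map_eq_zero θ, ← L.algebraMap_algebraMap, map_eq_zero_iff _ (IsFractionRing.injective L.B K)]

/-- A prime divisor does not dominate the variety. -/
theorem ker_lt_comap_q (i : ι) : RingHom.ker φ < (L.D.q i).comap (algebraMap A L.B) := by
  refine lt_of_le_of_ne (fun a ha => ?_) fun h => ?_
  · rw [Ideal.mem_comap, L.algebraMap_eq_zero_iff.mpr ha]
    exact Ideal.zero_mem _
  · obtain ⟨b, hb, hb1⟩ := L.D.exists_uniformizer i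
    obtain ⟨r, s, hr, e⟩ := L.birational b
    have h1 : algebraMap A L.B s ∈ L.D.q i := by
      rw [← e]
      exact Ideal.mul_mem_left _ _ ((L.D.pos_iff i hb).mp (by omega))
    have h2 : s ∈ RingHom.ker φ := by
      rw [h]
      exact h1
    rw [L.algebraMap_eq_zero_iff.mpr h2] at e
    exact (mul_ne_zero (fun h3 => hr (L.algebraMap_eq_zero_iff.mp h3)) hb) e

theorem isMaximal_q {i : ι} (h : ((L.D.q i).comap (algebraMap A L.B)).IsMaximal) :
    (L.D.q i).IsMaximal := by
  have := L.D.prime i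
  exact Ideal.isMaximal_of_isIntegral_of_isMaximal_comap (R := A) _ h

theorem len_eq_zero {i : ι} (h : (L.D.q i).IsMaximal) {c : L.B} (hc : c ∉ L.D.q i) :
    L.D.len A i c = 0 := by
  refine relLength_eq_zero A (le_of_eq (Eq.symm (h.out.2 _ (lt_of_le_of_ne le_sup_left fun e => hc ?_))))
  rw [e]
  exact Ideal.mem_sup_right (Ideal.mem_span_singleton_self c)

theorem len_ne_top [IsNoetherianRing A]
    (hdim : ∀ i, ∀ p : Ideal A, p.IsPrime → (L.D.q i).comap (algebraMap A L.B) < p → p.IsMaximal)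
    (i : ι) (c : L.B) (hc : c ∉ L.D.q i) : L.D.len A i c ≠ ⊤ := by
  have := L.D.prime i
  rw [KrullValuations.len, relLength_top]
  refine length_quotient_ne_top _ fun p hp hle => hdim i p hp (lt_of_lt_of_le ?_ hle)
  exact Ideal.comap_lt_comap_of_integral_mem_sdiff le_sup_left
    ⟨Ideal.mem_sup_right (Ideal.mem_span_singleton_self c), hc⟩ (Algebra.IsIntegral.isIntegral c)

/-- The order of a function at a point of codimension one is the weighted sum of the orders of its
pull-back at the points of the normalization above it. -/
theorem length_eq_sum [IsNoetherianRing A] (hmax : ∀ i, (L.D.q i).IsMaximal)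
    (hdim : ∀ p : Ideal A, p.IsPrime → RingHom.ker φ < p → p.IsMaximal) {a : A} (ha : φ a ≠ 0)
    (ha' : algebraMap A L.B a ≠ 0) :
    Module.length A (A ⧸ (RingHom.ker φ ⊔ Ideal.span {a})) =
      (L.D.div _ ha').sum fun i k => k * Module.length A (L.B ⧸ L.D.q i) := by
  let R := A ⧸ RingHom.ker φ
  have hP : (RingHom.ker φ).IsPrime := RingHom.ker_isPrime φ
  let : Algebra R L.B := (Ideal.Quotient.lift (RingHom.ker φ) (algebraMap A L.B)
    fun x hx => L.algebraMap_eq_zero_iff.mpr hx).toAlgebra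
  have hRB : ∀ x : A, algebraMap R L.B (Ideal.Quotient.mk _ x) = algebraMap A L.B x := fun x => rfl
  have : IsScalarTower A R L.B := IsScalarTower.of_algebraMap_eq fun x => rfl
  have : Module.Finite R L.B := Module.Finite.of_restrictScalars_finite A R L.B
  have : FaithfulSMul R L.B := (faithfulSMul_iff_algebraMap_injective R L.B).mpr (by
    rw [injective_iff_map_eq_zero]
    intro x hx
    obtain ⟨x, rfl⟩ := Ideal.Quotient.mk_surjective x
    exact Ideal.Quotient.eq_zero_iff_mem.mpr (L.algebraMap_eq_zero_iff.mp hx))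
  have : Ring.KrullDimLE 1 R := krullDimLE_one_quotient hP hdim
  have hne : ∀ {x : A}, φ x ≠ 0 → (Ideal.Quotient.mk (RingHom.ker φ) x) ≠ 0 := fun hx h0 =>
    hx (Ideal.Quotient.eq_zero_iff_mem.mp h0)
  have key := ord_eq_length (R := R) (B := L.B) (fun b => by
    obtain ⟨r, s, hr, e⟩ := L.birational b
    exact ⟨Ideal.Quotient.mk _ r, Ideal.Quotient.mk _ s, hne hr, by rw [Algebra.smul_def, hRB, hRB, e]⟩) (hne ha)
  have hord : Ring.ord R (Ideal.Quotient.mk _ a) =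
      Module.length A (A ⧸ (RingHom.ker φ ⊔ Ideal.span {a})) := by
    have h1 := length_quotient_span_of_surjective (Ideal.Quotient.mkₐ A (RingHom.ker φ))
      (Ideal.Quotient.mkₐ_surjective A _) a
    have h2 : RingHom.ker (Ideal.Quotient.mkₐ A (RingHom.ker φ)) = RingHom.ker φ := Ideal.mk_ker
    rw [h2] at h1
    exact (length_quotient_eq_of_surjective (R := R) (A := A) Ideal.Quotient.mk_surjective _).trans h1
  rw [← hord, key, length_quotient_eq_of_surjective (R := R) (A := A) Ideal.Quotient.mk_surjective, hRB,
    ← relLength_top, ← KrullValuations.map_mulBy_top, ← L.D.idealGE_div _ ha']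
  have h1 := L.D.relLength_idealGE A (fun i c hc => by rw [L.len_eq_zero (hmax i) hc]; exact ENat.zero_ne_top)
    0 (L.D.div _ ha') (σ := 0) fun i _ => Or.inr ⟨rfl, hmax i⟩
  have h2 : Submodule.map (KrullValuations.mulBy (0 : L.B)) ⊤ = ⊥ := by
    rw [KrullValuations.map_mulBy_top, Ideal.span_singleton_eq_bot]
  rw [zero_add, L.D.idealGE_zero, h2, sup_bot_eq] at h1
  rw [h1]
  refine Finsupp.sum_congr fun i _ => ?_
  rw [KrullValuations.len, Ideal.span_singleton_zero, sup_bot_eq, relLength_top]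

end LocalNormalization

/-! ### Orders of vanishing and restrictions of rational functions -/

section OrdAt

variable {Y : Scheme.{u}} [IsIntegral Y]

theorem algebraMap_stalk_injective (w : Y) :
    Function.Injective (algebraMap (Y.presheaf.stalk w) Y.functionField) :=
  IsFractionRing.injective (Y.presheaf.stalk w) Y.functionField

theorem restrictTo_eq {w : Y} (a : (Y.presheaf.stalk w)ˣ) {g : Y.functionField}
    (h : algebraMap (Y.presheaf.stalk w) Y.functionField (a : Y.presheaf.stalk w) = g) :
    restrictTo g w = Units.map ((Y.residue w).hom : Y.presheaf.stalk w →* Y.residueField w) a := by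
  have h' : ∃ a : (Y.presheaf.stalk w)ˣ,
      algebraMap (Y.presheaf.stalk w) Y.functionField (a : Y.presheaf.stalk w) = g := ⟨a, h⟩
  rw [restrictTo, dif_pos h']
  congr 1
  exact Units.ext (algebraMap_stalk_injective w (h'.choose_spec.trans h.symm))

theorem restrictTo_one (w : Y) : restrictTo (1 : Y.functionField) w = 1 := by
  rw [restrictTo_eq 1 (by rw [Units.val_one, map_one]), map_one]

theorem restrictTo_mul {w : Y} {f g : Y.functionField}
    (hf : ∃ a : (Y.presheaf.stalk w)ˣ,
      algebraMap (Y.presheaf.stalk w) Y.functionField (a : Y.presheaf.stalk w) = f)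
    (hg : ∃ a : (Y.presheaf.stalk w)ˣ,
      algebraMap (Y.presheaf.stalk w) Y.functionField (a : Y.presheaf.stalk w) = g) :
    restrictTo (f * g) w = restrictTo f w * restrictTo g w := by
  obtain ⟨a, ha⟩ := hf
  obtain ⟨b, hb⟩ := hg
  rw [restrictTo_eq a ha, restrictTo_eq b hb, restrictTo_eq (a * b) (by rw [Units.val_mul, map_mul, ha, hb]), map_mul]

variable [IsLocallyNoetherian Y]

theorem ordAt_mul {f g : Y.functionField} (hf : f ≠ 0) (hg : g ≠ 0) (w : Y) :
    ordAt Y (f * g) w = ordAt Y f w + ordAt Y g w := by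
  rw [ordAt_eq_ord _ _ hf, ordAt_eq_ord _ _ hg, ordAt_eq_ord _ _ (mul_ne_zero hf hg), Scheme.ord_mul hf hg]

theorem ordAt_algebraMap {w : Y} (hw : coheight w = 1) {a : Y.presheaf.stalk w} (ha : a ≠ 0) :
    ordAt Y (algebraMap (Y.presheaf.stalk w) Y.functionField a) w =
      ((Ring.ord (Y.presheaf.stalk w) a).toNat : ℤ) := by
  have : Ring.KrullDimLE 1 (Y.presheaf.stalk w) := krullDimLE_of_coheight_le hw.le
  have ha' := (map_ne_zero_iff _ (algebraMap_stalk_injective w)).mpr ha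
  rw [ordAt_eq_ord _ _ ha', Scheme.ord_eq_iff hw ha']
  change Ring.ordFrac (Y.presheaf.stalk w) _ = _
  rw [Ring.ordFrac_eq_ord _ ha]
  exact Ring.ordMonoidWithZeroHom_eq_coe _ (mem_nonZeroDivisors_of_ne_zero ha)
    (ENat.natCast_toNat (Ring.ord_ne_top (mem_nonZeroDivisors_of_ne_zero ha))).symm

theorem ordAt_eq_sub {w : Y} (hw : coheight w = 1) {g : Y.functionField} {a b : Y.presheaf.stalk w}
    (ha : a ≠ 0)
    (hb : b ≠ 0) (h : g * algebraMap (Y.presheaf.stalk w) Y.functionField b = algebraMap _ _ a) :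
    ordAt Y g w = ((Ring.ord (Y.presheaf.stalk w) a).toNat : ℤ) - ((Ring.ord (Y.presheaf.stalk w) b).toNat : ℤ) := by
  have ha' := (map_ne_zero_iff _ (algebraMap_stalk_injective w)).mpr ha
  have hb' := (map_ne_zero_iff _ (algebraMap_stalk_injective w)).mpr hb
  have hg : g ≠ 0 := by
    rintro rfl
    rw [zero_mul] at h
    exact ha' h.symm
  rw [← ordAt_algebraMap hw ha, ← ordAt_algebraMap hw hb, ← h, ordAt_mul hg hb']
  ring

theorem ordAt_unit {w : Y} (a : (Y.presheaf.stalk w)ˣ) :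
    ordAt Y (algebraMap (Y.presheaf.stalk w) Y.functionField (a : Y.presheaf.stalk w)) w = 0 := by
  by_cases hw : coheight w = 1
  · rw [ordAt_algebraMap hw a.ne_zero, Ring.ord_of_isUnit a.isUnit]
    rfl
  · exact if_neg hw

end OrdAt

/-! ### The divisor of a rational function on a subvariety, in terms of the ambient local rings -/

section Dimension

variable {X : Scheme.{u}}

theorem IsDim.lt_of_lt {a b : X} {j k : ℤ} (ha : IsDim a j) (hb : IsDim b k) (h : a < b) :
    j < k := by
  obtain ⟨m, hm, rfl⟩ := ha
  obtain ⟨n, hn, rfl⟩ := hb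
  have h1 := height_strictMono h (by rw [hm]; exact ENat.natCast_lt_top m)
  rw [hm, hn] at h1
  exact_mod_cast h1

theorem IsDim.exists_of_le {a b : X} {k : ℤ} (hb : IsDim b k) (h : a ≤ b) : ∃ j, IsDim a j := by
  obtain ⟨n, hn, rfl⟩ := hb
  have h1 := height_mono h
  rw [hn] at h1
  obtain ⟨m, hm, -⟩ := ENat.le_natCast_iff.mp h1
  exact ⟨m, m, hm, rfl⟩

theorem IsDim.between {a b c : X} {k : ℤ} (ha : IsDim a (k - 1)) (hc : IsDim c (k + 1))
    (hab : a < b) (hbc : b < c) :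
    IsDim b k := by
  obtain ⟨j, hj⟩ := hc.exists_of_le hbc.le
  have h1 := ha.lt_of_lt hj hab
  have h2 := hj.lt_of_lt hc hbc
  obtain rfl : j = k := by omega
  exact hj

theorem eq_of_le_of_not_lt {a b : X} (h : a ≤ b) (h' : ¬ a < b) : a = b := by
  by_contra hne
  exact h' (lt_of_le_not_ge h fun h1 => hne (Specializes.antisymm (show b ⤳ a from h) h1).eq.symm)

/-- If `w` is of dimension one more than `z`, each prime of the local ring at `z` strictly above that of `w` is
maximal. -/
theorem isMaximal_of_ker_specRes_lt {w z : X} (h : w ⤳ z) {k : ℤ} (hz : IsDim z k)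
    (hw : IsDim w (k + 1))
    (p : Ideal (X.presheaf.stalk z)) (hp : p.IsPrime) (hlt : RingHom.ker (specRes h) < p) :
    p.IsMaximal := by
  obtain ⟨y, hy, rfl⟩ := exists_ker_specRes_eq p
  have h1 : w ⤳ y := (ker_specRes_le_iff h hy).mp hlt.le
  have h2 : ¬ y ⤳ w := fun h2 => hlt.not_ge ((ker_specRes_le_iff hy h).mpr h2)
  have h3 : y < w := lt_of_le_not_ge h1 h2
  obtain rfl : z = y := eq_of_le_of_not_lt (show z ≤ y from hy) fun h4 => by
    obtain ⟨j, hj⟩ := hw.exists_of_le h3.le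
    have h5 := hj.lt_of_lt hw h3
    have h6 := hz.lt_of_lt hj h4
    omega
  rw [ker_specRes_self]
  infer_instance

end Dimension

section DivCoeff

variable {X : Scheme.{u}} [AlgebraicGeometry.IsNoetherian X]

/-- The multiplicity of the subvariety with generic point `z` in the Weil divisor of a rational function on
the subvariety with generic point `v`. -/
def divCoeff (v z : X) : Additive (X.residueField v)ˣ →+ ℤ where
  toFun y := Finsupp.mapDomain (subvarι v) (weilDiv v y.toMul) z
  map_zero' := by
    have h : weilDiv v 1 = 0 := by
      ext w
      have h1 : funOn v 1 = algebraMap _ _ (((1 : ((subvar v).presheaf.stalk w)ˣ)) : (subvar v).presheaf.stalk w) := by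
        simp [funOn]
      change ordAt _ (funOn v 1) w = 0
      rw [h1, ordAt_unit]
    change Finsupp.mapDomain (subvarι v) (weilDiv v 1) z = 0
    rw [h, Finsupp.mapDomain_zero]
    rfl
  map_add' x y := by
    have h : weilDiv v (x.toMul * y.toMul) = weilDiv v x.toMul + weilDiv v y.toMul := by
      ext w
      change ordAt _ (funOn v (x.toMul * y.toMul)) w = ordAt _ (funOn v x.toMul) w + ordAt _ (funOn v y.toMul) w
      rw [← ordAt_mul (funOn_ne_zero _ _) (funOn_ne_zero _ _)]
      simp [funOn]
    change Finsupp.mapDomain (subvarι v) (weilDiv v (x.toMul * y.toMul)) z = _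
    rw [h, Finsupp.mapDomain_add]
    rfl

theorem specializes_subvarι (v : X) (x : subvar v) : v ⤳ subvarι v x := by
  have h := (genericPoint_specializes x).map (subvarι v).continuous
  rwa [← subvarι_genericPoint v] at h

theorem exists_subvarι_eq {v z : X} (h : v ⤳ z) : ∃ x, subvarι v x = z :=
  h.mem_closed (subvarι v).isClosedEmbedding.isClosed_range ⟨_, (subvarι_genericPoint v).symm⟩

theorem divCoeff_subvarι (v : X) (y : (X.residueField v)ˣ) (x : subvar v) :
    divCoeff v (subvarι v x) (Additive.ofMul y) = ordAt (subvar v) (funOn v y) x :=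
  Finsupp.mapDomain_apply (subvarι v).isClosedEmbedding.injective _ _

theorem divCoeff_eq_zero {v z : X} (h : ¬ v ⤳ z) (y : Additive (X.residueField v)ˣ) :
    divCoeff v z y = 0 := by
  refine Finsupp.mapDomain_of_notMem_range _ _ ?_
  rintro ⟨x, rfl⟩
  exact h (specializes_subvarι v x)

theorem coheight_eq_one {v : X} {x : subvar v} {k : ℤ} (hx : IsDim (subvarι v x) k)
    (hv : IsDim v (k + 1)) :
    coheight x = 1 := by
  have hspec : ∀ {a b : subvar v}, a ⤳ b ↔ subvarι v a ⤳ subvarι v b := fun {a b} =>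
    (subvarι v).isClosedEmbedding.isEmbedding.specializes_iff.symm
  have hgen : ∀ a : subvar v, a ≤ genericPoint (subvar v) := fun a => genericPoint_specializes a
  refine le_antisymm ?_ ?_
  · refine coheight_le_coe_iff.mpr fun a ha => ?_
    have h1 : subvarι v x < subvarι v a := lt_of_le_not_ge (hspec.mp ha.le) fun h => ha.not_ge (hspec.mpr h)
    have h2 : subvarι v a = v := eq_of_le_of_not_lt (show _ ≤ v from specializes_subvarι v a) fun h2 => by
      obtain ⟨j, hj⟩ := hv.exists_of_le h2.le
      have h5 := hj.lt_of_lt hv h2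
      have h6 := hx.lt_of_lt hj h1
      omega
    have h3 : a = genericPoint (subvar v) :=
      (subvarι v).isClosedEmbedding.injective (h2.trans (subvarι_genericPoint v))
    have h4 : IsMax a := fun b _ => by
      rw [h3]
      exact hgen b
    rw [coheight_eq_zero.mpr h4]
    exact_mod_cast zero_lt_one
  · have h1 : x < genericPoint (subvar v) := lt_of_le_not_ge (hgen x) fun h => by
      have h2 : subvarι v x = v := by
        rw [(Specializes.antisymm (genericPoint_specializes x) h).eq.symm, ← subvarι_genericPoint v]
      rw [h2] at hx
      obtain ⟨m, hm, e⟩ := hx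
      obtain ⟨m', hm', e'⟩ := hv
      rw [hm] at hm'
      have : m = m' := by exact_mod_cast hm'
      omega
    exact le_trans le_add_self (coheight_add_one_le h1)

/-- The multiplicity of a prime divisor in the Weil divisor of a function, computed on the ambient scheme. -/
theorem divCoeff_eq {v z : X} (h : v ⤳ z) {k : ℤ} (hz : IsDim z k) (hv : IsDim v (k + 1))
    (y : (X.residueField v)ˣ) {a b : X.presheaf.stalk z} (ha : specRes h a ≠ 0)
    (hb : specRes h b ≠ 0)
    (e : y * specRes h b = specRes h a) :
    divCoeff v z (Additive.ofMul y) =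
      ((Module.length (X.presheaf.stalk z)
        (X.presheaf.stalk z ⧸ (RingHom.ker (specRes h) ⊔ Ideal.span {a}))).toNat : ℤ) -
      ((Module.length (X.presheaf.stalk z)
        (X.presheaf.stalk z ⧸ (RingHom.ker (specRes h) ⊔ Ideal.span {b}))).toNat : ℤ) := by
  obtain ⟨x, rfl⟩ := exists_subvarι_eq h
  have hx := coheight_eq_one hz hv
  have hp : ∀ c, pullFun (subvarι v) (subvarι_genericPoint v) (specRes h c) =
      algebraMap _ (subvar v).functionField ((subvarι v).stalkMap x c) := fun c => by
    rw [pullFun_specRes (subvarι v) (subvarι_genericPoint v) h x (specializes_refl _) c,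
      X.presheaf.stalkSpecializes_refl]
    rfl
  let : Algebra (X.presheaf.stalk (subvarι v x)) ((subvar v).presheaf.stalk x) :=
    ((subvarι v).stalkMap x).hom.toAlgebra
  have hsurj : Function.Surjective (algebraMap (X.presheaf.stalk (subvarι v x)) ((subvar v).presheaf.stalk x)) :=
    (subvarι v).stalkMap_surjective x
  have hker : RingHom.ker (Algebra.ofId (X.presheaf.stalk (subvarι v x)) ((subvar v).presheaf.stalk x)) =
      RingHom.ker (specRes h) := by
    ext c
    rw [RingHom.mem_ker, RingHom.mem_ker, ← map_eq_zero (pullFun (subvarι v) (subvarι_genericPoint v)), hp,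
      map_eq_zero_iff _ (algebraMap_stalk_injective x)]
    rfl
  have hord : ∀ c, Ring.ord ((subvar v).presheaf.stalk x) ((subvarι v).stalkMap x c) =
      Module.length (X.presheaf.stalk (subvarι v x))
        (X.presheaf.stalk (subvarι v x) ⧸ (RingHom.ker (specRes h) ⊔ Ideal.span {c})) := fun c => by
    have h1 := length_quotient_span_of_surjective
      (Algebra.ofId (X.presheaf.stalk (subvarι v x)) ((subvar v).presheaf.stalk x)) hsurj c
    rw [hker] at h1
    exact (length_quotient_eq_of_surjective hsurj _).trans h1
  have hne : ∀ c, specRes h c ≠ 0 → (subvarι v).stalkMap x c ≠ 0 := fun c hc h0 => by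
    have h1 := hp c
    rw [h0, map_zero, map_eq_zero] at h1
    exact hc h1
  rw [divCoeff_subvarι, ordAt_eq_sub hx (hne a ha) (hne b hb) ?_, hord, hord]
  rw [← hp, ← hp, ← e, map_mul]
  rfl

end DivCoeff

/-! ### Local computation on the normalization of a subvariety -/

section Local

variable {X : Scheme.{u}} [AlgebraicGeometry.IsNoetherian X]

/-- The residue field of the normalization at `w` is an extension of that of the image of `w`. -/
abbrev residueAlgebra (v : X) (w : normSubvar v) :
    Algebra (X.residueField (normSubvarπ v w)) ((normSubvar v).residueField w) :=
  ((normSubvarπ v).residueFieldMap w).hom.toAlgebra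

/-- The degree of a subvariety of the normalization over its image. (It would be `0` for an infinite
extension of function fields.) -/
def normDegree (v : X) (w : normSubvar v) : ℕ :=
  let _ := residueAlgebra v w
  Module.finrank (X.residueField (normSubvarπ v w)) ((normSubvar v).residueField w)

theorem specializes_normSubvarπ (v : X) (w : normSubvar v) : v ⤳ normSubvarπ v w := by
  have h := (genericPoint_specializes w).map (normSubvarπ v).continuous
  rwa [← normSubvarπ_genericPoint v] at h

/-- The normalization of the subvariety with generic point `v` near `z`. -/
abbrev NormalizationAt {v z : X} (h : v ⤳ z) :=
  LocalNormalization.{u} (specRes h) (pullFun (normSubvarπ v) (normSubvarπ_genericPoint v))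
    (fun i : PrimeDivisorsAt v z => (normSubvar v).presheaf.stalk i.1)

namespace NormalizationAt

variable {v z : X} {h : v ⤳ z} (L : NormalizationAt h) (i : PrimeDivisorsAt v z)

/-- The restriction of functions to a prime divisor of the normalization. -/
def res : L.B →+* (normSubvar v).residueField i.1 := ((normSubvar v).residue i.1).hom.comp (L.toLocal i)

theorem ker_res : RingHom.ker (res L i) = L.D.q i := by
  ext b
  rw [L.mem_q i b, RingHom.mem_ker]
  exact IsLocalRing.residue_eq_zero_iff (L.toLocal i b)

/-- The function field of a prime divisor consists of the quotients of restrictions of functions in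
`B`. -/
theorem exists_res_frac (t : (normSubvar v).residueField i.1) :
    ∃ a b, res L i b ≠ 0 ∧ t * res L i b = res L i a := by
  obtain ⟨x, rfl⟩ := (normSubvar v).residue_surjective i.1 t
  obtain ⟨a, b, hb, e⟩ := L.exists_frac i x
  refine ⟨a, b, fun h0 => hb ?_, ?_⟩
  · rw [← ker_res]
    exact h0
  · exact (map_mul ((normSubvar v).residue i.1).hom x (L.toLocal i b)).symm.trans
      (congrArg ((normSubvar v).residue i.1).hom e)

theorem toLocal_algebraMap (a : X.presheaf.stalk z) : L.toLocal i (algebraMap _ L.B a) =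
    (normSubvarπ v).stalkMap i.1 (X.presheaf.stalkSpecializes i.2.2 a) := by
  apply algebraMap_stalk_injective i.1
  rw [L.algebraMap_toLocal, L.algebraMap_algebraMap]
  exact pullFun_specRes (normSubvarπ v) _ h i.1 i.2.2 a

theorem res_algebraMap (a : X.presheaf.stalk z) : res L i (algebraMap _ L.B a) =
    (normSubvarπ v).residueFieldMap i.1 (specRes i.2.2 a) := by
  refine (congrArg ((normSubvar v).residue i.1) (toLocal_algebraMap L i a)).trans ?_
  exact (ConcreteCategory.congr_hom (Scheme.residue_residueFieldMap (normSubvarπ v) i.1) _).symm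

theorem comap_q : (L.D.q i).comap (algebraMap _ L.B) = RingHom.ker (specRes i.2.2) := by
  ext a
  rw [← ker_res, Ideal.mem_comap, RingHom.mem_ker, RingHom.mem_ker, res_algebraMap]
  exact map_eq_zero ((normSubvarπ v).residueFieldMap i.1).hom

include L in
theorem lt_normSubvarπ : normSubvarπ v i.1 < v := by
  refine lt_of_le_not_ge (specializes_normSubvarπ v i.1) fun h1 => ?_
  have h2 := L.ker_lt_comap_q i
  rw [comap_q] at h2
  exact h2.not_ge ((ker_specRes_le_iff i.2.2 h).mpr h1)

/-- A function of order zero at a prime divisor is a unit there. -/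
theorem exists_unit {u : ((normSubvar v).functionField)ˣ} (hu : L.D.v i u = 0) :
    ∃ a : ((normSubvar v).presheaf.stalk i.1)ˣ,
      algebraMap ((normSubvar v).presheaf.stalk i.1) (normSubvar v).functionField (a : _) = u := by
  obtain ⟨a, b, ha, hb, e⟩ := L.D.exists_frac_unit i hu
  have hunit : ∀ {c}, c ∉ L.D.q i → IsUnit (L.toLocal i c) := fun {c} hc => by
    by_contra h1
    exact hc ((L.mem_q i c).mpr ((IsLocalRing.mem_maximalIdeal _).mpr h1))
  refine ⟨(hunit ha).unit * (hunit hb).unit⁻¹, ?_⟩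
  have h1 : algebraMap ((normSubvar v).presheaf.stalk i.1) (normSubvar v).functionField
      ((hunit hb).unit : (normSubvar v).presheaf.stalk i.1) ≠ 0 :=
    (map_ne_zero_iff _ (algebraMap_stalk_injective i.1)).mpr (hunit hb).unit.ne_zero
  refine mul_right_cancel₀ h1 ?_
  rw [← map_mul, ← Units.val_mul, inv_mul_cancel_right, IsUnit.unit_spec, IsUnit.unit_spec,
    L.algebraMap_toLocal, L.algebraMap_toLocal, e]

theorem restrictTo_mul_res {u : ((normSubvar v).functionField)ˣ} (hu : L.D.v i u = 0) {a b : L.B}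
    (e : (u : (normSubvar v).functionField) * algebraMap L.B _ b = algebraMap L.B _ a) :
    (restrictTo (u : (normSubvar v).functionField) i.1 : (normSubvar v).residueField i.1) * res L i b = res L i a := by
  obtain ⟨c, hc⟩ := exists_unit L i hu
  rw [restrictTo_eq c hc]
  refine (map_mul ((normSubvar v).residue i.1).hom (c : (normSubvar v).presheaf.stalk i.1) (L.toLocal i b)).symm.trans
    (congrArg ((normSubvar v).residue i.1).hom ?_)
  apply algebraMap_stalk_injective i.1
  rw [map_mul, hc, L.algebraMap_toLocal, L.algebraMap_toLocal, e]

variable {n : ℤ} (hz : IsDim z (n - 1)) (hv : IsDim v (n + 1))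

include hz hv in
theorem isMaximal_of_comap_q_lt (p : Ideal (X.presheaf.stalk z)) (hp : p.IsPrime)
    (hlt : (L.D.q i).comap (algebraMap _ L.B) < p) : p.IsMaximal := by
  rw [comap_q] at hlt
  by_cases h1 : z < normSubvarπ v i.1
  · have h2 := hz.between hv h1 (lt_normSubvarπ L i)
    refine isMaximal_of_ker_specRes_lt i.2.2 hz ?_ p hp hlt
    rwa [sub_add_cancel]
  · have h2 : z = normSubvarπ v i.1 := eq_of_le_of_not_lt (show z ≤ _ from i.2.2) h1
    exfalso
    have h3 : RingHom.ker (specRes (specializes_refl z)) ≤ RingHom.ker (specRes i.2.2) :=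
      (ker_specRes_le_iff _ _).mpr (specializes_of_eq h2)
    rw [ker_specRes_self] at h3
    exact (lt_of_le_of_lt h3 hlt).not_ge (IsLocalRing.le_maximalIdeal hp.ne_top)

include hz hv in
theorem len_ne_top (c : L.B) (hc : c ∉ L.D.q i) : L.D.len (X.presheaf.stalk z) i c ≠ ⊤ :=
  LocalNormalization.len_ne_top L (fun i p hp hlt => isMaximal_of_comap_q_lt L i hz hv p hp hlt) i c hc

include hz hv in
/-- The order at `z` of the norm of a function on a prime divisor of the normalization. -/
theorem divCoeff_normTo (hlt : z < normSubvarπ v i.1) (c : L.B)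
    (t : ((normSubvar v).residueField i.1)ˣ)
    (ht : (t : (normSubvar v).residueField i.1) = res L i c) :
    divCoeff (normSubvarπ v i.1) z (Additive.ofMul (normTo (normSubvarπ v) i.1 t)) =
      ((L.D.len (X.presheaf.stalk z) i c).toNat : ℤ) := by
  let := residueAlgebra v i.1
  have hw := hz.between hv hlt (lt_normSubvarπ L i)
  have hmax := isMaximal_of_ker_specRes_lt i.2.2 hz (by rwa [sub_add_cancel])
  obtain ⟨a, b, hb, e⟩ := exists_specRes_frac i.2.2
    ((normTo (normSubvarπ v) i.1 t : _) : X.residueField (normSubvarπ v i.1))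
  have ha : specRes i.2.2 a ≠ 0 := by
    rw [← e]
    exact mul_ne_zero (Units.ne_zero _) hb
  rw [divCoeff_eq i.2.2 hz (by rwa [sub_add_cancel]) _ ha hb e]
  have hN : Algebra.norm (X.residueField (normSubvarπ v i.1)) (res L i c) * specRes i.2.2 b = specRes i.2.2 a := by
    rw [← ht, ← e]
    rfl
  have key := length_add_length_of_norm_eq (specRes i.2.2) (res L i) (res_algebraMap L i)
    (exists_specRes_frac i.2.2) (exists_res_frac L i) hmax (c := c) (ht ▸ t.ne_zero) ha hb hN
  have hfin : Module.length (X.presheaf.stalk z)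
      (X.presheaf.stalk z ⧸ (RingHom.ker (specRes i.2.2) ⊔ Ideal.span {a})) ≠ ⊤ := by
    refine length_quotient_ne_top _ fun p hp hle => hmax p hp (lt_of_le_of_ne (le_sup_left.trans hle) fun h1 => ha ?_)
    have h2 : a ∈ p := hle (Ideal.mem_sup_right (Ideal.mem_span_singleton_self a))
    rw [← h1] at h2
    exact h2
  rw [ker_res, ← relLength_top] at key
  change L.D.len _ i c + _ = _ at key
  rw [← key] at hfin ⊢
  rw [ENat.toNat_add (fun h1 => hfin (by rw [h1, top_add])) (fun h1 => hfin (by rw [h1, add_top]))]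
  push_cast
  ring

include hz hv in
/-- The numbers in the reciprocity law are the orders of the norms of the restrictions. -/
theorem chi_eq_divCoeff (hlt : z < normSubvarπ v i.1) {u : ((normSubvar v).functionField)ˣ}
    (hu : L.D.v i u = 0) :
    L.D.chi (X.presheaf.stalk z) i u = divCoeff (normSubvarπ v i.1) z
      (Additive.ofMul (normTo (normSubvarπ v) i.1 (restrictTo (u : (normSubvar v).functionField) i.1))) := by
  obtain ⟨a, b, ha, hb, e⟩ := L.D.exists_frac_unit i hu
  have hne : ∀ {c}, c ∉ L.D.q i → res L i c ≠ 0 := fun hc h0 => hc (by rw [← ker_res]; exact h0)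
  have h1 := restrictTo_mul_res L i hu e
  have h2 : restrictTo (u : (normSubvar v).functionField) i.1 = Units.mk0 _ (hne ha) / Units.mk0 _ (hne hb) := by
    rw [eq_div_iff_mul_eq']
    exact Units.ext h1
  rw [h2, map_div, ofMul_div, map_sub, divCoeff_normTo L i hz hv hlt a _ rfl,
    divCoeff_normTo L i hz hv hlt b _ rfl, L.D.chi_eq _ (fun i => len_ne_top L i hz hv) i ha hb e]

/-- A prime divisor of the normalization whose image is the closure of `z` itself does not contribute to
the reciprocity law, since its ideal is maximal. -/
theorem chi_eq_zero (hlt : ¬ z < normSubvarπ v i.1) (u : ((normSubvar v).functionField)ˣ)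
    (hu : L.D.v i u = 0)
    (hfin : ∀ i, ∀ c ∉ L.D.q i, L.D.len (X.presheaf.stalk z) i c ≠ ⊤) :
    L.D.chi (X.presheaf.stalk z) i u = 0 := by
  have h2 : z = normSubvarπ v i.1 := eq_of_le_of_not_lt (show z ≤ _ from i.2.2) hlt
  have hmax : (L.D.q i).IsMaximal := by
    refine L.isMaximal_q ?_
    rw [comap_q, le_antisymm ((ker_specRes_le_iff _ _).mpr i.2.2)
      ((ker_specRes_le_iff (specializes_refl z) i.2.2).mpr (specializes_of_eq h2)), ker_specRes_self]
    infer_instance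
  obtain ⟨a, b, ha, hb, e⟩ := L.D.exists_frac_unit i hu
  rw [L.D.chi_eq _ hfin i ha hb e, L.len_eq_zero hmax ha, L.len_eq_zero hmax hb, sub_self]

end NormalizationAt

end Local

/-! ### The reciprocity law on a subvariety -/

theorem finsum_subtype_of_eq_zero {α M : Type*} [AddCommMonoid M] {p : α → Prop} {f : α → M}
    (h : ∀ x, ¬ p x → f x = 0) : ∑ᶠ x : Subtype p, f x = ∑ᶠ x, f x := by
  rw [finsum_subtype_eq_finsum_cond]
  refine finsum_congr fun x => ?_
  by_cases hx : p x
  · simp [hx]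
  · simp [hx, h x hx]

section Tame

variable {X : Scheme.{u}} [AlgebraicGeometry.IsNoetherian X]

/-- The norm of the restriction to the prime divisor `w` of the normalization of the tame symbol
of two rational functions. -/
def tameNorm (v : X) (x y : (X.residueField v)ˣ) (w : normSubvar v) :
    (X.residueField (normSubvarπ v w))ˣ :=
  normTo (normSubvarπ v) w (restrictTo
    (funOnNorm v y ^ ordAt _ (funOnNorm v x) w / funOnNorm v x ^ ordAt _ (funOnNorm v y) w) w)

theorem funOnNorm_ne_zero (v : X) (y : (X.residueField v)ˣ) : funOnNorm v y ≠ 0 :=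
  (map_ne_zero _).mpr y.ne_zero

theorem funOnNorm_mul (v : X) (x y : (X.residueField v)ˣ) :
    funOnNorm v (x * y) = funOnNorm v x * funOnNorm v y := by
  simp [funOnNorm]

theorem tameNorm_of_ordAt_eq_zero {v : X} {x y : (X.residueField v)ˣ} {w : normSubvar v}
    (hx : ordAt _ (funOnNorm v x) w = 0) (hy : ordAt _ (funOnNorm v y) w = 0) : tameNorm v x y w = 1 := by
  rw [tameNorm, hx, hy, zpow_zero, zpow_zero, div_one, restrictTo_one, map_one]

variable {k : Type u} [Field k] (str : X ⟶ Spec (.of k)) [LocallyOfFiniteType str]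

include str

/-- The tame symbol is a unit at `w`, so that its restriction to `w` is not the default value `1`. -/
theorem exists_unit_tame {v : X} (x y : (X.residueField v)ˣ) {w : normSubvar v}
    (hw : coheight w = 1) :
    ∃ a : ((normSubvar v).presheaf.stalk w)ˣ,
      algebraMap ((normSubvar v).presheaf.stalk w) (normSubvar v).functionField (a : _) =
        funOnNorm v y ^ ordAt _ (funOnNorm v x) w / funOnNorm v x ^ ordAt _ (funOnNorm v y) w := by
  obtain ⟨L, hL⟩ := exists_localNormalization str (specializes_normSubvarπ v w)
  let i : PrimeDivisorsAt v (normSubvarπ v w) := ⟨w, hw, specializes_refl _⟩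
  obtain ⟨a, ha⟩ := NormalizationAt.exists_unit L i (L.D.v_tame i (Units.mk0 _ (funOnNorm_ne_zero v y))
    (Units.mk0 _ (funOnNorm_ne_zero v x)))
  refine ⟨a, ha.trans ?_⟩
  rw [KrullValuations.tame, hL, Units.val_div_eq_div_val, Units.val_zpow_eq_zpow_val, Units.val_zpow_eq_zpow_val]
  rfl

theorem tameNorm_mul {v : X} (x y y' : (X.residueField v)ˣ) {w : normSubvar v}
    (hw : coheight w = 1) :
    tameNorm v x (y * y') w = tameNorm v x y w * tameNorm v x y' w := by
  have := isNoetherian_normSubvar str v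
  rw [tameNorm, tameNorm, tameNorm, ← map_mul, ← restrictTo_mul (exists_unit_tame str x y hw) (exists_unit_tame str x y' hw)]
  congr 2
  rw [funOnNorm_mul, ordAt_mul (funOnNorm_ne_zero v y) (funOnNorm_ne_zero v y'), mul_zpow,
    zpow_add₀ (funOnNorm_ne_zero v x)]
  field_simp

/-- The reciprocity law: at each point `z` of codimension two, the orders of the norms of the tame symbols
of two rational functions at the prime divisors of the normalization sum up to zero. -/
theorem finsum_divCoeff_tameNorm {v z : X} {n : ℤ} (hz : IsDim z (n - 1)) (hv : IsDim v (n + 1))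
    (x y : (X.residueField v)ˣ) :
    ∑ᶠ w : {w : normSubvar v // coheight w = 1 ∧ IsDim (normSubvarπ v w) n},
      divCoeff (normSubvarπ v w.1) z (Additive.ofMul (tameNorm v x y w.1)) = 0 := by
  classical
  by_cases h : v ⤳ z
  swap
  · refine finsum_eq_zero_of_forall_eq_zero fun w => divCoeff_eq_zero (fun h1 => h ?_) _
    exact (specializes_normSubvarπ v w.1).trans h1
  obtain ⟨L, hL⟩ := exists_localNormalization str h
  have hfin := fun i => NormalizationAt.len_ne_top L i hz hv
  let f := Units.mk0 _ (funOnNorm_ne_zero v y)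
  let g := Units.mk0 _ (funOnNorm_ne_zero v x)
  have htame : ∀ i, ((L.D.tame i f g : ((normSubvar v).functionField)ˣ) : (normSubvar v).functionField) =
      funOnNorm v y ^ ordAt _ (funOnNorm v x) i.1 / funOnNorm v x ^ ordAt _ (funOnNorm v y) i.1 := fun i => by
    rw [KrullValuations.tame, hL, Units.val_div_eq_div_val, Units.val_zpow_eq_zpow_val, Units.val_zpow_eq_zpow_val]
    rfl
  let T : normSubvar v → ℤ := fun w => if coheight w = 1 ∧ IsDim (normSubvarπ v w) n then
    divCoeff (normSubvarπ v w) z (Additive.ofMul (tameNorm v x y w)) else 0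
  have hchi : ∀ i : PrimeDivisorsAt v z, L.D.chi (X.presheaf.stalk z) i (L.D.tame i f g) = T i.1 := fun i => by
    by_cases hlt : z < normSubvarπ v i.1
    · have h1 := hz.between hv hlt (NormalizationAt.lt_normSubvarπ L i)
      refine (NormalizationAt.chi_eq_divCoeff L i hz hv hlt (L.D.v_tame i f g)).trans ?_
      rw [htame]
      exact (if_pos ⟨i.2.1, h1⟩).symm
    · refine (NormalizationAt.chi_eq_zero L i hlt _ (L.D.v_tame i f g) hfin).trans (if_neg fun h1 => ?_).symm
      have h2 : z = normSubvarπ v i.1 := eq_of_le_of_not_lt (show z ≤ _ from i.2.2) hlt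
      rw [← h2] at h1
      obtain ⟨-, m, hm, e⟩ := h1
      obtain ⟨m', hm', e'⟩ := hz
      rw [hm] at hm'
      have : m = m' := by exact_mod_cast hm'
      omega
  -- the sum over the prime divisors of dimension `n` and the one over those whose images contain `z` have the same
  -- nonzero terms
  have h0 := L.D.tameSum_eq_zero (X.presheaf.stalk z) hfin f g
  rw [KrullValuations.tameSum, finsum_congr hchi, finsum_subtype_of_eq_zero (f := T)] at h0
  · rw [← h0, ← finsum_subtype_of_eq_zero (p := fun w => coheight w = 1 ∧ IsDim (normSubvarπ v w) n) (f := T)]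
    · exact finsum_congr fun w => (if_pos w.2).symm
    · exact fun w hw => if_neg hw
  · intro w hw
    by_cases h1 : coheight w = 1 ∧ IsDim (normSubvarπ v w) n
    · refine (if_pos h1).trans (divCoeff_eq_zero (fun h2 => hw ⟨h1.1, h2⟩) _)
    · exact if_neg h1

end Tame

/-! ### Push-forward of the divisor of a function from the normalization -/

section OrderSum

variable {X : Scheme.{u}} [AlgebraicGeometry.IsNoetherian X]

namespace NormalizationAt

variable {v z : X} {h : v ⤳ z} (L : NormalizationAt h)

/-- If the prime divisor `i` maps onto the closure of `z`, then `B / q i` is its function field. -/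
theorem length_quotient_q (i : PrimeDivisorsAt v z)
    (hmax : ((L.D.q i).comap (algebraMap (X.presheaf.stalk z) L.B)).IsMaximal) :
    Module.length (X.presheaf.stalk z) (L.B ⧸ L.D.q i) = normDegree v i.1 := by
  let := residueAlgebra v i.1
  let : Algebra (X.presheaf.stalk z) (X.residueField (normSubvarπ v i.1)) := (specRes i.2.2).toAlgebra
  let : Algebra (X.presheaf.stalk z) ((normSubvar v).residueField i.1) :=
    ((res L i).comp (algebraMap (X.presheaf.stalk z) L.B)).toAlgebra
  have : IsScalarTower (X.presheaf.stalk z) (X.residueField (normSubvarπ v i.1)) ((normSubvar v).residueField i.1) :=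
    IsScalarTower.of_algebraMap_eq fun a => res_algebraMap L i a
  have hsurj₁ : Function.Surjective (algebraMap (X.presheaf.stalk z) (X.residueField (normSubvarπ v i.1))) := fun t => by
    obtain ⟨a, b, hb, e⟩ := exists_specRes_frac i.2.2 t
    rw [comap_q] at hmax
    obtain ⟨c, d, hd, hc⟩ := hmax.exists_inv (x := b) hb
    have h1 : specRes i.2.2 c * specRes i.2.2 b = 1 := by
      have h2 := congrArg (specRes i.2.2) hc
      rwa [map_add, map_mul, map_one, (RingHom.mem_ker).mp hd, add_zero] at h2
    refine ⟨a * c, ?_⟩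
    change specRes i.2.2 (a * c) = t
    rw [map_mul, ← e, mul_assoc, mul_comm (specRes i.2.2 b), h1, mul_one]
  have hsurj₂ : Function.Surjective (res L i) := fun t => by
    obtain ⟨a, b, hb, e⟩ := exists_res_frac L i t
    have hb' : b ∉ L.D.q i := by
      rw [← ker_res]
      exact hb
    obtain ⟨c, d, hd, hc⟩ := (L.isMaximal_q hmax).exists_inv hb'
    rw [← ker_res] at hd
    have h1 : res L i c * res L i b = 1 := by
      have h2 := congrArg (res L i) hc
      rwa [map_add, map_mul, map_one, (RingHom.mem_ker).mp hd, add_zero] at h2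
    refine ⟨a * c, ?_⟩
    rw [map_mul, ← e, mul_assoc, mul_comm (res L i b), h1, mul_one]
  let ρ : L.B →ₐ[X.presheaf.stalk z] (normSubvar v).residueField i.1 :=
    { res L i with commutes' := fun _ => rfl }
  have hρ : RingHom.ker ρ = L.D.q i := ker_res L i
  have e : (L.B ⧸ L.D.q i) ≃ₗ[X.presheaf.stalk z] (normSubvar v).residueField i.1 := by
    rw [← hρ]
    exact (Ideal.quotientKerAlgEquivOfSurjective (f := ρ) hsurj₂).toLinearEquiv
  have : Module.Finite (X.presheaf.stalk z) ((normSubvar v).residueField i.1) :=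
    Module.Finite.of_surjective ρ.toLinearMap hsurj₂
  have : Module.Finite (X.residueField (normSubvarπ v i.1)) ((normSubvar v).residueField i.1) :=
    Module.Finite.of_restrictScalars_finite (X.presheaf.stalk z) _ _
  rw [e.length_eq, Module.length_eq_of_surjective hsurj₁, Module.length_eq_finrank]
  rfl

/-- The length of the local ring modulo `a`, if `z` is of codimension one. -/
theorem length_eq_finsum (hdim : ∀ p : Ideal (X.presheaf.stalk z), p.IsPrime → RingHom.ker (specRes h) < p → p.IsMaximal)
    {a : X.presheaf.stalk z} (ha : specRes h a ≠ 0) :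
    ((Module.length (X.presheaf.stalk z)
      (X.presheaf.stalk z ⧸ (RingHom.ker (specRes h) ⊔ Ideal.span {a}))).toNat : ℤ) =
      ∑ᶠ i, L.D.v i (algebraMap L.B _ (algebraMap _ L.B a)) * normDegree v i.1 := by
  have hcomap : ∀ i, ((L.D.q i).comap (algebraMap (X.presheaf.stalk z) L.B)).IsMaximal := fun i => by
    have := L.D.prime i
    exact hdim _ inferInstance (L.ker_lt_comap_q i)
  have ha' : algebraMap _ L.B a ≠ 0 := fun h0 => ha (L.algebraMap_eq_zero_iff.mp h0)
  have h1 := L.length_eq_sum (fun i => L.isMaximal_q (hcomap i)) hdim ha ha'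
  have h2 : (L.D.div _ ha').sum (fun i k => (k : ℕ∞) * Module.length (X.presheaf.stalk z) (L.B ⧸ L.D.q i)) =
      (((L.D.div _ ha').sum fun i k => k * normDegree v i.1 : ℕ) : ℕ∞) := by
    rw [Finsupp.sum, Finsupp.sum, Nat.cast_sum]
    exact Finset.sum_congr rfl fun i _ => by rw [length_quotient_q L i (hcomap i), Nat.cast_mul]
  rw [h1, h2, ENat.toNat_natCast, Finsupp.sum, Nat.cast_sum, finsum_eq_sum_of_support_subset (s := (L.D.div _ ha').support)]
  · refine Finset.sum_congr rfl fun i _ => ?_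
    rw [Nat.cast_mul, L.D.div_apply]
    rfl
  · intro i hi
    rw [Finset.mem_coe, Finsupp.mem_support_iff]
    intro h0
    have h3 := L.D.div_apply _ ha' i
    rw [h0] at h3
    refine hi ?_
    change L.D.ν i (algebraMap _ L.B a) * _ = 0
    rw [← h3, Nat.cast_zero, zero_mul]

end NormalizationAt

variable {k : Type u} [Field k] (str : X ⟶ Spec (.of k)) [LocallyOfFiniteType str]

include str

/-- The divisor of a function is the push-forward of the divisor of its pull-back to the normalization. -/
theorem divCoeff_eq_finsum {v z : X} (h : v ⤳ z) {n : ℤ} (hz : IsDim z n) (hv : IsDim v (n + 1))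
    (y : (X.residueField v)ˣ) : open scoped Classical in
    divCoeff v z (Additive.ofMul y) = ∑ᶠ w : normSubvar v,
      if normSubvarπ v w = z then ordAt _ (funOnNorm v y) w * (normDegree v w : ℤ) else 0 := by
  classical
  obtain ⟨L, hL⟩ := exists_localNormalization str h
  have hdim := isMaximal_of_ker_specRes_lt h hz hv
  obtain ⟨a, b, hb, e⟩ := exists_specRes_frac h (y : X.residueField v)
  have ha : specRes h a ≠ 0 := by
    rw [← e]
    exact mul_ne_zero y.ne_zero hb
  have hne : ∀ {c}, specRes h c ≠ 0 → algebraMap L.B (normSubvar v).functionField (algebraMap _ L.B c) ≠ 0 := fun hc => by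
    rw [L.algebraMap_algebraMap]
    exact (map_ne_zero _).mpr hc
  have hy : ∀ i, L.D.v i (funOnNorm v y) + L.D.v i (algebraMap L.B _ (algebraMap _ L.B b)) =
      L.D.v i (algebraMap L.B _ (algebraMap _ L.B a)) := fun i => by
    rw [← L.D.map_mul i (funOnNorm_ne_zero v y) (hne hb)]
    congr 1
    rw [L.algebraMap_algebraMap, L.algebraMap_algebraMap, ← e, map_mul]
    rfl
  have hfs : ∀ {f}, f ≠ 0 → (Function.support fun i : PrimeDivisorsAt v z => L.D.v i f * (normDegree v i.1 : ℤ)).Finite :=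
    fun hf => (L.D.finite hf).subset fun i hi h0 => hi (by simp only [h0, zero_mul])
  rw [divCoeff_eq h hz hv y ha hb e, NormalizationAt.length_eq_finsum L hdim ha,
    NormalizationAt.length_eq_finsum L hdim hb, ← finsum_sub_distrib (hfs (hne ha)) (hfs (hne hb)),
    ← finsum_subtype_of_eq_zero (p := fun w => coheight w = 1 ∧ normSubvarπ v w ⤳ z)]
  · refine finsum_congr fun i => ?_
    have hi : normSubvarπ v i.1 = z :=
      (eq_of_le_of_not_lt (show z ≤ normSubvarπ v i.1 from i.2.2) fun h1 => by
        obtain ⟨j, hj⟩ := hv.exists_of_le (NormalizationAt.lt_normSubvarπ L i).le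
        have h2 := hj.lt_of_lt hv (NormalizationAt.lt_normSubvarπ L i)
        have h3 := hz.lt_of_lt hj h1
        omega).symm
    rw [if_pos hi, ← hy i, hL]
    ring
  · intro w hw
    by_cases h1 : normSubvarπ v w = z
    · rw [if_pos h1, show ordAt _ (funOnNorm v y) w = 0 from if_neg fun h2 => hw ⟨h2, specializes_of_eq h1⟩, zero_mul]
    · exact if_neg h1

end OrderSum

/-! ### The intersection operation commutes with the boundary map -/

theorem finsum_subtype_eq_sum {α M : Type*} [AddCommMonoid M] {p : α → Prop} [DecidablePred p]
    {f : α → M} {s : Finset α}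
    (h : ∀ x, p x → x ∉ s → f x = 0) : ∑ᶠ x : Subtype p, f x = ∑ x ∈ s, if p x then f x else 0 := by
  rw [← finsum_eq_sum_of_support_subset (f := fun x => if p x then f x else 0),
    ← finsum_subtype_of_eq_zero (p := p) (f := fun x => if p x then f x else 0)]
  · exact finsum_congr fun x => (if_pos x.2).symm
  · exact fun x hx => if_neg hx
  · intro x hx
    by_contra hs
    refine hx ?_
    by_cases hp : p x
    · exact (if_pos hp).trans (h x hp hs)
    · exact if_neg hp

theorem boundary_of_apply {X : Scheme.{u}} [AlgebraicGeometry.IsNoetherian X] (S : Closeds X)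
    (k : ℤ) (v : Subvar S (k + 1)) (y : Additive (X.residueField v.1)ˣ) (z : Subvar S k) :
    open scoped Classical in
    boundary S k (DirectSum.of (fun v : Subvar S (k + 1) => Additive (X.residueField v.1)ˣ) v y) z =
      divCoeff v.1 z.1 y := by
  classical
  rw [boundary]
  exact DFunLike.congr_fun (DirectSum.toAddMonoid_of _ _ _) z

namespace PDivisor

variable {X : Scheme.{u}} [AlgebraicGeometry.IsNoetherian X] [IsIntegral X] (D : PDivisor X)

theorem mem_supp {v : X} : v ∈ D.supp ↔ v ∉ D.U' := by
  change v ∈ cartierSupport D.U D.x ↔ _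
  rw [D.support_eq]
  rfl

theorem mem_U {v : X} (hv : v ∈ D.supp) : v ∈ D.U := by
  have h : v ∈ D.U ⊔ D.U' := by
    rw [D.cover]
    trivial
  exact h.resolve_right (D.mem_supp.mp hv)

theorem mem_supp_of_specializes {v w : X} (h : v ⤳ w) (hv : v ∈ D.supp) : w ∈ D.supp :=
  h.mem_closed D.supp.isClosed hv

/-- Where it is a unit, the local defining function of the restriction of `D` to a subvariety is restricted to the local
defining functions of the restrictions of `D` to smaller subvarieties. -/
theorem exists_unit_funAt {v : X} (w : normSubvar v) (hw : normSubvarπ v w ∈ D.U ⊓ D.U') :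
    ∃ c : ((normSubvar v).presheaf.stalk w)ˣ,
      algebraMap ((normSubvar v).presheaf.stalk w) (normSubvar v).functionField (c : _) = funOnNorm v (D.funAt v) ∧
      (normSubvar v).residue w (c : (normSubvar v).presheaf.stalk w) =
        (normSubvarπ v).residueFieldMap w (D.funAt (normSubvarπ v w) : X.residueField (normSubvarπ v w)) := by
  have h := specializes_normSubvarπ v w
  have hv : v ∈ D.U ⊓ D.U' := h.mem_open (D.U ⊓ D.U').isOpen hw
  let s : (X.presheaf.stalk (normSubvarπ v w))ˣ :=
    Units.map ((X.presheaf.germ (D.U ⊓ D.U') _ hw).hom : _ →* X.presheaf.stalk (normSubvarπ v w)) D.sec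
  have h1 : (D.funAt v : X.residueField v) = specRes h s := by
    rw [funAt, dif_pos hv]
    exact (specRes_germ h hw _).symm
  have h2 : (D.funAt (normSubvarπ v w) : X.residueField (normSubvarπ v w)) = X.residue _ (s : X.presheaf.stalk _) := by
    rw [funAt, dif_pos hw]
    rfl
  refine ⟨Units.map (((normSubvarπ v).stalkMap w).hom : _ →* (normSubvar v).presheaf.stalk w) s, ?_, ?_⟩
  · rw [funOnNorm, h1, pullFun_specRes (normSubvarπ v) _ h w (specializes_refl _), X.presheaf.stalkSpecializes_refl]
    rfl
  · rw [h2]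
    exact (ConcreteCategory.congr_hom (Scheme.residue_residueFieldMap (normSubvarπ v) w) _).symm

omit [AlgebraicGeometry.IsNoetherian X] [IsIntegral X] in
theorem normTo_eq_pow {v : X} (w : normSubvar v) {c : ((normSubvar v).residueField w)ˣ}
    {t : (X.residueField (normSubvarπ v w))ˣ}
    (h : (c : (normSubvar v).residueField w) = (normSubvarπ v).residueFieldMap w (t : X.residueField (normSubvarπ v w))) :
    normTo (normSubvarπ v) w c = t ^ normDegree v w := by
  let := residueAlgebra v w
  apply Units.ext
  rw [Units.val_pow_eq_pow_val]
  change Algebra.norm (X.residueField (normSubvarπ v w)) (c : (normSubvar v).residueField w) = _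
  rw [h]
  exact Algebra.norm_algebraMap _

variable {k : Type u} [Field k] (str : X ⟶ Spec (.of k)) [LocallyOfFiniteType str]

include str in
/-- Outside `|D|`, the local equation `x` of `D` is a unit, so that the tame symbol at `w` of `x` and `y` is
the power of `x` with exponent `-ord_w y`, and the norm of `x` is a power of `x` with exponent the degree of
`w` over its image. -/
theorem divCoeff_tameNorm_funAt {v : X} (y : (X.residueField v)ˣ) (w : normSubvar v) {z : X}
    (hz : z ∈ D.supp)
    (hw : normSubvarπ v w ∉ D.supp) :
    divCoeff (normSubvarπ v w) z (Additive.ofMul (tameNorm v (D.funAt v) y w)) =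
      -(ordAt _ (funOnNorm v y) w * normDegree v w *
        divCoeff (normSubvarπ v w) z (Additive.ofMul (D.funAt (normSubvarπ v w)))) := by
  have := isNoetherian_normSubvar str v
  by_cases h : normSubvarπ v w ⤳ z
  swap
  · rw [divCoeff_eq_zero h, divCoeff_eq_zero h, mul_zero, neg_zero]
  have hw' : normSubvarπ v w ∈ D.U ⊓ D.U' := ⟨h.mem_open D.U.isOpen (D.mem_U hz), by
    rw [D.mem_supp, not_not] at hw
    exact hw⟩
  obtain ⟨c, hc, hc'⟩ := D.exists_unit_funAt w hw'
  have h0 : ordAt _ (funOnNorm v (D.funAt v)) w = 0 := by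
    rw [← hc, ordAt_unit]
  have h1 : tameNorm v (D.funAt v) y w = ((D.funAt (normSubvarπ v w)) ^ normDegree v w) ^ (-ordAt _ (funOnNorm v y) w) := by
    rw [tameNorm, h0, restrictTo_eq (c ^ (-ordAt _ (funOnNorm v y) w)), map_zpow, map_zpow, normTo_eq_pow w hc']
    have h2 := congrArg Units.val (map_zpow (Units.map (algebraMap ((normSubvar v).presheaf.stalk w)
      (normSubvar v).functionField : _ →* (normSubvar v).functionField)) c (-ordAt _ (funOnNorm v y) w))
    rw [Units.val_zpow_eq_zpow_val] at h2
    refine h2.trans ?_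
    rw [zpow_zero, zpow_neg, one_div, ← hc]
    rfl
  rw [h1, ofMul_zpow, ofMul_pow, map_zsmul, map_nsmul]
  simp only [smul_eq_mul, nsmul_eq_mul]
  ring

/-- Along `|D|`, the divisor of the restriction of `D` to a subvariety is that of the local equation. -/
theorem toCycle_restrictDiv {w : X} {n : ℤ} (z : Subvar D.supp (n - 1)) :
    toCycle D.supp (n - 1) w (D.restrictDiv w) z = divCoeff w z.1 (Additive.ofMul (D.funAt w)) := by
  change Finsupp.mapDomain (subvarι w) (D.restrictDiv w) z.1 = _
  by_cases h : w ⤳ z.1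
  · obtain ⟨x, hx⟩ := exists_subvarι_eq h
    have hz := D.mem_U z.2.1
    rw [← hx] at hz ⊢
    rw [divCoeff_subvarι, Finsupp.mapDomain_apply (subvarι w).isClosedEmbedding.injective]
    exact if_pos hz
  · rw [divCoeff_eq_zero h]
    refine Finsupp.mapDomain_of_notMem_range _ _ ?_
    rintro ⟨x, hx⟩
    exact h (hx ▸ specializes_subvarι w x)

theorem cap_apply {n : ℤ} (β : Z (⊤ : Closeds X) n) (z : Subvar D.supp (n - 1)) :
    open scoped Classical in
    D.cap n β z = β.sum fun w m =>
      m * if w.1 ∈ D.supp then 0 else divCoeff w.1 z.1 (Additive.ofMul (D.funAt w.1)) := by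
  classical
  rw [cap, Finsupp.liftAddHom_apply, Finsupp.sum, Finsupp.sum, Finsupp.finsetSum_apply]
  refine Finset.sum_congr rfl fun w _ => ?_
  rw [zmultiplesHom_apply, Finsupp.smul_apply, smul_eq_mul]
  split_ifs
  · rfl
  · rw [toCycle_restrictDiv]

end PDivisor

namespace PDivisor

variable {X : Scheme.{u}} [AlgebraicGeometry.IsNoetherian X] [IsIntegral X] (D : PDivisor X)
variable {k : Type u} [Field k] (str : X ⟶ Spec (.of k)) [LocallyOfFiniteType str]

include str

omit [IsIntegral X] in
theorem finite_tameNorm_ne_one {v : X} (x y : (X.residueField v)ˣ) :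
    {w | tameNorm v x y w ≠ 1}.Finite := by
  have := isNoetherian_normSubvar str v
  refine ((ordAt_support_finite _ _ (funOnNorm_ne_zero v x)).union (ordAt_support_finite _ _ (funOnNorm_ne_zero v y))).subset
    fun w hw => ?_
  by_contra h
  rw [Set.mem_union, Function.mem_support, Function.mem_support, not_or, not_not, not_not] at h
  exact hw (tameNorm_of_ordAt_eq_zero h.1 h.2)

omit str [LocallyOfFiniteType str] in
/-- The contribution of a prime divisor `w` of the normalization to the intersection `D · y`. -/
def capTerm (n : ℤ) (v : Subvar (⊤ : Closeds X) (n + 1)) (y : (X.residueField v.1)ˣ)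
    (w : {w : normSubvar v.1 // coheight w = 1 ∧ normSubvarπ v.1 w ∈ D.supp ∧ IsDim (normSubvarπ v.1 w) (n - 1 + 1)}) :
    W D.supp (n - 1) :=
  open scoped Classical in
  DirectSum.of (fun v : Subvar D.supp (n - 1 + 1) => Additive (X.residueField v.1)ˣ)
    ⟨normSubvarπ v.1 w.1, w.2.2⟩ (Additive.ofMul (tameNorm v.1 (D.funAt v.1) y w.1))

omit str [LocallyOfFiniteType str] in
theorem capRatSingle_eq_finsum {n : ℤ} {v : Subvar (⊤ : Closeds X) (n + 1)} (hv : v.1 ∉ D.supp)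
    (y : (X.residueField v.1)ˣ) : D.capRatSingle n v y = ∑ᶠ w, D.capTerm n v y w :=
  if_neg hv

theorem finite_support_capTerm {n : ℤ} (v : Subvar (⊤ : Closeds X) (n + 1))
    (y : (X.residueField v.1)ˣ) :
    (Function.support (D.capTerm n v y)).Finite := by
  refine ((finite_tameNorm_ne_one str (D.funAt v.1) y).preimage Subtype.val_injective.injOn).subset fun w hw h => hw ?_
  rw [capTerm, h, ofMul_one, map_zero]

theorem capTerm_mul {n : ℤ} (v : Subvar (⊤ : Closeds X) (n + 1)) (y y' : (X.residueField v.1)ˣ)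
    (w) :
    D.capTerm n v (y * y') w = D.capTerm n v y w + D.capTerm n v y' w := by
  classical
  rw [capTerm, capTerm, capTerm, tameNorm_mul str _ _ _ w.2.1, ofMul_mul, map_add]

theorem capRatSingle_mul {n : ℤ} (v : Subvar (⊤ : Closeds X) (n + 1))
    (y y' : (X.residueField v.1)ˣ) :
    D.capRatSingle n v (y * y') = D.capRatSingle n v y + D.capRatSingle n v y' := by
  by_cases hv : v.1 ∈ D.supp
  · rw [capRatSingle, capRatSingle, capRatSingle, if_pos hv, if_pos hv, if_pos hv, add_zero]
  · rw [D.capRatSingle_eq_finsum hv, D.capRatSingle_eq_finsum hv, D.capRatSingle_eq_finsum hv,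
      ← finsum_add_distrib (D.finite_support_capTerm str v y) (D.finite_support_capTerm str v y')]
    exact finsum_congr fun w => D.capTerm_mul str v y y' w

/-- The map `y ↦ D · y` on `k(V)^*` as a homomorphism. -/
def capRatSingleHom (n : ℤ) (v : Subvar (⊤ : Closeds X) (n + 1)) :
    Additive (X.residueField v.1)ˣ →+ W D.supp (n - 1) :=
  AddMonoidHom.mk' (fun y => D.capRatSingle n v y.toMul) fun y y' => D.capRatSingle_mul str v y.toMul y'.toMul

/-- The intersection operation on rational equivalences as a homomorphism. -/
def capRatHom (n : ℤ) : W (⊤ : Closeds X) n →+ W D.supp (n - 1) :=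
  open scoped Classical in
  DirectSum.toAddMonoid fun v => D.capRatSingleHom str n v

theorem capRat_eq (n : ℤ) (α : W (⊤ : Closeds X) n) : D.capRat n α = D.capRatHom str n α := by
  classical
  refine Eq.symm ((DFinsupp.sumAddHom_apply (fun v => D.capRatSingleHom str n v) α).trans ?_)
  rw [DFinsupp.sum, capRat]
  rfl

/-- The coefficient of `∂(D · y)` at `z` as a sum over the prime divisors of the normalization over `|D|`. -/
theorem boundary_capRatSingle_apply {n : ℤ} {v : Subvar (⊤ : Closeds X) (n + 1)} (hv : v.1 ∉ D.supp)
    (y : (X.residueField v.1)ˣ) (z : Subvar D.supp (n - 1)) :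
    boundary D.supp (n - 1) (D.capRatSingle n v y) z =
      ∑ᶠ w : {w : normSubvar v.1 // coheight w = 1 ∧ normSubvarπ v.1 w ∈ D.supp ∧ IsDim (normSubvarπ v.1 w) (n - 1 + 1)},
        divCoeff (normSubvarπ v.1 w.1) z.1 (Additive.ofMul (tameNorm v.1 (D.funAt v.1) y w.1)) := by
  classical
  rw [D.capRatSingle_eq_finsum hv]
  refine (((Finsupp.applyAddHom z).comp (boundary D.supp (n - 1))).map_finsum
    (D.finite_support_capTerm str v y)).trans (finsum_congr fun w => ?_)
  exact boundary_of_apply D.supp (n - 1) ⟨normSubvarπ v.1 w.1, w.2.2⟩ _ z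

/-- The coefficient of `D · ∂y` at `z` as a sum over the prime divisors of the normalization: the divisor of
`y` is the push-forward of that of its pull-back, and the prime divisors over `|D|` are killed by `D`. The
sum is taken over any finite set `s` that contains the zeros and poles of `y`. -/
theorem cap_boundary_apply {n : ℤ} (v : Subvar (⊤ : Closeds X) (n + 1)) (y : (X.residueField v.1)ˣ)
    (z : Subvar D.supp (n - 1)) (s : Finset (normSubvar v.1))
    (hs : ∀ w, ordAt _ (funOnNorm v.1 y) w ≠ 0 → w ∈ s) :
    open scoped Classical in
    D.cap n (toCycle ⊤ n v.1 (weilDiv v.1 y)) z = ∑ w ∈ s, if IsDim (normSubvarπ v.1 w) n ∧ normSubvarπ v.1 w ∉ D.supp then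
      ordAt _ (funOnNorm v.1 y) w * normDegree v.1 w *
        divCoeff (normSubvarπ v.1 w) z.1 (Additive.ofMul (D.funAt (normSubvarπ v.1 w))) else 0 := by
  classical
  set β := toCycle ⊤ n v.1 (weilDiv v.1 y) with hβ
  let c : X → ℤ := fun w => if w ∈ D.supp then 0 else divCoeff w z.1 (Additive.ofMul (D.funAt w))
  let G : normSubvar v.1 → ℤ := fun w => ordAt _ (funOnNorm v.1 y) w * normDegree v.1 w
  have hβ' : ∀ w, β w = ∑ x ∈ s, if normSubvarπ v.1 x = w.1 then G x else 0 := fun w => by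
    change divCoeff v.1 w.1 (Additive.ofMul y) = _
    by_cases h : v.1 ⤳ w.1
    · rw [divCoeff_eq_finsum str h w.2.2 v.2.2]
      refine finsum_eq_sum_of_support_subset _ fun x hx => hs x fun h0 => hx ?_
      simp only [h0, zero_mul, ite_self]
    · rw [divCoeff_eq_zero h]
      refine (Finset.sum_eq_zero fun x _ => if_neg fun h1 => h ?_).symm
      rw [← h1]
      exact specializes_normSubvarπ v.1 x
  have hfin : {w : Subvar (⊤ : Closeds X) n | ∃ x ∈ s, normSubvarπ v.1 x = w.1}.Finite :=
    ((s.finite_toSet.image (normSubvarπ v.1)).preimage Subtype.val_injective.injOn).subset fun w hw => hw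
  set T : Finset (Subvar (⊤ : Closeds X) n) := β.support ∪ hfin.toFinset with hT
  rw [cap_apply]
  refine (Finsupp.sum_of_support_subset β (s := T) Finset.subset_union_left _ ?_).trans ?_
  · exact fun w _ => zero_mul (if w.1 ∈ D.supp then 0 else divCoeff w.1 z.1 (Additive.ofMul (D.funAt w.1)))
  have h1 : ∀ w ∈ T, (β w * if w.1 ∈ D.supp then 0 else divCoeff w.1 z.1 (Additive.ofMul (D.funAt w.1))) =
      ∑ x ∈ s, if normSubvarπ v.1 x = w.1 then G x * c (normSubvarπ v.1 x) else 0 := fun w _ => by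
    rw [hβ', Finset.sum_mul]
    refine Finset.sum_congr rfl fun x _ => ?_
    by_cases h : normSubvarπ v.1 x = w.1
    · rw [if_pos h, if_pos h, h]
    · rw [if_neg h, if_neg h, zero_mul]
  rw [Finset.sum_congr rfl h1, Finset.sum_comm]
  refine Finset.sum_congr rfl fun x hx => ?_
  by_cases hd : IsDim (normSubvarπ v.1 x) n
  · rw [Finset.sum_eq_single ⟨normSubvarπ v.1 x, trivial, hd⟩]
    · rw [if_pos rfl]
      by_cases hD : normSubvarπ v.1 x ∈ D.supp
      · rw [if_neg fun h => h.2 hD]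
        simp only [c, if_pos hD, mul_zero]
      · rw [if_pos ⟨hd, hD⟩]
        simp only [c, if_neg hD, G]
    · exact fun w _ hw => if_neg fun h => hw (Subtype.ext h.symm)
    · exact fun h => absurd (Finset.mem_union_right _ (hfin.mem_toFinset.mpr ⟨x, hx, rfl⟩)) h
  · rw [if_neg fun h => hd h.1]
    refine Finset.sum_eq_zero fun w _ => if_neg fun h => hd ?_
    rw [h]
    exact w.2.2

/-- `∂(D · y) = D · ∂y` for a rational function `y` on a subvariety. In the reciprocity law for `y` and the
local equation of `D`, the prime divisors over `|D|` contribute `∂(D · y)` and the other ones `-D · ∂y`. -/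
theorem boundary_capRatSingle {n : ℤ} (v : Subvar (⊤ : Closeds X) (n + 1))
    (y : (X.residueField v.1)ˣ) :
    boundary D.supp (n - 1) (D.capRatSingle n v y) = D.cap n (toCycle ⊤ n v.1 (weilDiv v.1 y)) := by
  classical
  ext z
  by_cases hv : v.1 ∈ D.supp
  · rw [capRatSingle, if_pos hv, map_zero, cap_apply]
    refine (Finset.sum_eq_zero fun w _ => ?_).symm
    beta_reduce
    by_cases h : v.1 ⤳ w.1
    · rw [if_pos (D.mem_supp_of_specializes h hv), mul_zero]
    · have h1 : toCycle ⊤ n v.1 (weilDiv v.1 y) w = 0 := divCoeff_eq_zero h (Additive.ofMul y)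
      rw [h1, zero_mul]
  have := isNoetherian_normSubvar str v.1
  let x := D.funAt v.1
  let T : normSubvar v.1 → ℤ := fun w => divCoeff (normSubvarπ v.1 w) z.1 (Additive.ofMul (tameNorm v.1 x y w))
  let s : Finset (normSubvar v.1) := ((ordAt_support_finite _ _ (funOnNorm_ne_zero v.1 x)).union
    (ordAt_support_finite _ _ (funOnNorm_ne_zero v.1 y))).toFinset
  have hs : ∀ w, w ∉ s → ordAt _ (funOnNorm v.1 x) w = 0 ∧ ordAt _ (funOnNorm v.1 y) w = 0 := fun w hw => by
    rw [Set.Finite.mem_toFinset, Set.mem_union, Function.mem_support, Function.mem_support, not_or, not_not, not_not] at hw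
    exact hw
  have hT : ∀ w, w ∉ s → T w = 0 := fun w hw => by
    change divCoeff _ _ (Additive.ofMul (tameNorm v.1 x y w)) = 0
    rw [tameNorm_of_ordAt_eq_zero (hs w hw).1 (hs w hw).2, ofMul_one, map_zero]
  -- all the sums are taken over the finite set `s` of the zeros and poles of `x` and `y`
  have hrec := finsum_divCoeff_tameNorm str z.2.2 v.2.2 x y
  rw [finsum_subtype_eq_sum (f := T) fun w _ hw => hT w hw] at hrec
  rw [D.boundary_capRatSingle_apply str hv, finsum_subtype_eq_sum (f := T) fun w _ hw => hT w hw,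
    D.cap_boundary_apply str v y z s fun w hw => by_contra fun h => hw (hs w h).2, ← sub_eq_zero, ← Finset.sum_sub_distrib]
  refine Eq.trans (Finset.sum_congr rfl fun w _ => ?_) hrec
  rw [sub_add_cancel]
  by_cases hw : coheight w = 1 ∧ IsDim (normSubvarπ v.1 w) n
  · rw [if_pos hw]
    by_cases hD : normSubvarπ v.1 w ∈ D.supp
    · rw [if_pos ⟨hw.1, hD, hw.2⟩, if_neg fun h => h.2 hD, sub_zero]
    · rw [if_neg fun h => hD h.2.1, if_pos ⟨hw.2, hD⟩, zero_sub]
      exact (D.divCoeff_tameNorm_funAt str y w z.2.1 hD).symm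
  -- points `w` which are not of codimension one have `ord_w y = 0` by convention
  · rw [if_neg hw, if_neg fun h => hw ⟨h.1, h.2.2⟩, zero_sub, neg_eq_zero]
    by_cases hd : IsDim (normSubvarπ v.1 w) n ∧ normSubvarπ v.1 w ∉ D.supp
    · rw [if_pos hd, show ordAt _ (funOnNorm v.1 y) w = 0 from if_neg fun h => hw ⟨h, hd.1⟩, zero_mul, zero_mul]
    · exact if_neg hd

theorem boundary_capRat (n : ℤ) (α : W (⊤ : Closeds X) n) :
    boundary D.supp (n - 1) (D.capRat n α) = D.cap n (boundary ⊤ n α) := by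
  classical
  rw [capRat_eq D str]
  refine DFunLike.congr_fun (f := (boundary D.supp (n - 1)).comp (D.capRatHom str n)) (g := (D.cap n).comp (boundary ⊤ n)) ?_ α
  refine DirectSum.addHom_ext fun v y => ?_
  change boundary D.supp (n - 1) (D.capRatHom str n _) = D.cap n (boundary ⊤ n _)
  rw [capRatHom, boundary, DirectSum.toAddMonoid_of, boundary, DirectSum.toAddMonoid_of]
  exact D.boundary_capRatSingle str v y.toMul

end PDivisor

end DivisorIntersection

end

theorem mainTheorem4 {k : Type u} [Field k] (V : DivisorIntersection.Variety k)
    (D : DivisorIntersection.PDivisor V.X) (n : ℤ) :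
    -- the map on rational equivalences is a homomorphism of groups
    (∀ α β : DivisorIntersection.W (⊤ : Closeds V.X) n,
      D.capRat n (α + β) = D.capRat n α + D.capRat n β) ∧
    -- the square commutes
    (∀ α : DivisorIntersection.W (⊤ : Closeds V.X) n,
      DivisorIntersection.boundary D.supp (n - 1) (D.capRat n α) =
        D.cap n (DivisorIntersection.boundary ⊤ n α)) ∧
    -- intersection with `D` passes to the Chow groups
    ∃ c : DivisorIntersection.Chow (⊤ : Closeds V.X) n →+ DivisorIntersection.Chow D.supp (n - 1),
      ∀ z : DivisorIntersection.Z (⊤ : Closeds V.X) n,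
        c (QuotientAddGroup.mk z) = QuotientAddGroup.mk (D.cap n z) := by
  have hom : ∀ α β : DivisorIntersection.W (⊤ : Closeds V.X) n,
      D.capRat n (α + β) = D.capRat n α + D.capRat n β := fun α β => by
    rw [D.capRat_eq V.str, D.capRat_eq V.str, D.capRat_eq V.str, map_add]
  have comm := fun α => D.boundary_capRat V.str n α
  refine ⟨hom, comm, QuotientAddGroup.map _ _ (D.cap n) ?_, fun z => rfl⟩
  rintro _ ⟨α, rfl⟩
  exact ⟨D.capRat n α, comm α⟩
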